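/- **Setting.** For every $n$ let $x=(x_1,\dots,x_{p_n})^\top$ be a covariate vector with $x_0:=1$. The training and test inputs have densities $f^{tr},f^{te}$ (depending on $n$) with a common support with respect to a dominating measure, and $y$ has the same conditional law given $x$ in both populations (covariate shift). Put $w=f^{te}/f^{tr}\in(0,\infty)$ on the support. Let $y^{te}(x)=\alpha+\beta^\top x$ be the best linear predictor of $y^{te}$ from $x^{te}$ (misspecification is allowed), and $\varepsilon^{te}=y^{te}-y^{te}(x^{te})$, $\varepsilon^{tr}=y^{tr}-y^{te}(x^{tr})$. The training sample is $(x^{tr}_t,y^{tr}_t)$, $t\le n$, with $\varepsilon^{tr}_t=y^{tr}_t-y^{te}(x^{tr}_t)$. Let $\Sigma^{te}=\mathrm{Cov}(x^{te})$. Put $c_n=(\log p_n/n)^{1/2}$; $d_n=c_n^{2q/(1+q)}(\log n)^{1/\eta+1/2}$ if $0<q\le1$ and $d_n=c_n$ if $q>1$; $b_n=M_wc_n^{-2/(1+q)}$ if $0<q\le 1$ and $b_n=M_wc_n^{-1}(\log n)^{-M_\eta}$ if $q>1$, with $M_w>0$ and $M_\eta\ge 1/\eta+1/2$. Let $v(x)=\min\{w(x),b_n\}$,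 let $\hat w(\cdot)\ge0$ be any estimate of $w$, built from the training data and possibly further information independent of $x^{te}$, and let $\hat v(x)=\min\{\hat w(x),b_n\}$, $\hat w_t=\hat v(x^{tr}_t)/(n^{-1}\sum_s\hat v(x^{tr}_s))$. **Procedure.** For a model $J\subset\{1,\dots,p_n\}$ let $\check y^{te}(x|J)=\check\alpha(J)+\check\beta(J)^\top x_J$ be the least squares predictor (with intercept) with weights $\hat w_t$, and $(\check\sigma^{te}(J))^2=n^{-1}\sum_t\hat w_t(y^{tr}_t-\check y^{te}(x^{tr}_t|J))^2$. Let $\hat\mu_j=n^{-1}\sum_t\hat w_tx^{tr}_{tj}$ and $\hat\sigma_{jj}=n^{-1}\sum_t\hat w_t(x^{tr}_{tj}-\hat\mu_j)^2$. IWOGA starts from $\check J_0=\emptyset$ and puts $\check J_{m+1}=\check J_m\cup\{\check\jmath\}$, where $\check\jmath$ maximizes $|n^{-1}\sum_t\hat w_t(y^{tr}_t-\check y^{te}(x^{tr}_t|\check J_m))(x^{tr}_{tj}-\hat\mu_j)|/\hat\sigma_{jj}^{1/2}$ over $j\notin\check J_m$. With $K_n=\lfloor M_kd_n^{-1}\rfloor$,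 let $\check k$ minimize $\mathrm{HDIWIC}_s(\check J_k)=(1+s_a(\sharp\check J_k+1)d_n^2)(\check\sigma^{te}(\check J_k))^2$ over $1\le k\le\min(K_n,p_n)$. Ties are broken arbitrarily. **Assumptions.** 1. $\log p_n=O(n^\gamma)$ for some $\gamma\in(0,1)$, and $p_n\to\infty$. 2. For some $\theta_0>0$, $\eta\in(0,2]$: $\limsup_n E\exp(\theta_0|\varepsilon^{tr}|^\eta)<\infty$, $\limsup_nE\exp(\theta_0|\varepsilon^{te}|^\eta)<\infty$, $\limsup_n\max_{0\le i,j\le p_n}E\exp(\theta_0|x^{te}_ix^{te}_j|)<\infty$; moreover $\liminf_nE(\varepsilon^{te})^2>0$. 3. $\limsup_nE[w(x^{te})^q]<\infty$ for some $q>0$ (the $q$ used in $d_n$, $b_n$). 4. $(\varepsilon^{tr}_t,x^{tr}_t)$, $1\le t\le n$, are i.i.d. 5. $\sup_n(|\alpha|+\|\beta\|_2)<\infty$, and for some $\xi\ge0$, $C_\xi>0$: $\|\beta_J\|_1\le C_\xi\|\beta_J\|_2^{2\xi/(2\xi+1)}$ for all $n$ and all $J$. 6. For a constant $C^{te}_\Sigma$: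 $\|(\Sigma^{te}_{J,J})^{-1}\sigma^{te}_{J,j}\|_1\le C^{te}_\Sigma$ for all $n$, all $1\le\sharp J\le K_n$ and $j\notin J$, where $\sigma^{te}_{J,j}$ is the part in $J$ of the $j$th column of $\Sigma^{te}$. 7. $\lambda_{\min}(\Sigma^{te})\ge C^{te}_{\lambda+}$ for all $n$, for a constant $C^{te}_{\lambda+}>0$. 8. For some constant $C>0$, $$P\Big(\max_{0\le i\le j\le p_n}\Big|\frac1n\sum_{t=1}^n(v(x^{tr}_t)-\hat v(x^{tr}_t))x^{tr}_{ti}x^{tr}_{tj}\Big|\ge Cd_n\Big)=o(1),\quad P\Big(\max_{0\le i\le p_n}\Big|\frac1n\sum_{t=1}^n(v(x^{tr}_t)-\hat v(x^{tr}_t))x^{tr}_{ti}\varepsilon^{tr}_t\Big|\ge Cd_n\Big)=o(1),$$ $$\frac1n\sum_{t=1}^n(v(x^{tr}_t)-\hat v(x^{tr}_t))(\varepsilon^{tr}_t)^2=o_p(1).$$ **Theorem.** If $M_k>0$ is sufficiently small, then for all sufficiently large $s_a$ (how small and how large does not depend on $\xi$ and $C_\xi$), $$\frac{E_n\big[(y^{te}(x^{te})-\check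 y^{te}(x^{te}|\check J_{\check k}))^2\big]}{d_n^{(1+2\xi)/(1+\xi)}}=O_p(1),$$ where $E_n$ is the conditional expectation given the training data and the information used to build $\hat v$, of which $x^{te}$ is independent. -/

import Mathlib

open MeasureTheory ProbabilityTheory Filter Topology Matrix
open scoped ENNReal

noncomputable section

namespace IWOGA

/-! ### The population: covariate shift -/

/-- A pair of laws (training, test) of `(x, y)`, `x ∈ ℝ^p`, `y ∈ ℝ`, under covariate shift:
the training and test inputs have densities `ftr`, `fte` with respect to a dominating
`σ`-finite measure `ν` (e.g. Lebesgue measure), the densities have a common support, and the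
conditional law `condY` of `y` given `x` is the same for both. -/
structure ShiftModel (p : ℕ) where
  ν : Measure (Fin p → ℝ)
  ftr : (Fin p → ℝ) → ℝ
  fte : (Fin p → ℝ) → ℝ
  condY : Kernel (Fin p → ℝ) ℝ
  sigmaFinite : SigmaFinite ν
  markov : IsMarkovKernel condY
  measurable_ftr : Measurable ftr
  measurable_fte : Measurable fte
  ftr_nonneg : ∀ u, 0 ≤ ftr u
  fte_nonneg : ∀ u, 0 ≤ fte u
  lintegral_ftr : ∫⁻ u, ENNReal.ofReal (ftr u) ∂ν = 1
  lintegral_fte : ∫⁻ u, ENNReal.ofReal (fte u) ∂ν = 1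
  common_support : ∀ u, 0 < ftr u ↔ 0 < fte u

namespace ShiftModel

variable {p : ℕ} (M : ShiftModel p)

/-- Law of the training input. -/
def trainX : Measure (Fin p → ℝ) := M.ν.withDensity (fun u => ENNReal.ofReal (M.ftr u))

/-- Law of the test input. -/
def testX : Measure (Fin p → ℝ) := M.ν.withDensity (fun u => ENNReal.ofReal (M.fte u))

/-- Joint law of the training pair `(x, y)`. -/
def trainLaw : Measure ((Fin p → ℝ) × ℝ) := M.trainX ⊗ₘ M.condY

/-- Joint law of the test pair `(x, y)`. -/
def testLaw : Measure ((Fin p → ℝ) × ℝ) := M.testX ⊗ₘ M.condY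

/-- The importance `w = fte / ftr`; it is positive and finite on the common support. -/
def w (u : Fin p → ℝ) : ℝ := M.fte u / M.ftr u

instance isProbabilityMeasure_trainX : IsProbabilityMeasure M.trainX :=
  ⟨by simp [trainX, M.lintegral_ftr]⟩

instance isProbabilityMeasure_testX : IsProbabilityMeasure M.testX :=
  ⟨by simp [testX, M.lintegral_fte]⟩

instance isProbabilityMeasure_trainLaw : IsProbabilityMeasure M.trainLaw := by
  have := M.markov
  unfold trainLaw
  infer_instance

instance isProbabilityMeasure_testLaw : IsProbabilityMeasure M.testLaw := by
  have := M.markov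
  unfold testLaw
  infer_instance

/-- Covariance matrix of the test input. -/
def SigmaTe : Matrix (Fin p) (Fin p) ℝ :=
  Matrix.of fun i j =>
    covariance (fun u : Fin p → ℝ => u i) (fun u : Fin p → ℝ => u j) M.testX

end ShiftModel

/-- The residual `y - (a + bᵀ x)` of a linear predictor at the pair `z = (x, y)`. -/
def residual {p : ℕ} (a : ℝ) (b : Fin p → ℝ) (z : (Fin p → ℝ) × ℝ) : ℝ :=
  z.2 - (a + b ⬝ᵥ z.1)

/-- `(a, b)` are the coefficients of the best linear predictor of `y` in the test population,
under the full model (all of `x` and `y` being square integrable). -/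
def ShiftModel.IsBestLinearPredictor {p : ℕ} (M : ShiftModel p) (a : ℝ) (b : Fin p → ℝ) :
    Prop :=
  MemLp (fun z : (Fin p → ℝ) × ℝ => z.2) 2 M.testLaw ∧
  (∀ j, MemLp (fun z : (Fin p → ℝ) × ℝ => z.1 j) 2 M.testLaw) ∧
  ∀ (a' : ℝ) (b' : Fin p → ℝ),
    ∫ z, (residual a b z) ^ 2 ∂M.testLaw ≤ ∫ z, (residual a' b' z) ^ 2 ∂M.testLaw

/-- `(1, x_1, …, x_p)`, i.e. `x` with the coordinate `x_0 = 1` added. -/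
def aug {p : ℕ} (u : Fin p → ℝ) : Fin (p + 1) → ℝ := Fin.cons 1 u

/-- `‖b_J‖₁`. -/
def l1On {p : ℕ} (b : Fin p → ℝ) (J : Finset (Fin p)) : ℝ := ∑ j ∈ J, |b j|

/-- `‖b_J‖₂`. -/
def l2On {p : ℕ} (b : Fin p → ℝ) (J : Finset (Fin p)) : ℝ := √(∑ j ∈ J, (b j) ^ 2)

/-- `‖(Σ_{J,J})⁻¹ σ_{J,j}‖₁`, where `σ_{J,j}` is the part in `J` of the `j`th column of `Σ`. -/
def partialL1 {p : ℕ} (S : Matrix (Fin p) (Fin p) ℝ) (J : Finset (Fin p)) (j : Fin p) : ℝ :=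
  ∑ i : J, |((S.submatrix (fun i : J => (i : Fin p)) (fun i : J => (i : Fin p)))⁻¹ *ᵥ
    (fun i : J => S i j)) i|

/-! ### Rates and tuning sequences -/

/-- `c_n = (log p_n / n)^{1/2}`. -/
def cRate (p : ℕ → ℕ) (n : ℕ) : ℝ := √(Real.log (p n) / n)

/-- `d_n = d_n(q)`. -/
def dRate (p : ℕ → ℕ) (q η : ℝ) (n : ℕ) : ℝ :=
  if q ≤ 1 then cRate p n ^ (2 * q / (1 + q)) * Real.log n ^ (1 / η + 1 / 2) else cRate p n

/-- The trimming parameter `b_n = b_n(q)`. -/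
def bTrim (p : ℕ → ℕ) (q Mw Mη : ℝ) (n : ℕ) : ℝ :=
  if q ≤ 1 then Mw * cRate p n ^ (-(2 / (1 + q)))
  else Mw * (cRate p n)⁻¹ * Real.log n ^ (-Mη)

/-- The upper bound `K_n` for the number of iterations: the integer part of `M_k / d_n`. -/
def maxIter (p : ℕ → ℕ) (q η Mk : ℝ) (n : ℕ) : ℕ := ⌊Mk / dRate p q η n⌋₊

/-! ### Weighted least squares, the greedy algorithm and the information criterion -/

section Sample

variable {n p : ℕ}

/-- Weights normalized by their sample mean: `v_t / (n⁻¹ ∑ v_s)`. -/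
def normWeight (v : Fin n → ℝ) (t : Fin n) : ℝ := v t / ((n : ℝ)⁻¹ * ∑ s, v s)

/-- `n⁻¹ ∑ w_t f_t`. -/
def wMean (w f : Fin n → ℝ) : ℝ := (n : ℝ)⁻¹ * ∑ t, w t * f t

/-- Weighted mean of the `j`th covariate. -/
def muX (w : Fin n → ℝ) (x : Fin n → Fin p → ℝ) (j : Fin p) : ℝ := wMean w fun t => x t j

/-- Weighted sample covariance matrix of the covariates. -/
def sigmaHat (w : Fin n → ℝ) (x : Fin n → Fin p → ℝ) : Matrix (Fin p) (Fin p) ℝ :=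
  Matrix.of fun i j => wMean w fun t => (x t i - muX w x i) * (x t j - muX w x j)

/-- Weighted sample covariance between the `j`th covariate and the response. -/
def sHat (w : Fin n → ℝ) (x : Fin n → Fin p → ℝ) (y : Fin n → ℝ) (j : Fin p) : ℝ :=
  wMean w fun t => (x t j - muX w x j) * (y t - wMean w y)

/-- Weighted least squares slope of model `J`. -/
def betaHat (w : Fin n → ℝ) (x : Fin n → Fin p → ℝ) (y : Fin n → ℝ) (J : Finset (Fin p)) :
    J → ℝ :=
  ((sigmaHat w x).submatrix (fun i : J => (i : Fin p)) (fun i : J => (i : Fin p)))⁻¹ *ᵥ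
    (fun j : J => sHat w x y j)

/-- Weighted least squares intercept of model `J`. -/
def alphaHat (w : Fin n → ℝ) (x : Fin n → Fin p → ℝ) (y : Fin n → ℝ) (J : Finset (Fin p)) : ℝ :=
  wMean w y - ∑ j : J, betaHat w x y J j * muX w x j

/-- Weighted least squares predictor of model `J` at the point `u`. -/
def predict (w : Fin n → ℝ) (x : Fin n → Fin p → ℝ) (y : Fin n → ℝ) (J : Finset (Fin p))
    (u : Fin p → ℝ) : ℝ :=
  alphaHat w x y J + ∑ j : J, betaHat w x y J j * u j

/-- Weighted residual mean square of model `J`. -/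
def resVar (w : Fin n → ℝ) (x : Fin n → Fin p → ℝ) (y : Fin n → ℝ) (J : Finset (Fin p)) : ℝ :=
  wMean w fun t => (y t - predict w x y J (x t)) ^ 2

/-- The greedy criterion: weighted inner product of the current residual with the `j`th
(weight-centred) covariate, divided by the weighted standard deviation of that covariate. -/
def score (w : Fin n → ℝ) (x : Fin n → Fin p → ℝ) (y : Fin n → ℝ) (J : Finset (Fin p))
    (j : Fin p) : ℝ :=
  wMean w (fun t => (y t - predict w x y J (x t)) * (x t j - muX w x j)) /
    √(sigmaHat w x j j)

/-- `J 0, J 1, …, J m` is the sequence of models selected by the (importance-weighted)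
orthogonal greedy algorithm with weights `w` in its first `m` iterations; ties are broken
arbitrarily. -/
def IsGreedyPath (w : Fin n → ℝ) (x : Fin n → Fin p → ℝ) (y : Fin n → ℝ) (m : ℕ)
    (J : ℕ → Finset (Fin p)) : Prop :=
  J 0 = ∅ ∧ ∀ k < m, ∃ j ∉ J k, J (k + 1) = insert j (J k) ∧
    ∀ i ∉ J k, |score w x y (J k) i| ≤ |score w x y (J k) j|

/-- The high-dimensional importance-weighted information criterion of model `J`. -/
def hdiwic (sa d : ℝ) (w : Fin n → ℝ) (x : Fin n → Fin p → ℝ) (y : Fin n → ℝ)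
    (J : Finset (Fin p)) : ℝ :=
  (1 + sa * ((J.card : ℝ) + 1) * d ^ 2) * resVar w x y J

/-- `k` minimizes the criterion over `J 1, …, J m`; ties are broken arbitrarily. -/
def IsCriterionMin (sa d : ℝ) (w : Fin n → ℝ) (x : Fin n → Fin p → ℝ) (y : Fin n → ℝ) (m : ℕ)
    (J : ℕ → Finset (Fin p)) (k : ℕ) : Prop :=
  1 ≤ k ∧ k ≤ m ∧
    ∀ l, 1 ≤ l → l ≤ m → hdiwic sa d w x y (J k) ≤ hdiwic sa d w x y (J l)

/-- The modified conditional prediction error `E_n[(y^te(x^te) - ŷ(x^te | J))²]`, where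
`y^te(u) = a + bᵀ u`: the test input is independent of the sample and of the weights, so the
conditional expectation integrates over the law of the test input, the sample, the weights and
the model being held fixed. -/
def mcpe (M : ShiftModel p) (a : ℝ) (b : Fin p → ℝ) (w : Fin n → ℝ) (x : Fin n → Fin p → ℝ)
    (y : Fin n → ℝ) (J : Finset (Fin p)) : ℝ :=
  ∫ u, ((a + b ⬝ᵥ u) - predict w x y J u) ^ 2 ∂M.testX

end Sample

/-! ### Stochastic order symbols -/

/-- `Z_n = O_p(1)`. -/
def IsBigOpOne {Ω : ℕ → Type*} [∀ n, MeasurableSpace (Ω n)] (P : ∀ n, Measure (Ω n))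
    (Z : ∀ n, Ω n → ℝ) : Prop :=
  ∀ ε : ℝ, 0 < ε → ∃ B : ℝ, ∀ᶠ n in atTop, P n {ω | B < |Z n ω|} ≤ ENNReal.ofReal ε

/-- `Z_n = o_p(1)`. -/
def IsLittleOpOne {Ω : ℕ → Type*} [∀ n, MeasurableSpace (Ω n)] (P : ∀ n, Measure (Ω n))
    (Z : ∀ n, Ω n → ℝ) : Prop :=
  ∀ δ : ℝ, 0 < δ → Tendsto (fun n => P n {ω | δ ≤ |Z n ω|}) atTop (𝓝 0)

end IWOGA

end

/-! ### Exponential deviation bounds for sample means -/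

section Deviation

/-! Let δ be the best linear slope minus the slope fitted in a model J (extended by zero), S the
test covariance matrix, Ŝ its weighted sample version and r the weighted sample covariance of
covariates and noise. By the algebra of weighted least squares (`resVar_eq`, `score_eq`, `mcpe_eq`)
the residual variance of J is a term free of J plus the excess D = δᵀŜδ + 2δᵀr, the greedy scores
are the normalized entries of Ŝδ + r, and the prediction error is Q = δᵀSδ plus a squared mean of
order d². Hence the theorem is deterministic on the event `SampleAccuracy` that the weighted moments
are within a multiple of d of the test moments (`exists_mcpe_le`); probability is needed only to
show that this event becomes certain (`tendsto_measure_not_sampleAccuracy`).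

Probability: an average weighted by min(w, b) has a trimming bias controlled by the q-th moment of
w. Its fluctuation obeys a Chernoff bound in which one factor of the weight changes the training law
into the test law and the other is kept below b. The rates d and b balance bias, variance and
exponential range (`exists_eventually_rateRelations`), so that one average fails at scale d with
probability of order p^(-4), which survives a union bound over pairs of covariates. Estimated
weights enter through the approximation conditions.

Determinism: write s for the ℓ₁ norm of the omitted true coefficients. For models of size at most a
small multiple of 1/d, Ŝ stays coercive and the ℓ₁ norm of δ is of order |J|d + s
(`sum_abs_error_le`), so D and Q differ by order |J|d² + d s(1 + s). A greedy step lowers D by the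
squared score g² (`excess_insert_le`), and Q is at most of order s·g plus the same error, because Ŝδ
+ r vanishes on J and δ equals the true slope off J (`quadratic_le_of_normal`). Sparsity and the
eigenvalue bound give s of order at most Q^((1-κ)/2) with κ = 1/(2ξ+1). So as long as Q exceeds a
multiple of ρ = d^((1+2ξ)/(1+ξ)), the excess satisfies D' ≤ D - cD^(1+κ) and after m steps is of
order m^(-1/κ). This reaches ρ at m of order d^(-1/(1+ξ)), where md² is also of order ρ
(`exists_greedy_excess_le`).

The criterion compares its minimizer with this m without knowing ξ. For large penalty factor the
penalty outweighs the error |J|d² of the selected model, and Q of order ρ follows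
(`exists_criterion_excess_le`). -/

lemma Real.exp_le_one_add_add_sq_mul_exp_abs (u : ℝ) :
    Real.exp u ≤ 1 + u + u ^ 2 * Real.exp |u| := by
  -- For |u| ≤ 1 this is the Taylor remainder. For u > 1 the quadratic term alone dominates; for u <
  -- -1 the left side is below 1 while u + u² is nonnegative.
  rcases le_or_gt |u| 1 with h | h
  · have h1 := (abs_le.mp (Real.abs_exp_sub_one_sub_id_le h)).2
    have h2 : u ^ 2 * 1 ≤ u ^ 2 * Real.exp |u| :=
      mul_le_mul_of_nonneg_left (Real.one_le_exp (abs_nonneg u)) (sq_nonneg u)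
    linarith
  · rcases lt_abs.mp h with h1 | h1
    · rw [abs_of_pos (by linarith)]
      have h3 : 1 * Real.exp u ≤ u ^ 2 * Real.exp u := by
        gcongr; nlinarith
      linarith
    · have h2 : Real.exp u ≤ 1 := Real.exp_le_one_iff.mpr (by linarith)
      have h3 : u ^ 2 * 1 ≤ u ^ 2 * Real.exp |u| :=
        mul_le_mul_of_nonneg_left (Real.one_le_exp (abs_nonneg u)) (sq_nonneg u)
      nlinarith

variable {S : Type*} [MeasurableSpace S]

/-- Moment bounds are carried as lower Lebesgue integrals, which make sense before integrability is
known; their finiteness then yields it. -/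
lemma integrable_of_lintegral_ofReal_le {μ : Measure S} {f g : S → ℝ} {H : ℝ}
    (hf : Measurable f) (hfg : ∀ z, |f z| ≤ g z)
    (hH : ∫⁻ z, ENNReal.ofReal (g z) ∂μ ≤ ENNReal.ofReal H) : Integrable f μ := by
  refine ⟨hf.aestronglyMeasurable, ?_⟩
  rw [hasFiniteIntegral_iff_norm]
  calc ∫⁻ z, ENNReal.ofReal ‖f z‖ ∂μ ≤ ∫⁻ z, ENNReal.ofReal (g z) ∂μ :=
        lintegral_mono fun z => ENNReal.ofReal_le_ofReal (hfg z)
    _ ≤ _ := hH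
    _ < ⊤ := ENNReal.ofReal_lt_top

lemma integral_le_of_lintegral_ofReal_le {μ : Measure S} {f : S → ℝ} {H : ℝ} (hH0 : 0 ≤ H)
    (hf : Measurable f) (hf0 : ∀ z, 0 ≤ f z)
    (hH : ∫⁻ z, ENNReal.ofReal (f z) ∂μ ≤ ENNReal.ofReal H) : ∫ z, f z ∂μ ≤ H := by
  rw [integral_eq_lintegral_of_nonneg_ae (Eventually.of_forall hf0) hf.aestronglyMeasurable]
  exact ENNReal.toReal_le_of_le_ofReal hH0 hH

/-- Moment generating function bound under an exponentially weighted second moment. -/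
lemma integral_exp_centered_le {μ : Measure S} [IsProbabilityMeasure μ] {f : S → ℝ}
    (hf : Measurable f) {l H : ℝ} (hH0 : 0 ≤ H)
    (hH : ∫⁻ z, ENNReal.ofReal ((l * f z) ^ 2 * Real.exp |l * f z|) ∂μ
      ≤ ENNReal.ofReal (l ^ 2 * H)) :
    Integrable (fun z => Real.exp (l * (f z - ∫ z, f z ∂μ))) μ ∧
    ∫ z, Real.exp (l * (f z - ∫ z, f z ∂μ)) ∂μ ≤ Real.exp (l ^ 2 * H) := by
  set g : S → ℝ := fun z => l * f z with hg
  have hgm : Measurable g := hf.const_mul l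
  have hqm : Measurable fun z => g z ^ 2 * Real.exp |g z| := by fun_prop
  have hq0 : ∀ z, 0 ≤ g z ^ 2 * Real.exp |g z| := fun z => by positivity
  have hqi : Integrable (fun z => g z ^ 2 * Real.exp |g z|) μ :=
    integrable_of_lintegral_ofReal_le hqm (fun z => (abs_of_nonneg (hq0 z)).le) hH
  have hsq : ∀ z, g z ^ 2 ≤ g z ^ 2 * Real.exp |g z| := fun z => by
    have := mul_le_mul_of_nonneg_left (Real.one_le_exp (abs_nonneg (g z))) (sq_nonneg (g z))
    linarith
  have hgi : Integrable g μ := by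
    refine ((integrable_const 1).add hqi).mono' hgm.aestronglyMeasurable
      (Eventually.of_forall fun z => ?_)
    have h1 := hsq z
    have h2 : |g z| ≤ 1 + g z ^ 2 := by
      rw [← sq_abs]; nlinarith [sq_nonneg (|g z| - 1), abs_nonneg (g z)]
    simp only [Pi.add_apply, Real.norm_eq_abs]
    linarith
  have hbi : Integrable (fun z => 1 + g z + g z ^ 2 * Real.exp |g z|) μ :=
    ((integrable_const 1).add hgi).add hqi
  have hei : Integrable (fun z => Real.exp (g z)) μ := by
    refine hbi.mono' (by fun_prop) (Eventually.of_forall fun z => ?_)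
    rw [Real.norm_eq_abs, abs_of_pos (Real.exp_pos _)]
    exact Real.exp_le_one_add_add_sq_mul_exp_abs _
  have hm : l * ∫ z, f z ∂μ = ∫ z, g z ∂μ := (integral_const_mul l f).symm
  have hsplit : ∀ z, Real.exp (l * (f z - ∫ z, f z ∂μ))
      = Real.exp (-∫ z, g z ∂μ) * Real.exp (g z) := fun z => by
    rw [← Real.exp_add, mul_sub, hm]; congr 1; simp only [hg]; ring
  simp_rw [hsplit]
  refine ⟨hei.const_mul _, ?_⟩
  rw [integral_const_mul]
  have h1 : ∫ z, Real.exp (g z) ∂μ ≤ 1 + ∫ z, g z ∂μ + l ^ 2 * H := by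
    calc ∫ z, Real.exp (g z) ∂μ ≤ ∫ z, (1 + g z + g z ^ 2 * Real.exp |g z|) ∂μ :=
          integral_mono hei hbi fun z => Real.exp_le_one_add_add_sq_mul_exp_abs _
      _ = 1 + ∫ z, g z ∂μ + ∫ z, g z ^ 2 * Real.exp |g z| ∂μ := by
          rw [integral_add (f := fun z => 1 + g z) ((integrable_const 1).add hgi) hqi,
            integral_add (integrable_const 1) hgi]
          simp
      _ ≤ _ := by
          gcongr
          exact integral_le_of_lintegral_ofReal_le (by positivity) hqm hq0 hH
  -- The factor `exp (∫ g)` gained here is cancelled exactly by the centering.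
  have h2 : 1 + ∫ z, g z ∂μ + l ^ 2 * H ≤ Real.exp (∫ z, g z ∂μ + l ^ 2 * H) := by
    have := Real.add_one_le_exp (∫ z, g z ∂μ + l ^ 2 * H)
    linarith
  calc Real.exp (-∫ z, g z ∂μ) * ∫ z, Real.exp (g z) ∂μ
      ≤ Real.exp (-∫ z, g z ∂μ) * Real.exp (∫ z, g z ∂μ + l ^ 2 * H) := by
        gcongr; exact h1.trans h2
    _ = _ := by rw [← Real.exp_add]; congr 1; ring

variable {Ω : Type*} [MeasurableSpace Ω]

/-- One-sided Chernoff bound for the mean of an i.i.d. sample. -/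
lemma measure_mean_sub_ge_le {P : Measure Ω} {n : ℕ} (hn : 0 < n)
    {ζ : Fin n → Ω → S} (hζ : ∀ t, Measurable (ζ t)) (hind : iIndepFun ζ P)
    {μ : Measure S} [IsProbabilityMeasure μ] (hlaw : ∀ t, P.map (ζ t) = μ)
    {f : S → ℝ} (hf : Measurable f) {l H : ℝ} (hl : 0 ≤ l) (hH0 : 0 ≤ H)
    (hH : ∫⁻ z, ENNReal.ofReal ((l * f z) ^ 2 * Real.exp |l * f z|) ∂μ
      ≤ ENNReal.ofReal (l ^ 2 * H)) (a : ℝ) :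
    P {ω | a ≤ (n : ℝ)⁻¹ * ∑ t, f (ζ t ω) - ∫ z, f z ∂μ}
      ≤ ENNReal.ofReal (Real.exp (-(n * (l * a - l ^ 2 * H)))) := by
  have := hind.isProbabilityMeasure
  set m := ∫ z, f z ∂μ
  have hn' : (0 : ℝ) < n := by exact_mod_cast hn
  set U : Fin n → Ω → ℝ := fun t ω => f (ζ t ω) - m with hU
  have hUm : ∀ t, Measurable (U t) := fun t => (hf.comp (hζ t)).sub_const m
  have hUind : iIndepFun U P :=
    hind.comp (fun _ z => f z - m) (fun _ => hf.sub_const m)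
  obtain ⟨hi, hle⟩ := integral_exp_centered_le hf hH0 hH
  have hmgf : ∀ t, mgf (U t) P l ≤ Real.exp (l ^ 2 * H) := fun t => by
    have : mgf (U t) P l = ∫ z, Real.exp (l * (f z - m)) ∂μ := by
      rw [← hlaw t, integral_map (hζ t).aemeasurable (by fun_prop)]; rfl
    rw [this]; exact hle
  have hint : ∀ t, Integrable (fun ω => Real.exp (l * U t ω)) P := fun t => by
    have h : Integrable (fun z => Real.exp (l * (f z - m))) (P.map (ζ t)) := by
      rw [hlaw t]; exact hi
    exact (integrable_map_measure (by fun_prop) (hζ t).aemeasurable).mp h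
  have hsum : Integrable (fun ω => Real.exp (l * (∑ t, U t) ω)) P :=
    hUind.integrable_exp_mul_sum hUm fun t _ => hint t
  have hset : {ω | a ≤ (n : ℝ)⁻¹ * ∑ t, f (ζ t ω) - m} = {ω | n * a ≤ (∑ t, U t) ω} := by
    ext ω
    simp only [Set.mem_ofPred_eq, Finset.sum_apply, hU, Finset.sum_sub_distrib, Finset.sum_const,
      Finset.card_univ, Fintype.card_fin, nsmul_eq_mul]
    rw [← mul_le_mul_iff_right₀ hn', mul_sub, ← mul_assoc, mul_inv_cancel₀ hn'.ne', one_mul]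
  rw [hset, ← ofReal_measureReal]
  refine ENNReal.ofReal_le_ofReal ((measure_ge_le_exp_mul_mgf (n * a) hl hsum).trans ?_)
  rw [hUind.mgf_sum hUm]
  calc Real.exp (-l * (n * a)) * ∏ t, mgf (U t) P l
      ≤ Real.exp (-l * (n * a)) * ∏ _t : Fin n, Real.exp (l ^ 2 * H) := by
        gcongr with t
        · exact fun t _ => mgf_nonneg
        · exact hmgf t
    _ = _ := by
        rw [Finset.prod_const, Finset.card_univ, Fintype.card_fin, ← Real.exp_nat_mul,
          ← Real.exp_add]
        congr 1; ring

/-- Two-sided Chernoff bound for the mean of an i.i.d. sample. -/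
lemma measure_abs_mean_sub_ge_le {P : Measure Ω} {n : ℕ} (hn : 0 < n)
    {ζ : Fin n → Ω → S} (hζ : ∀ t, Measurable (ζ t)) (hind : iIndepFun ζ P)
    {μ : Measure S} [IsProbabilityMeasure μ] (hlaw : ∀ t, P.map (ζ t) = μ)
    {f : S → ℝ} (hf : Measurable f) {l H : ℝ} (hl : 0 ≤ l) (hH0 : 0 ≤ H)
    (hH : ∫⁻ z, ENNReal.ofReal ((l * f z) ^ 2 * Real.exp |l * f z|) ∂μ
      ≤ ENNReal.ofReal (l ^ 2 * H)) (a : ℝ) :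
    P {ω | a ≤ |(n : ℝ)⁻¹ * ∑ t, f (ζ t ω) - ∫ z, f z ∂μ|}
      ≤ ENNReal.ofReal (2 * Real.exp (-(n * (l * a - l ^ 2 * H)))) := by
  have h1 := measure_mean_sub_ge_le hn hζ hind hlaw hf hl hH0 hH a
  have h2 := measure_mean_sub_ge_le hn hζ hind hlaw hf.neg hl hH0
    (by simpa [abs_neg] using hH) a
  have hsub : {ω | a ≤ |(n : ℝ)⁻¹ * ∑ t, f (ζ t ω) - ∫ z, f z ∂μ|} ⊆
      {ω | a ≤ (n : ℝ)⁻¹ * ∑ t, f (ζ t ω) - ∫ z, f z ∂μ} ∪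
      {ω | a ≤ (n : ℝ)⁻¹ * ∑ t, (-f) (ζ t ω) - ∫ z, (-f) z ∂μ} := by
    intro ω hω
    simp only [Set.mem_ofPred_eq, Set.mem_union, Pi.neg_apply, Finset.sum_neg_distrib,
      integral_neg] at hω ⊢
    rcases le_abs.mp hω with h | h
    · exact Or.inl h
    · right; linarith
  refine (measure_mono hsub).trans ((measure_union_le _ _).trans ?_)
  rw [two_mul, ENNReal.ofReal_add (Real.exp_pos _).le (Real.exp_pos _).le]
  exact add_le_add h1 h2

/-- Chebyshev's inequality for the mean of an i.i.d. sample. -/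
lemma measure_abs_mean_sub_ge_le_of_sq {P : Measure Ω} {n : ℕ} (hn : 0 < n)
    {ζ : Fin n → Ω → S} (hζ : ∀ t, Measurable (ζ t)) (hind : iIndepFun ζ P)
    {μ : Measure S} [IsProbabilityMeasure μ] (hlaw : ∀ t, P.map (ζ t) = μ)
    {f : S → ℝ} (hf : Measurable f) {H : ℝ} (hH0 : 0 ≤ H)
    (hH : ∫⁻ z, ENNReal.ofReal (f z ^ 2) ∂μ ≤ ENNReal.ofReal H) {a : ℝ} (ha : 0 < a) :
    P {ω | a ≤ |(n : ℝ)⁻¹ * ∑ t, f (ζ t ω) - ∫ z, f z ∂μ|}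
      ≤ ENNReal.ofReal (H / (n * a ^ 2)) := by
  have := hind.isProbabilityMeasure
  have hn' : (0 : ℝ) < n := by exact_mod_cast hn
  have hsqi : Integrable (fun z => f z ^ 2) μ :=
    integrable_of_lintegral_ofReal_le (hf.pow_const 2)
      (fun z => (abs_of_nonneg (sq_nonneg _)).le) hH
  have hL2 : MemLp f 2 μ := (memLp_two_iff_integrable_sq hf.aestronglyMeasurable).mpr hsqi
  set U : Fin n → Ω → ℝ := fun t ω => f (ζ t ω) with hU
  have hUm : ∀ t, Measurable (U t) := fun t => hf.comp (hζ t)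
  have hUL : ∀ t, MemLp (U t) 2 P := fun t => by
    have h := hL2; rw [← hlaw t] at h
    exact (memLp_map_measure_iff hf.aestronglyMeasurable (hζ t).aemeasurable).mp h
  have hUind : iIndepFun U P := hind.comp (fun _ => f) (fun _ => hf)
  have hmean : ∀ t, ∫ ω, U t ω ∂P = ∫ z, f z ∂μ := fun t => by
    rw [← hlaw t, integral_map (hζ t).aemeasurable hf.aestronglyMeasurable]
  have hvar : ∀ t, variance (U t) P ≤ H := fun t => by
    refine (variance_le_expectation_sq (hUm t).aestronglyMeasurable).trans ?_
    have h1 : ∫ ω, (U t ω) ^ 2 ∂P = ∫ z, f z ^ 2 ∂μ := by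
      rw [← hlaw t, integral_map (hζ t).aemeasurable (by fun_prop)]
    calc ∫ ω, (U t ^ 2) ω ∂P = ∫ z, f z ^ 2 ∂μ := h1
      _ ≤ H := integral_le_of_lintegral_ofReal_le hH0 (hf.pow_const 2) (fun z => sq_nonneg _) hH
  have hsumL : MemLp (∑ t, U t) 2 P := memLp_finsetSum' _ fun t _ => hUL t
  have hvs : variance (∑ t, U t) P ≤ n * H := by
    rw [IndepFun.variance_sum (fun t _ => hUL t)
      (fun i _ j _ hij => hUind.indepFun hij)]
    calc ∑ t, variance (U t) P ≤ ∑ _t : Fin n, H := Finset.sum_le_sum fun t _ => hvar t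
      _ = n * H := by simp
  have hE : ∫ ω, (∑ t, U t) ω ∂P = n * ∫ z, f z ∂μ := by
    simp only [Finset.sum_apply]
    rw [integral_finsetSum _ fun t _ => (hUL t).integrable (by norm_num)]
    simp [hmean]
  have hset : {ω | a ≤ |(n : ℝ)⁻¹ * ∑ t, f (ζ t ω) - ∫ z, f z ∂μ|} =
      {ω | n * a ≤ |(∑ t, U t) ω - ∫ ω, (∑ t, U t) ω ∂P|} := by
    ext ω
    rw [Set.mem_ofPred_eq, Set.mem_ofPred_eq, hE, Finset.sum_apply]
    have : ∑ t, U t ω - n * ∫ z, f z ∂μ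
        = n * ((n : ℝ)⁻¹ * ∑ t, f (ζ t ω) - ∫ z, f z ∂μ) := by
      rw [mul_sub, ← mul_assoc, mul_inv_cancel₀ hn'.ne', one_mul]
    rw [this, abs_mul, abs_of_pos hn', mul_le_mul_iff_right₀ hn']
  rw [hset]
  refine (meas_ge_le_variance_div_sq hsumL (by positivity)).trans (ENNReal.ofReal_le_ofReal ?_)
  calc variance (∑ t, U t) P / (n * a) ^ 2 ≤ n * H / (n * a) ^ 2 := by gcongr
    _ = _ := by field_simp

end Deviation

/-! ### Trimmed importance weighting -/

section Trimmed

variable {S : Type*} [MeasurableSpace S] {μ τ : Measure S} {w : S → ℝ}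

lemma lintegral_ofReal_withDensity (hw : Measurable w) (hw0 : ∀ z, 0 ≤ w z)
    (hτ : τ = μ.withDensity fun z => ENNReal.ofReal (w z)) {g : S → ℝ} (hg : Measurable g) :
    ∫⁻ z, ENNReal.ofReal (g z) ∂τ = ∫⁻ z, ENNReal.ofReal (w z * g z) ∂μ := by
  rw [hτ, lintegral_withDensity_eq_lintegral_mul _ (by fun_prop) (by fun_prop)]
  exact lintegral_congr fun z => (ENNReal.ofReal_mul (hw0 z)).symm

lemma integral_withDensity_ofReal (hw : Measurable w) (hw0 : ∀ z, 0 ≤ w z)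
    (hτ : τ = μ.withDensity fun z => ENNReal.ofReal (w z)) (g : S → ℝ) :
    ∫ z, g z ∂τ = ∫ z, w z * g z ∂μ := by
  rw [hτ, integral_withDensity_eq_integral_toReal_smul (by fun_prop) (by simp)]
  simp [hw0]

lemma integrable_withDensity_ofReal (hw : Measurable w) (hw0 : ∀ z, 0 ≤ w z)
    (hτ : τ = μ.withDensity fun z => ENNReal.ofReal (w z)) {g : S → ℝ} :
    Integrable g τ ↔ Integrable (fun z => w z * g z) μ := by
  rw [hτ, integrable_withDensity_iff_integrable_smul' (by fun_prop) (by simp)]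
  simp [hw0]

/-- The polynomial factor may cost only a quarter of the exponent: the moment generating function
takes another quarter, and the remaining half pays for the tail. -/
lemma one_add_sq_le_exp {x : ℝ} (hx : 0 ≤ x) : (1 + x) ^ 2 ≤ 128 * Real.exp (x / 4) := by
  have h1 : 1 + x / 8 ≤ Real.exp (x / 8) := by
    have := Real.add_one_le_exp (x / 8); linarith
  have h2 : Real.exp (x / 4) = Real.exp (x / 8) ^ 2 := by
    rw [← Real.exp_nat_mul]; congr 1; push_cast; ring
  rw [h2]
  nlinarith [Real.exp_pos (x / 8)]

lemma one_add_le_exp_half {x : ℝ} : 1 + x ≤ 2 * Real.exp (x / 2) := by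
  have h1 := Real.add_one_le_exp (x / 2)
  linarith

/-- Exponentially weighted second moment of the trimmed importance-weighted variable. -/
lemma lintegral_trimmed_sq_exp_le (hw : Measurable w) (hw0 : ∀ z, 0 ≤ w z)
    (hτ : τ = μ.withDensity fun z => ENNReal.ofReal (w z))
    {Z R G : S → ℝ} (hR : Measurable R) (hG : Measurable G)
    (hR0 : ∀ z, 0 ≤ R z) (hG0 : ∀ z, 0 ≤ G z)
    {b K lgn ls T l : ℝ} (hb : 0 ≤ b) (hK : 0 ≤ K) (hlgn : 1 ≤ lgn) (hlgnK : 4 * K ^ 2 ≤ lgn)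
    (hls : 0 < ls) (hT : 0 ≤ T) (hl : 0 ≤ l)
    (hZR : ∀ z, |Z z| ≤ K * ls * (1 + R z / lgn))
    (hRint : ∫⁻ z, ENNReal.ofReal (Real.exp (R z)) ∂τ ≤ ENNReal.ofReal K)
    (hlb : l * b * ls ≤ K)
    (hVG : ∀ z, R z ≤ 4 * lgn → min (w z) b * Z z ^ 2 ≤ T * G z)
    (hGint : ∫⁻ z, ENNReal.ofReal (G z) ∂τ ≤ ENNReal.ofReal K)
    (hbT : b * ls ^ 2 * Real.exp (-(2 * lgn)) ≤ K * T) :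
    ∫⁻ z, ENNReal.ofReal ((l * (min (w z) b * Z z)) ^ 2 *
        Real.exp |l * (min (w z) b * Z z)|) ∂μ
      ≤ ENNReal.ofReal (l ^ 2 * ((Real.exp (5 * K ^ 2) * K
          + 128 * K ^ 2 * Real.exp (K ^ 2) * K * K) * T)) := by
  set C1 := Real.exp (5 * K ^ 2)
  set C2 := 128 * K ^ 2 * Real.exp (K ^ 2) * K
  have hC1 : 0 ≤ C1 := (Real.exp_pos _).le
  have hC2 : 0 ≤ C2 := by positivity
  have hV0 : ∀ z, 0 ≤ min (w z) b := fun z => le_min (hw0 z) hb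
  -- Only one of the two factors `min (w z) b` in the square appears: the other is later bounded by
  -- `w z` and turns μ into τ. Below R = 4 lgn the exponent is bounded because l·b·ls ≤ K; above it
  -- the exponential moment of R takes over.
  have key : ∀ z, min (w z) b * Z z ^ 2 * Real.exp (l * b * |Z z|)
      ≤ C1 * T * G z + C2 * T * Real.exp (R z) := by
    intro z
    have hlbZ : l * b * |Z z| ≤ K ^ 2 * (1 + R z / lgn) := by
      have h0 : 0 ≤ 1 + R z / lgn := by have := hR0 z; positivity
      calc l * b * |Z z| ≤ l * b * (K * ls * (1 + R z / lgn)) := by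
            gcongr; exact hZR z
        _ = (l * b * ls) * K * (1 + R z / lgn) := by ring
        _ ≤ K * K * (1 + R z / lgn) := by gcongr
        _ = _ := by ring
    rcases le_or_gt (R z) (4 * lgn) with h | h
    · have h1 : R z / lgn ≤ 4 := by rw [div_le_iff₀ (by linarith)]; exact h
      have h2 : Real.exp (l * b * |Z z|) ≤ C1 := by
        refine Real.exp_le_exp.mpr (hlbZ.trans ?_)
        nlinarith [sq_nonneg K]
      have h3 : 0 ≤ C2 * T * Real.exp (R z) := by positivity
      have h4 : min (w z) b * Z z ^ 2 * Real.exp (l * b * |Z z|) ≤ (T * G z) * C1 :=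
        mul_le_mul (hVG z h) h2 (Real.exp_pos _).le (mul_nonneg hT (hG0 z))
      linarith
    · have h3 : 0 ≤ C1 * T * G z := mul_nonneg (by positivity) (hG0 z)
      have hr := hR0 z
      have hRl : R z / lgn ≤ R z := div_le_self hr hlgn
      have hz : |Z z| ≤ K * ls * (1 + R z) :=
        (hZR z).trans (by gcongr)
      have hz2 : Z z ^ 2 ≤ K ^ 2 * ls ^ 2 * (128 * Real.exp (R z / 4)) := by
        calc Z z ^ 2 = |Z z| ^ 2 := (sq_abs _).symm
          _ ≤ (K * ls * (1 + R z)) ^ 2 := by gcongr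
          _ = K ^ 2 * ls ^ 2 * (1 + R z) ^ 2 := by ring
          _ ≤ _ := by gcongr; exact one_add_sq_le_exp hr
      have he : Real.exp (l * b * |Z z|) ≤ Real.exp (K ^ 2) * Real.exp (R z / 4) := by
        rw [← Real.exp_add]
        refine Real.exp_le_exp.mpr (hlbZ.trans ?_)
        -- This is what 4K² ≤ lgn is for: the Chernoff exponent takes at most a quarter of R.
        have : K ^ 2 * (R z / lgn) ≤ R z / 4 := by
          rw [mul_div_assoc', div_le_iff₀ (by linarith)]
          nlinarith
        linarith
      have hee : Real.exp (R z / 4) * Real.exp (R z / 4)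
          ≤ Real.exp (-(2 * lgn)) * Real.exp (R z) := by
        rw [← Real.exp_add, ← Real.exp_add]
        exact Real.exp_le_exp.mpr (by linarith)
      calc min (w z) b * Z z ^ 2 * Real.exp (l * b * |Z z|)
          ≤ b * (K ^ 2 * ls ^ 2 * (128 * Real.exp (R z / 4)))
            * (Real.exp (K ^ 2) * Real.exp (R z / 4)) := by
            gcongr; exact min_le_right _ _
        _ = 128 * K ^ 2 * Real.exp (K ^ 2) * (b * ls ^ 2)
            * (Real.exp (R z / 4) * Real.exp (R z / 4)) := by ring
        _ ≤ 128 * K ^ 2 * Real.exp (K ^ 2) * (b * ls ^ 2)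
            * (Real.exp (-(2 * lgn)) * Real.exp (R z)) := by gcongr
        _ = 128 * K ^ 2 * Real.exp (K ^ 2) * (b * ls ^ 2 * Real.exp (-(2 * lgn)))
            * Real.exp (R z) := by ring
        _ ≤ 128 * K ^ 2 * Real.exp (K ^ 2) * (K * T) * Real.exp (R z) := by gcongr
        _ = C2 * T * Real.exp (R z) := by ring
        _ ≤ _ := by linarith
  calc ∫⁻ z, ENNReal.ofReal ((l * (min (w z) b * Z z)) ^ 2 *
        Real.exp |l * (min (w z) b * Z z)|) ∂μ
      ≤ ∫⁻ z, ENNReal.ofReal (w z * (l ^ 2 * (C1 * T * G z + C2 * T * Real.exp (R z)))) ∂μ := by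
        refine lintegral_mono fun z => ENNReal.ofReal_le_ofReal ?_
        have h1 : |l * (min (w z) b * Z z)| ≤ l * b * |Z z| := by
          rw [abs_mul, abs_mul, abs_of_nonneg hl, abs_of_nonneg (hV0 z), mul_assoc]
          gcongr; exact min_le_right _ _
        calc (l * (min (w z) b * Z z)) ^ 2 * Real.exp |l * (min (w z) b * Z z)|
            ≤ (l * (min (w z) b * Z z)) ^ 2 * Real.exp (l * b * |Z z|) := by gcongr
          _ = min (w z) b * (l ^ 2 * (min (w z) b * Z z ^ 2 * Real.exp (l * b * |Z z|))) := by
              ring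
          _ ≤ w z * (l ^ 2 * (C1 * T * G z + C2 * T * Real.exp (R z))) := by
              have h5 := hV0 z
              have h6 := hw0 z
              gcongr
              · exact min_le_left _ _
              · exact key z
    _ = ∫⁻ z, ENNReal.ofReal (l ^ 2 * (C1 * T * G z + C2 * T * Real.exp (R z))) ∂τ :=
        (lintegral_ofReal_withDensity hw hw0 hτ (by fun_prop)).symm
    _ = ∫⁻ z, (ENNReal.ofReal (l ^ 2 * (C1 * T)) * ENNReal.ofReal (G z)
          + ENNReal.ofReal (l ^ 2 * (C2 * T)) * ENNReal.ofReal (Real.exp (R z))) ∂τ := by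
        refine lintegral_congr fun z => ?_
        rw [← ENNReal.ofReal_mul (by positivity), ← ENNReal.ofReal_mul (by positivity),
          ← ENNReal.ofReal_add (mul_nonneg (by positivity) (hG0 z)) (by positivity)]
        congr 1; ring
    _ = ENNReal.ofReal (l ^ 2 * (C1 * T)) * ∫⁻ z, ENNReal.ofReal (G z) ∂τ
          + ENNReal.ofReal (l ^ 2 * (C2 * T)) * ∫⁻ z, ENNReal.ofReal (Real.exp (R z)) ∂τ := by
        rw [lintegral_add_left (by fun_prop), lintegral_const_mul _ (by fun_prop),
          lintegral_const_mul _ (by fun_prop)]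
    _ ≤ ENNReal.ofReal (l ^ 2 * (C1 * T)) * ENNReal.ofReal K
          + ENNReal.ofReal (l ^ 2 * (C2 * T)) * ENNReal.ofReal K := by gcongr
    _ = _ := by
        rw [← ENNReal.ofReal_mul (by positivity), ← ENNReal.ofReal_mul (by positivity),
          ← ENNReal.ofReal_add (by positivity) (by positivity)]
        congr 1; ring

/-- The trimming bias. -/
lemma abs_integral_trimmed_sub_le (hw : Measurable w) (hw0 : ∀ z, 0 ≤ w z)
    (hτ : τ = μ.withDensity fun z => ENNReal.ofReal (w z))
    {Z R : S → ℝ} (hZ : Measurable Z) (hR : Measurable R) (hR0 : ∀ z, 0 ≤ R z)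
    {b K lgn ls d q : ℝ} (hb : 0 < b) (hK : 0 ≤ K) (hlgn : 1 ≤ lgn) (hls : 0 < ls)
    (hq : 0 < q) (hd : 0 ≤ d)
    (hZR : ∀ z, |Z z| ≤ K * ls * (1 + R z / lgn))
    (hRint : ∫⁻ z, ENNReal.ofReal (Real.exp (R z)) ∂τ ≤ ENNReal.ofReal K)
    (hwint : ∫⁻ z, ENNReal.ofReal (w z ^ q) ∂τ ≤ ENNReal.ofReal K)
    (hbd : ls * b ^ (-q) ≤ K * d) (hld : ls * Real.exp (-(2 * lgn)) ≤ K * d) :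
    Integrable Z τ ∧
    |∫ z, min (w z) b * Z z ∂μ - ∫ z, Z z ∂τ| ≤ 7 * K ^ 3 * d := by
  have hexp : ∀ z, |Z z| ≤ 2 * K * ls * Real.exp (R z / 2) := by
    intro z
    have hr := hR0 z
    calc |Z z| ≤ K * ls * (1 + R z / lgn) := hZR z
      _ ≤ K * ls * (1 + R z) := by gcongr; exact div_le_self hr hlgn
      _ ≤ K * ls * (2 * Real.exp (R z / 2)) := by gcongr; exact one_add_le_exp_half
      _ = _ := by ring
  have hZint : Integrable Z τ := by
    refine integrable_of_lintegral_ofReal_le (g := fun z => 2 * K * ls * Real.exp (R z))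
      (H := 2 * K * ls * K) hZ
      (fun z => (hexp z).trans ?_) ?_
    · gcongr; linarith [hR0 z]
    · simp_rw [ENNReal.ofReal_mul (show 0 ≤ 2 * K * ls by positivity)]
      rw [lintegral_const_mul _ (by fun_prop)]
      gcongr
  refine ⟨hZint, ?_⟩
  have hwZ : Integrable (fun z => w z * Z z) μ :=
    (integrable_withDensity_ofReal hw hw0 hτ).mp hZint
  have hV0 : ∀ z, 0 ≤ min (w z) b := fun z => le_min (hw0 z) hb.le
  have hVZ : Integrable (fun z => min (w z) b * Z z) μ := by
    refine hwZ.norm.mono' (by fun_prop) (Eventually.of_forall fun z => ?_)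
    rw [Real.norm_eq_abs, Real.norm_eq_abs, abs_mul, abs_mul, abs_of_nonneg (hV0 z),
      abs_of_nonneg (hw0 z)]
    gcongr; exact min_le_left _ _
  rw [integral_withDensity_ofReal hw hw0 hτ, ← integral_sub hVZ hwZ]
  refine (abs_integral_le_integral_abs).trans ?_
  refine integral_le_of_lintegral_ofReal_le (by positivity) (by fun_prop)
    (fun z => abs_nonneg _) ?_
  -- Trimming acts only where w > b, and there 1 ≤ b^(-q) w^q, as in Markov's inequality. The factor
  -- w taken out in front changes the measure, so the q-th moment is taken under τ.
  have key : ∀ z, |min (w z) b * Z z - w z * Z z|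
      ≤ w z * (5 * K * (ls * b ^ (-q)) * w z ^ q
        + 2 * K * (ls * Real.exp (-(2 * lgn))) * Real.exp (R z)) := by
    intro z
    have hwz := hw0 z
    have hwq : 0 ≤ w z ^ q := Real.rpow_nonneg hwz q
    rcases le_or_gt (w z) b with h | h
    · rw [min_eq_left h, sub_self, abs_zero]
      positivity
    · have h1 : |min (w z) b * Z z - w z * Z z| ≤ w z * |Z z| := by
        rw [min_eq_right h.le, ← sub_mul, abs_mul, abs_sub_comm, abs_of_nonneg (by linarith)]
        gcongr; linarith
      refine h1.trans ?_
      gcongr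
      rcases le_or_gt (R z) (4 * lgn) with h2 | h2
      · have h3 : R z / lgn ≤ 4 := by rw [div_le_iff₀ (by linarith)]; exact h2
        have h4 : 1 ≤ b ^ (-q) * w z ^ q := by
          rw [Real.rpow_neg hb.le, ← div_eq_inv_mul, one_le_div (by positivity)]
          exact Real.rpow_le_rpow hb.le h.le hq.le
        calc |Z z| ≤ K * ls * (1 + R z / lgn) := hZR z
          _ ≤ K * ls * 5 := by gcongr; linarith
          _ = 5 * K * ls * 1 := by ring
          _ ≤ 5 * K * ls * (b ^ (-q) * w z ^ q) := by gcongr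
          _ = 5 * K * (ls * b ^ (-q)) * w z ^ q := by ring
          _ ≤ _ := le_add_of_nonneg_right (by positivity)
      · calc |Z z| ≤ 2 * K * ls * Real.exp (R z / 2) := hexp z
          _ ≤ 2 * K * ls * (Real.exp (-(2 * lgn)) * Real.exp (R z)) := by
              rw [← Real.exp_add]; gcongr; linarith
          _ = 2 * K * (ls * Real.exp (-(2 * lgn))) * Real.exp (R z) := by ring
          _ ≤ _ := le_add_of_nonneg_left (by positivity)
  have hwq : Measurable fun z => w z ^ q := hw.pow_const q
  calc ∫⁻ z, ENNReal.ofReal |min (w z) b * Z z - w z * Z z| ∂μ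
      ≤ ∫⁻ z, ENNReal.ofReal (w z * (5 * K * (ls * b ^ (-q)) * w z ^ q
        + 2 * K * (ls * Real.exp (-(2 * lgn))) * Real.exp (R z))) ∂μ :=
        lintegral_mono fun z => ENNReal.ofReal_le_ofReal (key z)
    _ = ∫⁻ z, ENNReal.ofReal (5 * K * (ls * b ^ (-q)) * w z ^ q
        + 2 * K * (ls * Real.exp (-(2 * lgn))) * Real.exp (R z)) ∂τ :=
        (lintegral_ofReal_withDensity hw hw0 hτ (by fun_prop)).symm
    _ = ∫⁻ z, (ENNReal.ofReal (5 * K * (ls * b ^ (-q))) * ENNReal.ofReal (w z ^ q)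
        + ENNReal.ofReal (2 * K * (ls * Real.exp (-(2 * lgn))))
          * ENNReal.ofReal (Real.exp (R z))) ∂τ := by
        refine lintegral_congr fun z => ?_
        have := Real.rpow_nonneg (hw0 z) q
        rw [← ENNReal.ofReal_mul (by positivity), ← ENNReal.ofReal_mul (by positivity),
          ← ENNReal.ofReal_add (by positivity) (by positivity)]
    _ = ENNReal.ofReal (5 * K * (ls * b ^ (-q))) * ∫⁻ z, ENNReal.ofReal (w z ^ q) ∂τ
        + ENNReal.ofReal (2 * K * (ls * Real.exp (-(2 * lgn))))
          * ∫⁻ z, ENNReal.ofReal (Real.exp (R z)) ∂τ := by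
        rw [lintegral_add_left (by fun_prop), lintegral_const_mul _ (by fun_prop),
          lintegral_const_mul _ (by fun_prop)]
    _ ≤ ENNReal.ofReal (5 * K * (K * d)) * ENNReal.ofReal K
        + ENNReal.ofReal (2 * K * (K * d)) * ENNReal.ofReal K := by gcongr
    _ = _ := by
        rw [← ENNReal.ofReal_mul (by positivity), ← ENNReal.ofReal_mul (by positivity),
          ← ENNReal.ofReal_add (by positivity) (by positivity)]
        congr 1; ring

variable {Ω : Type*} [MeasurableSpace Ω]

/-- Deviation of the trimmed importance-weighted sample mean of `Z` from the target mean of `Z`: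
at scale `d`, the probability is at most `2 p ^ (-4)`, where `L = log p`. -/
lemma measure_trimmed_mean_deviation_le [IsProbabilityMeasure μ] {P : Measure Ω} {n : ℕ}
    (hn : 0 < n) {ζ : Fin n → Ω → S} (hζ : ∀ t, Measurable (ζ t)) (hind : iIndepFun ζ P)
    (hlaw : ∀ t, P.map (ζ t) = μ) (hw : Measurable w) (hw0 : ∀ z, 0 ≤ w z)
    (hτ : τ = μ.withDensity fun z => ENNReal.ofReal (w z))
    {Z R G : S → ℝ} (hZ : Measurable Z) (hR : Measurable R) (hG : Measurable G)
    (hR0 : ∀ z, 0 ≤ R z) (hG0 : ∀ z, 0 ≤ G z)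
    {b K lgn ls d q c L : ℝ} (hb : 0 < b) (hK : 0 ≤ K) (hlgn : 1 ≤ lgn)
    (hlgnK : 4 * K ^ 2 ≤ lgn) (hls : 0 < ls) (hq : 0 < q) (hd : 0 < d) (hc : 0 < c)
    (hcL : n * c ^ 2 = L)
    (hZR : ∀ z, |Z z| ≤ K * ls * (1 + R z / lgn))
    (hRint : ∫⁻ z, ENNReal.ofReal (Real.exp (R z)) ∂τ ≤ ENNReal.ofReal K)
    (hwint : ∫⁻ z, ENNReal.ofReal (w z ^ q) ∂τ ≤ ENNReal.ofReal K)
    (hbd : ls * b ^ (-q) ≤ K * d) (hld : ls * Real.exp (-(2 * lgn)) ≤ K * d)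
    (hlb : c ^ 2 / d * b * ls ≤ K)
    (hVG : ∀ z, R z ≤ 4 * lgn → min (w z) b * Z z ^ 2 ≤ (d / c) ^ 2 * G z)
    (hGint : ∫⁻ z, ENNReal.ofReal (G z) ∂τ ≤ ENNReal.ofReal K)
    (hbT : b * ls ^ 2 * Real.exp (-(2 * lgn)) ≤ K * (d / c) ^ 2) :
    P {ω | (7 * K ^ 3 + (Real.exp (5 * K ^ 2) * K + 128 * K ^ 2 * Real.exp (K ^ 2) * K * K) + 4)
        * d ≤ |(n : ℝ)⁻¹ * ∑ t, min (w (ζ t ω)) b * Z (ζ t ω) - ∫ z, Z z ∂τ|}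
      ≤ ENNReal.ofReal (2 * Real.exp (-(4 * L))) := by
  set C := Real.exp (5 * K ^ 2) * K + 128 * K ^ 2 * Real.exp (K ^ 2) * K * K
  have hC : 0 ≤ C := by positivity
  obtain ⟨-, hbias⟩ := abs_integral_trimmed_sub_le hw hw0 hτ hZ hR hR0 hb hK hlgn hls hq hd.le
    hZR hRint hwint hbd hld
  have hH := lintegral_trimmed_sq_exp_le hw hw0 hτ hR hG hR0 hG0 hb.le hK hlgn hlgnK hls
    (sq_nonneg (d / c)) (show 0 ≤ c ^ 2 / d by positivity) hZR hRint hlb hVG hGint hbT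
  -- With l = c²/d, level a = (C + 4)d and H = C(d/c)², the exponent n(la - l²H) collapses to 4nc² =
  -- 4L whatever the ratio d/c is.
  have hmain := measure_abs_mean_sub_ge_le hn hζ hind hlaw
    (f := fun z => min (w z) b * Z z) (by fun_prop) (show 0 ≤ c ^ 2 / d by positivity)
    (show 0 ≤ C * (d / c) ^ 2 by positivity) hH ((C + 4) * d)
  have hexp : (n : ℝ) * (c ^ 2 / d * ((C + 4) * d) - (c ^ 2 / d) ^ 2 * (C * (d / c) ^ 2))
      = 4 * L := by
    rw [← hcL]; field_simp; ring
  rw [hexp] at hmain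
  refine (measure_mono fun ω hω => ?_).trans hmain
  rw [Set.mem_ofPred_eq] at hω ⊢
  have htri := abs_sub_le ((n : ℝ)⁻¹ * ∑ t, min (w (ζ t ω)) b * Z (ζ t ω))
    (∫ z, min (w z) b * Z z ∂μ) (∫ z, Z z ∂τ)
  linarith

end Trimmed

namespace IWOGA

/-! ### Rates -/

section Rates

/-- The relations between the rates `c`, `d`, the trimming level `b` and the power `ls` of
`log n` on which the deviation bounds rest. -/
structure RateRelations (n : ℕ) (K q c d b ls L : ℝ) : Prop where
  pos_n : 0 < n
  pos_c : 0 < c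
  pos_b : 0 < b
  pos_ls : 0 < ls
  le_d : c ≤ d
  mul_sq : n * c ^ 2 = L
  one_div_le : (n : ℝ)⁻¹ ≤ c ^ 2
  c_le_one : c ≤ 1
  chernoff : c ^ 2 / d * b * ls ≤ K
  trim : ls * b ^ (-q) ≤ K * d
  tail : ls * Real.exp (-(2 * Real.log n)) ≤ K * d
  variance : q ≤ 1 → b ^ (1 - q) * ls ^ 2 ≤ K * (d / c) ^ 2
  large : b * ls ^ 2 * Real.exp (-(2 * Real.log n)) ≤ K * (d / c) ^ 2

lemma tendsto_log_rpow_mul_rpow_neg (r : ℝ) {a : ℝ} (ha : 0 < a) :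
    Tendsto (fun n : ℕ => Real.log n ^ r * (n : ℝ) ^ (-a)) atTop (𝓝 0) := by
  have h := (isLittleO_log_rpow_rpow_atTop r ha).tendsto_div_nhds_zero
  refine (h.comp tendsto_natCast_atTop_atTop).congr' ?_
  filter_upwards [eventually_gt_atTop 0] with n hn
  have : (0 : ℝ) ≤ n := by positivity
  simp only [Function.comp]
  rw [Real.rpow_neg this, div_eq_mul_inv]

variable {p : ℕ → ℕ} {γ : ℝ}

lemma eventually_cRate_pos (hp' : Tendsto p atTop atTop) :
    ∀ᶠ n : ℕ in atTop, 0 < n ∧ 0 < cRate p n ∧ (n : ℝ) * cRate p n ^ 2 = Real.log (p n) ∧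
      (n : ℝ)⁻¹ ≤ cRate p n ^ 2 := by
  -- Since 3 > e, this gives log p ≥ 1 and therefore 1/n ≤ c².
  filter_upwards [eventually_gt_atTop 0, hp'.eventually_ge_atTop 3] with n hn hpn
  have hn' : (0 : ℝ) < n := by exact_mod_cast hn
  have h1 : (1 : ℝ) ≤ Real.log (p n) := by
    rw [Real.le_log_iff_exp_le (by positivity)]
    have : (3 : ℝ) ≤ p n := by exact_mod_cast hpn
    linarith [Real.exp_one_lt_d9]
  have h2 : cRate p n ^ 2 = Real.log (p n) / n := by
    rw [cRate, Real.sq_sqrt (by positivity)]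
  refine ⟨hn, ?_, ?_, ?_⟩
  · rw [cRate]; exact Real.sqrt_pos.mpr (by positivity)
  · rw [h2]; field_simp
  · rw [h2, inv_eq_one_div]; gcongr

lemma exists_cRate_le
    (hp : (fun n => Real.log (p n)) =O[atTop] (fun n : ℕ => (n : ℝ) ^ γ)) :
    ∃ C : ℝ, 0 < C ∧ ∀ᶠ n : ℕ in atTop, cRate p n ≤ C * (n : ℝ) ^ (-((1 - γ) / 2)) := by
  obtain ⟨C, hC, hb⟩ := hp.exists_pos
  refine ⟨√C, Real.sqrt_pos.mpr hC, ?_⟩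
  filter_upwards [hb.bound, eventually_gt_atTop 0] with n h hn
  have hn' : (0 : ℝ) < n := by exact_mod_cast hn
  have hl : 0 ≤ Real.log (p n) := Real.log_natCast_nonneg _
  rw [Real.norm_of_nonneg hl, Real.norm_of_nonneg (by positivity)] at h
  have h2 : C * (n : ℝ) ^ (-(1 - γ)) = C * (n : ℝ) ^ γ / n := by
    rw [show -(1 - γ) = γ - 1 by ring, Real.rpow_sub hn', Real.rpow_one, mul_div_assoc]
  have h3 : ((n : ℝ) ^ (-((1 - γ) / 2))) ^ 2 = (n : ℝ) ^ (-(1 - γ)) := by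
    rw [← Real.rpow_natCast, ← Real.rpow_mul hn'.le]; congr 1; push_cast; ring
  rw [cRate]
  refine Real.sqrt_le_iff.mpr ⟨by positivity, ?_⟩
  rw [mul_pow, Real.sq_sqrt hC.le, h3, h2]
  gcongr

/-- Since γ < 1, the rate c decays at least like a negative power of n, so any positive power of it
absorbs every power of log n. -/
lemma tendsto_cRate_rpow_mul_log_rpow (hγ : γ < 1)
    (hp : (fun n => Real.log (p n)) =O[atTop] (fun n : ℕ => (n : ℝ) ^ γ))
    {a : ℝ} (ha : 0 < a) (r : ℝ) :
    Tendsto (fun n : ℕ => cRate p n ^ a * Real.log n ^ r) atTop (𝓝 0) := by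
  obtain ⟨C, hC, hle⟩ := exists_cRate_le hp
  have hlim := (tendsto_log_rpow_mul_rpow_neg r
    (show 0 < (1 - γ) / 2 * a by apply mul_pos _ ha; linarith)).const_mul (C ^ a)
  rw [mul_zero] at hlim
  refine squeeze_zero' (Eventually.of_forall fun n => ?_) ?_ hlim
  · exact mul_nonneg (Real.rpow_nonneg (Real.sqrt_nonneg _) _)
      (Real.rpow_nonneg (Real.log_natCast_nonneg _) _)
  · filter_upwards [hle] with n hn
    have hn0 : (0 : ℝ) ≤ n := by positivity
    have h0 : 0 ≤ cRate p n := Real.sqrt_nonneg _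
    have h1 : cRate p n ^ a ≤ C ^ a * (n : ℝ) ^ (-((1 - γ) / 2 * a)) := by
      calc cRate p n ^ a ≤ (C * (n : ℝ) ^ (-((1 - γ) / 2))) ^ a :=
            Real.rpow_le_rpow h0 hn ha.le
        _ = _ := by
          rw [Real.mul_rpow hC.le (by positivity), ← Real.rpow_mul hn0]
          congr 2; ring
    calc cRate p n ^ a * Real.log n ^ r
        ≤ C ^ a * (n : ℝ) ^ (-((1 - γ) / 2 * a)) * Real.log n ^ r := by
          gcongr
      _ = _ := by ring

lemma tendsto_cRate (hγ : γ < 1)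
    (hp : (fun n => Real.log (p n)) =O[atTop] (fun n : ℕ => (n : ℝ) ^ γ)) :
    Tendsto (cRate p) atTop (𝓝 0) := by
  simpa using tendsto_cRate_rpow_mul_log_rpow hγ hp one_pos 0

lemma tendsto_dRate (hγ : γ < 1)
    (hp : (fun n => Real.log (p n)) =O[atTop] (fun n : ℕ => (n : ℝ) ^ γ))
    {q η : ℝ} (hq : 0 < q) : Tendsto (dRate p q η) atTop (𝓝 0) := by
  by_cases h : q ≤ 1
  · refine (tendsto_cRate_rpow_mul_log_rpow hγ hp
      (show 0 < 2 * q / (1 + q) by positivity) (1 / η + 1 / 2)).congr fun n => ?_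
    rw [dRate, if_pos h]
  · refine (tendsto_cRate hγ hp).congr fun n => ?_
    rw [dRate, if_neg h]

lemma eventually_one_le_log : ∀ᶠ n : ℕ in atTop, (1 : ℝ) ≤ Real.log n :=
  (Real.tendsto_log_atTop.comp tendsto_natCast_atTop_atTop).eventually_ge_atTop 1

variable {q η Mw Mη : ℝ}

/-- Needed for Chebyshev's inequality, where the variance of the weighted mean of squared noise is
of order b/n. As 1/n ≤ c², it suffices that bc² vanishes. -/
lemma tendsto_bTrim_div (hγ : γ < 1)
    (hp : (fun n => Real.log (p n)) =O[atTop] (fun n : ℕ => (n : ℝ) ^ γ))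
    (hp' : Tendsto p atTop atTop) (hq : 0 < q) (hMw : 0 < Mw) (hMη : 0 ≤ Mη) :
    Tendsto (fun n : ℕ => bTrim p q Mw Mη n / n) atTop (𝓝 0) := by
  have hlim : Tendsto (fun n : ℕ => Mw * (if q ≤ 1 then cRate p n ^ (2 * q / (1 + q)) else
      cRate p n)) atTop (𝓝 0) := by
    rw [← mul_zero Mw]
    refine Tendsto.const_mul _ ?_
    by_cases h : q ≤ 1
    · simpa [h] using tendsto_cRate_rpow_mul_log_rpow hγ hp
        (show 0 < 2 * q / (1 + q) by positivity) 0
    · simpa [h] using tendsto_cRate hγ hp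
  refine squeeze_zero' ?_ ?_ hlim
  · filter_upwards [eventually_cRate_pos hp'] with n ⟨hn, hc, _, _⟩
    rw [bTrim]
    have := Real.rpow_nonneg (Real.log_natCast_nonneg n) (-Mη)
    split_ifs <;> positivity
  · filter_upwards [eventually_cRate_pos hp', eventually_one_le_log] with n ⟨hn, hc, _, hcn⟩ hl
    rw [bTrim, div_eq_mul_inv]
    split_ifs with h
    · calc Mw * cRate p n ^ (-(2 / (1 + q))) * (n : ℝ)⁻¹
          ≤ Mw * cRate p n ^ (-(2 / (1 + q))) * cRate p n ^ 2 := by gcongr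
        _ = Mw * cRate p n ^ (2 * q / (1 + q)) := by
          rw [mul_assoc, ← Real.rpow_natCast, ← Real.rpow_add hc]
          congr 2; push_cast; field_simp; ring
    · have : Real.log n ^ (-Mη) ≤ 1 := Real.rpow_le_one_of_one_le_of_nonpos hl (by linarith)
      calc Mw * (cRate p n)⁻¹ * Real.log n ^ (-Mη) * (n : ℝ)⁻¹
          ≤ Mw * (cRate p n)⁻¹ * 1 * cRate p n ^ 2 := by gcongr
        _ = Mw * cRate p n := by field_simp

/-- For q ≤ 1 the exponents 2q/(1+q) and 2/(1+q) solve the balance of Chernoff range, trimming bias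
and variance exactly: these three relations are equalities up to powers of Mw. For q > 1 there is
slack: the Chernoff range needs Mη to dominate the power of log n, and in the bias the spare factor
c^(q-1) absorbs all logarithms. -/
theorem exists_eventually_rateRelations (hγ : γ < 1)
    (hp : (fun n => Real.log (p n)) =O[atTop] (fun n : ℕ => (n : ℝ) ^ γ))
    (hp' : Tendsto p atTop atTop) (hq : 0 < q) (hη : 0 < η) (hMw : 0 < Mw)
    (hMη : 1 / η + 1 / 2 ≤ Mη) :
    ∃ K : ℝ, 0 < K ∧ ∀ᶠ n : ℕ in atTop,
      RateRelations n K q (cRate p n) (dRate p q η n) (bTrim p q Mw Mη n)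
        (Real.log n ^ (1 / η + 1 / 2)) (Real.log (p n)) := by
  set s := 1 / η + 1 / 2 with hs
  have hs0 : 0 < s := by positivity
  have hMη0 : 0 ≤ Mη := hs0.le.trans hMη
  have hls1 := (tendsto_log_rpow_mul_rpow_neg s one_pos).eventually_le_const zero_lt_one
  have hls2 := (tendsto_log_rpow_mul_rpow_neg (s * 2) one_pos).eventually_le_const zero_lt_one
  have hbn := (tendsto_bTrim_div hγ hp hp' hq hMw hMη0).eventually_le_const zero_lt_one
  have hlast : ∀ᶠ n : ℕ in atTop, ¬ q ≤ 1 →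
      cRate p n ^ (q - 1) * Real.log n ^ (s + Mη * q) ≤ 1 := by
    by_cases h : q ≤ 1
    · exact Eventually.of_forall fun n hn => absurd h hn
    · filter_upwards [(tendsto_cRate_rpow_mul_log_rpow hγ hp (show 0 < q - 1 by linarith)
        (s + Mη * q)).eventually_le_const zero_lt_one] with n hn _ using hn
  have hK1 : 0 < Mw ^ (-q) := Real.rpow_pos_of_pos hMw _
  have hK2 : 0 < Mw ^ (1 - q) := Real.rpow_pos_of_pos hMw _
  refine ⟨1 + Mw + Mw ^ (-q) + Mw ^ (1 - q), by positivity, ?_⟩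
  set K := 1 + Mw + Mw ^ (-q) + Mw ^ (1 - q) with hK
  filter_upwards [eventually_cRate_pos hp', eventually_one_le_log, hls1, hls2, hbn, hlast,
    (tendsto_cRate hγ hp).eventually_le_const zero_lt_one] with
    n ⟨hn, hc, hcp, hcn⟩ hl h1 h2 hb hlq hc1
  have hn' : (0 : ℝ) < n := by exact_mod_cast hn
  set c := cRate p n
  have hl0 : 0 < Real.log n := by linarith
  set ls := Real.log n ^ s with hlsdef
  have hls : 0 < ls := Real.rpow_pos_of_pos hl0 _
  have hls1' : 1 ≤ ls := Real.one_le_rpow hl hs0.le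
  have hbpos : 0 < bTrim p q Mw Mη n := by
    have := Real.rpow_pos_of_pos hl0 (-Mη)
    rw [bTrim]; split_ifs <;> positivity
  have hcd : c ≤ dRate p q η n := by
    rw [dRate]
    split_ifs with h
    · have h3 : c ^ (1 : ℝ) ≤ c ^ (2 * q / (1 + q)) := by
        refine Real.rpow_le_rpow_of_exponent_ge hc hc1 ?_
        rw [div_le_one (by positivity)]; linarith
      rw [Real.rpow_one] at h3
      calc c ≤ c ^ (2 * q / (1 + q)) * 1 := by linarith
        _ ≤ _ := by gcongr
    · exact le_rfl
  have hdpos : 0 < dRate p q η n := hc.trans_le hcd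
  have hdc : 1 ≤ (dRate p q η n / c) ^ 2 := one_le_pow₀ ((one_le_div hc).mpr hcd)
  have hexp : Real.exp (-(2 * Real.log n)) = ((n : ℝ)⁻¹) ^ 2 := by
    rw [Real.exp_neg, two_mul, Real.exp_add, Real.exp_log hn']; field_simp
  rw [Real.rpow_neg_one] at h1 h2
  have hn1 : (n : ℝ)⁻¹ ≤ 1 := by
    rw [inv_le_one_iff₀]; right; exact_mod_cast hn
  refine ⟨hn, hc, hbpos, hls, hcd, hcp, hcn, hc1, ?_, ?_, ?_, ?_, ?_⟩
  · have hKMw : Mw ≤ K := by rw [hK]; linarith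
    refine le_trans ?_ hKMw
    rw [dRate, bTrim]
    split_ifs with h
    · have h4 : c ^ (-(2 / (1 + q))) * c ^ 2 = c ^ (2 * q / (1 + q)) := by
        rw [← Real.rpow_natCast, ← Real.rpow_add hc]; congr 1; push_cast; field_simp; ring
      have h5 : 0 < c ^ (2 * q / (1 + q)) := Real.rpow_pos_of_pos hc _
      have h6 : c ^ 2 / (c ^ (2 * q / (1 + q)) * ls) * (Mw * c ^ (-(2 / (1 + q)))) * ls
          = Mw * (c ^ (-(2 / (1 + q))) * c ^ 2) / c ^ (2 * q / (1 + q)) := by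
        field_simp
      change c ^ 2 / (c ^ (2 * q / (1 + q)) * ls) * (Mw * c ^ (-(2 / (1 + q)))) * ls ≤ Mw
      rw [h6, h4, mul_div_cancel_right₀ _ h5.ne']
    · have h4 : Real.log n ^ (-Mη) * ls ≤ 1 := by
        rw [hlsdef, ← Real.rpow_add hl0]
        exact Real.rpow_le_one_of_one_le_of_nonpos hl (by linarith)
      calc c ^ 2 / c * (Mw * c⁻¹ * Real.log n ^ (-Mη)) * ls
          = Mw * (Real.log n ^ (-Mη) * ls) := by field_simp
        _ ≤ Mw * 1 := by gcongr
        _ = Mw := mul_one _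
  · have hKMw : Mw ^ (-q) ≤ K := by rw [hK]; linarith
    refine le_trans ?_ (mul_le_mul_of_nonneg_right hKMw hdpos.le)
    rw [dRate, bTrim]
    split_ifs with h
    · rw [Real.mul_rpow hMw.le (Real.rpow_nonneg hc.le _), ← Real.rpow_mul hc.le]
      apply le_of_eq
      rw [show -(2 / (1 + q)) * -q = 2 * q / (1 + q) by field_simp]
      ring
    · rw [Real.mul_rpow (by positivity) (Real.rpow_nonneg hl0.le _),
        Real.mul_rpow hMw.le (by positivity), ← Real.rpow_mul hl0.le, Real.inv_rpow hc.le,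
        Real.rpow_neg hc.le, inv_inv, show -Mη * -q = Mη * q by ring]
      have h4 : c ^ q = c ^ (q - 1) * c := by
        rw [Real.rpow_sub_one hc.ne']; field_simp
      have h5 : ls * Real.log n ^ (Mη * q) = Real.log n ^ (s + Mη * q) := by
        rw [hlsdef, ← Real.rpow_add hl0]
      calc ls * (Mw ^ (-q) * c ^ q * Real.log n ^ (Mη * q))
          = Mw ^ (-q) * (c ^ (q - 1) * (ls * Real.log n ^ (Mη * q))) * c := by rw [h4]; ring
        _ ≤ Mw ^ (-q) * 1 * c := by
            rw [h5]; gcongr; exact hlq h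
        _ = _ := by ring
  · have hK1 : 1 ≤ K := by rw [hK]; linarith
    have h4 : (n : ℝ)⁻¹ ≤ c := hcn.trans (by nlinarith)
    rw [hexp]
    calc ls * (n : ℝ)⁻¹ ^ 2 = (ls * (n : ℝ)⁻¹) * (n : ℝ)⁻¹ := by ring
      _ ≤ 1 * dRate p q η n := by gcongr; exact h4.trans hcd
      _ ≤ K * dRate p q η n := by gcongr
  · intro h
    have hKMw : Mw ^ (1 - q) ≤ K := by rw [hK]; linarith
    refine le_trans (le_of_eq ?_) (mul_le_mul_of_nonneg_right hKMw (sq_nonneg _))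
    rw [dRate, bTrim, if_pos h, if_pos h, Real.mul_rpow hMw.le (Real.rpow_nonneg hc.le _),
      ← Real.rpow_mul hc.le]
    have h4 : c ^ (-(2 / (1 + q)) * (1 - q)) = (c ^ (2 * q / (1 + q)) / c) ^ 2 := by
      rw [← Real.rpow_sub_one hc.ne', ← Real.rpow_natCast, ← Real.rpow_mul hc.le]
      congr 1; push_cast; field_simp; ring
    change Mw ^ (1 - q) * c ^ (-(2 / (1 + q)) * (1 - q)) * ls ^ 2
      = Mw ^ (1 - q) * (c ^ (2 * q / (1 + q)) * ls / c) ^ 2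
    rw [h4]; ring
  · have hK1 : 1 ≤ K := by rw [hK]; linarith
    have h3 : ls ^ 2 = Real.log n ^ (s * 2) := by
      rw [hlsdef, ← Real.rpow_natCast, ← Real.rpow_mul hl0.le]; norm_num
    rw [hexp]
    calc bTrim p q Mw Mη n * ls ^ 2 * (n : ℝ)⁻¹ ^ 2
        = (bTrim p q Mw Mη n / n) * (ls ^ 2 * (n : ℝ)⁻¹) := by ring
      _ ≤ 1 * 1 := by rw [h3]; gcongr
      _ = 1 * 1 := rfl
      _ ≤ K * (dRate p q η n / c) ^ 2 := by gcongr

end Rates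

/-! ### Change of measure under covariate shift -/

namespace ShiftModel

variable {p : ℕ} (M : ShiftModel p)

lemma measurable_w : Measurable M.w := M.measurable_fte.div M.measurable_ftr

lemma w_nonneg (u : Fin p → ℝ) : 0 ≤ M.w u := div_nonneg (M.fte_nonneg u) (M.ftr_nonneg u)

lemma testX_eq_withDensity :
    M.testX = M.trainX.withDensity fun u => ENNReal.ofReal (M.w u) := by
  have h1 := M.measurable_ftr
  have h2 := M.measurable_w
  rw [testX, trainX, ← withDensity_mul _ (by fun_prop) (by fun_prop)]
  congr 1
  ext u
  rw [Pi.mul_apply, ← ENNReal.ofReal_mul (M.ftr_nonneg u)]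
  -- The identity ftr · w = fte could fail only where ftr vanishes; the common support makes fte
  -- vanish there too.
  rcases (M.ftr_nonneg u).eq_or_lt with h | h
  · have h3 : M.fte u = 0 :=
      le_antisymm (not_lt.mp fun h4 => ((M.common_support u).mpr h4).ne h) (M.fte_nonneg u)
    simp [w, h3]
  · congr 1
    rw [w]; field_simp

/-- The common conditional law cancels, so weights depending on x alone also correct averages that
involve y. -/
lemma testLaw_eq_withDensity :
    M.testLaw = M.trainLaw.withDensity fun z => ENNReal.ofReal (M.w z.1) := by
  have := M.markov
  have h2 := M.measurable_w
  refine Measure.ext_of_lintegral _ fun f hf => ?_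
  rw [lintegral_withDensity_eq_lintegral_mul _ (by fun_prop) hf, testLaw, trainLaw,
    Measure.lintegral_compProd hf, Measure.lintegral_compProd (by fun_prop), testX_eq_withDensity,
    lintegral_withDensity_eq_lintegral_mul _ (by fun_prop) (by fun_prop)]
  refine lintegral_congr fun u => ?_
  simp only [Pi.mul_apply]
  rw [lintegral_const_mul _ (by fun_prop)]

lemma map_fst_testLaw : M.testLaw.map Prod.fst = M.testX := by
  have := M.markov
  exact Measure.fst_compProd _ _

lemma lintegral_testX {f : (Fin p → ℝ) → ℝ≥0∞} (hf : Measurable f) :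
    ∫⁻ u, f u ∂M.testX = ∫⁻ z, f z.1 ∂M.testLaw := by
  rw [← map_fst_testLaw, lintegral_map hf measurable_fst]

lemma integral_testX {f : (Fin p → ℝ) → ℝ} (hf : Measurable f) :
    ∫ u, f u ∂M.testX = ∫ z, f z.1 ∂M.testLaw := by
  rw [← map_fst_testLaw, integral_map measurable_fst.aemeasurable hf.aestronglyMeasurable]

end ShiftModel

@[fun_prop]
lemma measurable_aug {p : ℕ} (i : Fin (p + 1)) : Measurable fun u : Fin p → ℝ => aug u i := by
  refine Fin.cases ?_ (fun j => ?_) i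
  · simp [aug]
  · simpa [aug] using measurable_pi_apply j

@[fun_prop]
lemma measurable_residual {p : ℕ} (a : ℝ) (b : Fin p → ℝ) : Measurable (residual a b) := by
  unfold residual dotProduct
  fun_prop

/-! ### Moment bounds -/

lemma exists_rpow_le_mul_exp {r : ℝ} (hr : 0 ≤ r) {θ : ℝ} (hθ : 0 < θ) :
    ∃ C : ℝ, 0 < C ∧ ∀ x : ℝ, 0 ≤ x → x ^ r ≤ C * Real.exp (θ * x) := by
  obtain ⟨k, hk⟩ := exists_nat_ge r
  refine ⟨1 + k.factorial / θ ^ k, by positivity, fun x hx => ?_⟩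
  have h1 : x ^ r ≤ 1 + x ^ k := by
    rcases le_total x 1 with h | h
    · have := Real.rpow_le_one hx h hr
      have := pow_nonneg hx k
      linarith
    · have := Real.rpow_le_rpow_of_exponent_le h hk
      rw [Real.rpow_natCast] at this
      linarith
  have h2 : x ^ k ≤ k.factorial / θ ^ k * Real.exp (θ * x) := by
    have := Real.pow_div_factorial_le_exp (θ * x) (by positivity) k
    rw [div_le_iff₀ (by positivity), mul_pow] at this
    rw [div_mul_eq_mul_div, le_div_iff₀ (by positivity)]
    linarith
  have h3 : 1 ≤ Real.exp (θ * x) := Real.one_le_exp (by positivity)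
  linarith

lemma exists_eventually_le_of_limsup_lt_top {f : ℕ → ℝ≥0∞} (h : limsup f atTop < ⊤) :
    ∃ K : ℝ, 0 < K ∧ ∀ᶠ n in atTop, f n ≤ ENNReal.ofReal K := by
  obtain ⟨K, hK1, hK2⟩ := exists_between h
  refine ⟨K.toReal + 1, by positivity, ?_⟩
  filter_upwards [eventually_lt_of_limsup_lt hK1] with n hn
  refine hn.le.trans ?_
  rw [ENNReal.le_ofReal_iff_toReal_le hK2.ne (by positivity)]
  linarith

lemma lintegral_ofReal_le_of_le_mul {S : Type*} [MeasurableSpace S] {μ : Measure S}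
    {f g : S → ℝ} {C K : ℝ} (hC : 0 ≤ C) (hg : Measurable g) (hfg : ∀ z, f z ≤ C * g z)
    (hK : ∫⁻ z, ENNReal.ofReal (g z) ∂μ ≤ ENNReal.ofReal K) :
    ∫⁻ z, ENNReal.ofReal (f z) ∂μ ≤ ENNReal.ofReal (C * K) := by
  calc ∫⁻ z, ENNReal.ofReal (f z) ∂μ ≤ ∫⁻ z, ENNReal.ofReal C * ENNReal.ofReal (g z) ∂μ := by
        refine lintegral_mono fun z => ?_
        rw [← ENNReal.ofReal_mul hC]
        exact ENNReal.ofReal_le_ofReal (hfg z)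
    _ = ENNReal.ofReal C * ∫⁻ z, ENNReal.ofReal (g z) ∂μ := lintegral_const_mul _ (by fun_prop)
    _ ≤ ENNReal.ofReal C * ENNReal.ofReal K := by gcongr
    _ = _ := (ENNReal.ofReal_mul hC).symm

lemma lintegral_ofReal_le_of_le_add {S : Type*} [MeasurableSpace S] {μ : Measure S}
    {f g h : S → ℝ} {C D K L : ℝ} (hC : 0 ≤ C) (hD : 0 ≤ D) (hK0 : 0 ≤ K) (hL0 : 0 ≤ L)
    (hg : Measurable g) (hh : Measurable h)
    (hfg : ∀ z, f z ≤ C * g z + D * h z)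
    (hK : ∫⁻ z, ENNReal.ofReal (g z) ∂μ ≤ ENNReal.ofReal K)
    (hL : ∫⁻ z, ENNReal.ofReal (h z) ∂μ ≤ ENNReal.ofReal L) :
    ∫⁻ z, ENNReal.ofReal (f z) ∂μ ≤ ENNReal.ofReal (C * K + D * L) := by
  calc ∫⁻ z, ENNReal.ofReal (f z) ∂μ
      ≤ ∫⁻ z, (ENNReal.ofReal (C * g z) + ENNReal.ofReal (D * h z)) ∂μ := by
        refine lintegral_mono fun z => ?_
        exact (ENNReal.ofReal_le_ofReal (hfg z)).trans ENNReal.ofReal_add_le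
    _ = ∫⁻ z, ENNReal.ofReal (C * g z) ∂μ + ∫⁻ z, ENNReal.ofReal (D * h z) ∂μ :=
        lintegral_add_left (by fun_prop) _
    _ ≤ ENNReal.ofReal (C * K) + ENNReal.ofReal (D * L) :=
        add_le_add (lintegral_ofReal_le_of_le_mul hC hg (fun _ => le_rfl) hK)
          (lintegral_ofReal_le_of_le_mul hD hh (fun _ => le_rfl) hL)
    _ = _ := (ENNReal.ofReal_add (by positivity) (by positivity)).symm

/-! ### Uniform deviation over finite families -/

/-- Fixed-sample deviation bound for one member of the family. -/
lemma measure_deviation_le_of_rateRelations {S Ω : Type*} [MeasurableSpace S]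
    [MeasurableSpace Ω] {μ τ : Measure S} [IsProbabilityMeasure μ] {w : S → ℝ} {P : Measure Ω}
    {n : ℕ} {ζ : Fin n → Ω → S} (hζ : ∀ t, Measurable (ζ t)) (hind : iIndepFun ζ P)
    (hlaw : ∀ t, P.map (ζ t) = μ) (hw : Measurable w) (hw0 : ∀ z, 0 ≤ w z)
    (hτ : τ = μ.withDensity fun z => ENNReal.ofReal (w z))
    {K q c d b ls L : ℝ} (hK : 1 ≤ K) (hq : 0 < q) (hr : RateRelations n K q c d b ls L)
    (hlog : 1 ≤ Real.log n) (hlogK : 4 * (25 * K ^ 4) ^ 2 ≤ Real.log n)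
    {Z R : S → ℝ} (hZ : Measurable Z) (hR : Measurable R) (hR0 : ∀ z, 0 ≤ R z)
    (hZR : ∀ z, |Z z| ≤ K * ls * (1 + R z / Real.log n))
    (hRint : ∫⁻ z, ENNReal.ofReal (Real.exp (R z)) ∂τ ≤ ENNReal.ofReal K)
    (hwint : ∫⁻ z, ENNReal.ofReal (w z ^ q) ∂τ ≤ ENNReal.ofReal K)
    (hZint : 1 < q → ∫⁻ z, ENNReal.ofReal ((Z z ^ 2) ^ (q / (q - 1))) ∂τ ≤ ENNReal.ofReal K) :
    P {ω | (7 * (25 * K ^ 4) ^ 3 + (Real.exp (5 * (25 * K ^ 4) ^ 2) * (25 * K ^ 4)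
        + 128 * (25 * K ^ 4) ^ 2 * Real.exp ((25 * K ^ 4) ^ 2) * (25 * K ^ 4) * (25 * K ^ 4)) + 4)
        * d ≤ |(n : ℝ)⁻¹ * ∑ t, min (w (ζ t ω)) b * Z (ζ t ω) - ∫ z, Z z ∂τ|}
      ≤ ENNReal.ofReal (2 * Real.exp (-(4 * L))) := by
  have hK0 : 0 < K := by linarith
  set K' := 25 * K ^ 4 with hK'
  have hKK : K ≤ K' := by
    have := one_le_pow₀ hK (n := 3)
    have : K * 1 ≤ K * K ^ 3 := by gcongr
    nlinarith
  have hK2 : 2 * K ≤ K' := by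
    have := one_le_pow₀ hK (n := 3)
    have : K * 1 ≤ K * K ^ 3 := by gcongr
    nlinarith
  have hd : 0 < d := hr.pos_c.trans_le hr.le_d
  have hmono : ENNReal.ofReal K ≤ ENNReal.ofReal K' := ENNReal.ofReal_le_ofReal hKK
  have hls := hr.pos_ls
  have hb := hr.pos_b
  have hdc : 1 ≤ (d / c) ^ 2 := one_le_pow₀ ((one_le_div hr.pos_c).mpr hr.le_d)
  have hwq : ∀ z, 0 ≤ w z ^ q := fun z => Real.rpow_nonneg (hw0 z) q
  have hwqm : Measurable fun z => w z ^ q := hw.pow_const q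
  -- The variance is controlled in two ways. For q ≤ 1, interpolation gives min(w, b) ≤ b^(1-q) w^q,
  -- and 25 is (1 + 4)², the size of Z² where R ≤ 4 log n. For q > 1, Young's inequality splits w Z²
  -- into w^q and a conjugate power of Z², so trimming plays no role in the variance.
  obtain ⟨G, hGm, hG0, hVG, hGint⟩ : ∃ G : S → ℝ, Measurable G ∧ (∀ z, 0 ≤ G z) ∧
      (∀ z, R z ≤ 4 * Real.log n → min (w z) b * Z z ^ 2 ≤ (d / c) ^ 2 * G z) ∧
      ∫⁻ z, ENNReal.ofReal (G z) ∂τ ≤ ENNReal.ofReal K' := by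
    rcases le_or_gt q 1 with h | h
    · refine ⟨fun z => 25 * K ^ 3 * w z ^ q, by fun_prop,
        fun z => by have := hwq z; positivity, fun z hz => ?_, ?_⟩
      · have h3 : R z / Real.log n ≤ 4 := by rw [div_le_iff₀ (by linarith)]; exact hz
        have h4 : Z z ^ 2 ≤ 25 * K ^ 2 * ls ^ 2 := by
          calc Z z ^ 2 = |Z z| ^ 2 := (sq_abs _).symm
            _ ≤ (K * ls * 5) ^ 2 := by
              gcongr
              refine (hZR z).trans ?_
              gcongr; linarith
            _ = _ := by ring
        have h5 : min (w z) b ≤ b ^ (1 - q) * w z ^ q := by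
          have hm0 : 0 ≤ min (w z) b := le_min (hw0 z) hb.le
          calc min (w z) b = min (w z) b ^ (1 - q) * min (w z) b ^ q := by
                rcases hm0.eq_or_lt with h0 | h0
                · rw [← h0, Real.zero_rpow hq.ne']; simp
                · rw [← Real.rpow_add h0]; simp
            _ ≤ _ := mul_le_mul
                (Real.rpow_le_rpow hm0 (min_le_right (w z) b) (by linarith))
                (Real.rpow_le_rpow hm0 (min_le_left (w z) b) hq.le)
                (Real.rpow_nonneg hm0 _) (Real.rpow_nonneg hb.le _)
        have := hwq z
        calc min (w z) b * Z z ^ 2 ≤ (b ^ (1 - q) * w z ^ q) * (25 * K ^ 2 * ls ^ 2) := by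
              gcongr
          _ = 25 * K ^ 2 * (b ^ (1 - q) * ls ^ 2) * w z ^ q := by ring
          _ ≤ 25 * K ^ 2 * (K * (d / c) ^ 2) * w z ^ q := by
              have h6 := hr.variance h
              exact mul_le_mul_of_nonneg_right
                (mul_le_mul_of_nonneg_left h6 (by positivity)) (hwq z)
          _ = _ := by ring
      · refine (lintegral_ofReal_le_of_le_mul (C := 25 * K ^ 3) (by positivity) hwqm
          (fun z => le_rfl) hwint).trans (ENNReal.ofReal_le_ofReal (le_of_eq ?_))
        rw [hK']; ring
    · have hconj : q.HolderConjugate (q / (q - 1)) := Real.HolderConjugate.conjExponent h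
      have hZq : ∀ z, 0 ≤ (Z z ^ 2) ^ (q / (q - 1)) := fun z => by positivity
      refine ⟨fun z => w z ^ q + (Z z ^ 2) ^ (q / (q - 1)), by fun_prop,
        fun z => add_nonneg (hwq z) (hZq z), fun z hz => ?_, ?_⟩
      · have h1 := Real.young_inequality_of_nonneg (hw0 z) (sq_nonneg (Z z)) hconj
        have h2 : w z ^ q / q ≤ w z ^ q := div_le_self (hwq z) h.le
        have h3 : (Z z ^ 2) ^ (q / (q - 1)) / (q / (q - 1)) ≤ (Z z ^ 2) ^ (q / (q - 1)) :=
          div_le_self (hZq z) hconj.symm.lt.le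
        have h4 : min (w z) b * Z z ^ 2 ≤ w z * Z z ^ 2 := by
          gcongr; exact min_le_left _ _
        have h5 := hwq z
        have h6 := hZq z
        nlinarith
      · refine (lintegral_ofReal_le_of_le_add zero_le_one zero_le_one hK0.le hK0.le hwqm
          (by fun_prop) (fun z => by rw [one_mul, one_mul]) hwint (hZint h)).trans
          (ENNReal.ofReal_le_ofReal ?_)
        linarith
  refine measure_trimmed_mean_deviation_le hr.pos_n hζ hind hlaw hw hw0 hτ hZ hR hGm hR0 hG0 hb
    (hK0.le.trans hKK) hlog hlogK hls hq hd hr.pos_c hr.mul_sq (fun z => (hZR z).trans ?_)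
    (hRint.trans hmono) (hwint.trans hmono) (hr.trim.trans (by gcongr))
    (hr.tail.trans (by gcongr)) (hr.chernoff.trans hKK) hVG hGint (hr.large.trans (by gcongr))
  have := hR0 z
  gcongr

/-! ### Uniform deviation of trimmed importance-weighted sample means -/

/-- `ζ` is an i.i.d. sample from the training law of `M`. -/
structure IsSample {p n : ℕ} (M : ShiftModel p) {Ω : Type*} [MeasurableSpace Ω] (P : Measure Ω)
    (ζ : Fin n → Ω → (Fin p → ℝ) × ℝ) : Prop where
  measurable : ∀ t, Measurable (ζ t)
  indep : iIndepFun ζ P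
  law : ∀ t, P.map (ζ t) = M.trainLaw

/-- The union bound: at most (p+1)² averages, each failing with probability at most 2p^(-4). -/
lemma eventually_exp_log_le {p : ℕ → ℕ} (hp' : Tendsto p atTop atTop) :
    Tendsto (fun n => ENNReal.ofReal ((p n + 1) ^ 2 * (2 * Real.exp (-(4 * Real.log (p n))))))
      atTop (𝓝 0) := by
  rw [← ENNReal.ofReal_zero]
  refine ENNReal.tendsto_ofReal ?_
  have h1 : Tendsto (fun n => 8 * ((p n : ℝ)⁻¹)) atTop (𝓝 (8 * 0)) :=
    ((tendsto_inv_atTop_zero.comp tendsto_natCast_atTop_atTop).comp hp').const_mul 8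
  rw [mul_zero] at h1
  refine squeeze_zero' (Eventually.of_forall fun n => by positivity) ?_ h1
  filter_upwards [hp'.eventually_ge_atTop 1] with n hn
  have hn1 : (1 : ℝ) ≤ p n := by exact_mod_cast hn
  have hp0 : (0 : ℝ) < p n := by linarith
  have h2 : Real.exp (-(4 * Real.log (p n))) = ((p n : ℝ) ^ 4)⁻¹ := by
    rw [Real.exp_neg, ← Real.exp_log (show (0 : ℝ) < (p n : ℝ) ^ 4 by positivity), Real.log_pow]
    norm_num
  rw [h2]
  calc ((p n : ℝ) + 1) ^ 2 * (2 * ((p n : ℝ) ^ 4)⁻¹)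
      ≤ (2 * p n) ^ 2 * (2 * ((p n : ℝ) ^ 4)⁻¹) := by gcongr; linarith
    _ = 8 * ((p n : ℝ)⁻¹ * (p n : ℝ)⁻¹) := by field_simp; ring
    _ ≤ 8 * ((p n : ℝ)⁻¹ * 1) := by
        gcongr; exact inv_le_one_of_one_le₀ hn1
    _ = _ := by ring

/-- R is the exponentially integrable quantity that controls Z: the average behaves like one of
variables of size (log n)^(1/η + 1/2) unless R exceeds a multiple of log n. All constants are merged
into one K, uniform over the family, before the one-variable bound is summed. -/
theorem tendsto_measure_exists_deviation {p : ℕ → ℕ} (M : ∀ n, ShiftModel (p n))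
    {Ω : ℕ → Type*} [∀ n, MeasurableSpace (Ω n)] {P : ∀ n, Measure (Ω n)}
    {ζ : ∀ n, Fin n → Ω n → (Fin (p n) → ℝ) × ℝ} (hS : ∀ n, IsSample (M n) (P n) (ζ n))
    {γ q η Mw Mη : ℝ} (hγ : γ < 1)
    (hp : (fun n => Real.log (p n)) =O[atTop] (fun n : ℕ => (n : ℝ) ^ γ))
    (hp' : Tendsto p atTop atTop) (hq : 0 < q) (hη : 0 < η) (hMw : 0 < Mw)
    (hMη : 1 / η + 1 / 2 ≤ Mη)
    (hw : ∃ K : ℝ, ∀ᶠ n in atTop, ∫⁻ z, ENNReal.ofReal ((M n).w z.1 ^ q) ∂(M n).testLaw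
      ≤ ENNReal.ofReal K)
    {ι : ℕ → Type*} [∀ n, Fintype (ι n)] (hι : ∀ n, Fintype.card (ι n) ≤ (p n + 1) ^ 2)
    {Z R : ∀ n, ι n → (Fin (p n) → ℝ) × ℝ → ℝ} (hZ : ∀ n i, Measurable (Z n i))
    (hR : ∀ n i, Measurable (R n i)) (hR0 : ∀ n i z, 0 ≤ R n i z)
    (hZR : ∃ K : ℝ, ∀ᶠ n : ℕ in atTop, ∀ i z,
      |Z n i z| ≤ K * Real.log n ^ (1 / η + 1 / 2) * (1 + R n i z / Real.log n))
    (hRint : ∃ K : ℝ, ∀ᶠ n in atTop, ∀ i,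
      ∫⁻ z, ENNReal.ofReal (Real.exp (R n i z)) ∂(M n).testLaw ≤ ENNReal.ofReal K)
    (hZint : 1 < q → ∃ K : ℝ, ∀ᶠ n in atTop, ∀ i,
      ∫⁻ z, ENNReal.ofReal ((Z n i z ^ 2) ^ (q / (q - 1))) ∂(M n).testLaw ≤ ENNReal.ofReal K) :
    ∃ A : ℝ, 0 < A ∧ Tendsto (fun n => P n {ω | ∃ i, A * dRate p q η n ≤
      |(n : ℝ)⁻¹ * ∑ t, min ((M n).w (ζ n t ω).1) (bTrim p q Mw Mη n) * Z n i (ζ n t ω)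
        - ∫ z, Z n i z ∂(M n).testLaw|}) atTop (𝓝 0) := by
  obtain ⟨K1, hK1, hrate⟩ := exists_eventually_rateRelations hγ hp hp' hq hη hMw hMη
  obtain ⟨K2, hw⟩ := hw
  obtain ⟨K3, hZR⟩ := hZR
  obtain ⟨K4, hRint⟩ := hRint
  obtain ⟨K5, hZint⟩ : ∃ K : ℝ, ∀ᶠ n in atTop, 1 < q → ∀ i,
      ∫⁻ z, ENNReal.ofReal ((Z n i z ^ 2) ^ (q / (q - 1))) ∂(M n).testLaw
        ≤ ENNReal.ofReal K := by
    by_cases h : 1 < q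
    · obtain ⟨K, hK⟩ := hZint h
      exact ⟨K, hK.mono fun n hn _ => hn⟩
    · exact ⟨0, Eventually.of_forall fun n hn => absurd hn h⟩
  set K := 1 + K1 + |K2| + |K3| + |K4| + |K5| with hKdef
  have a2 := abs_nonneg K2
  have a3 := abs_nonneg K3
  have a4 := abs_nonneg K4
  have a5 := abs_nonneg K5
  have hK : 1 ≤ K := by rw [hKdef]; linarith
  have l1 : K1 ≤ K := by rw [hKdef]; linarith
  have l2 : K2 ≤ K := by rw [hKdef]; linarith [le_abs_self K2]
  have l3 : K3 ≤ K := by rw [hKdef]; linarith [le_abs_self K3]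
  have l4 : K4 ≤ K := by rw [hKdef]; linarith [le_abs_self K4]
  have l5 : K5 ≤ K := by rw [hKdef]; linarith [le_abs_self K5]
  refine ⟨7 * (25 * K ^ 4) ^ 3 + (Real.exp (5 * (25 * K ^ 4) ^ 2) * (25 * K ^ 4)
        + 128 * (25 * K ^ 4) ^ 2 * Real.exp ((25 * K ^ 4) ^ 2) * (25 * K ^ 4) * (25 * K ^ 4)) + 4,
    by positivity, ?_⟩
  refine tendsto_of_tendsto_of_tendsto_of_le_of_le' tendsto_const_nhds
    (eventually_exp_log_le hp') (Eventually.of_forall fun _ => bot_le) ?_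
  have hlogK : ∀ᶠ n : ℕ in atTop, 4 * (25 * K ^ 4) ^ 2 ≤ Real.log n :=
    (Real.tendsto_log_atTop.comp tendsto_natCast_atTop_atTop).eventually_ge_atTop _
  filter_upwards [hrate, hw, hZR, hRint, hZint, hlogK, eventually_one_le_log] with
    n hrn hwn hZRn hRn hZn hlK hl1
  have hwm : Measurable fun z : (Fin (p n) → ℝ) × ℝ => (M n).w z.1 :=
    (M n).measurable_w.comp measurable_fst
  have hrn' : RateRelations n K q (cRate p n) (dRate p q η n) (bTrim p q Mw Mη n)
      (Real.log n ^ (1 / η + 1 / 2)) (Real.log (p n)) := by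
    have hd : 0 < dRate p q η n := hrn.pos_c.trans_le hrn.le_d
    exact { hrn with
      chernoff := hrn.chernoff.trans l1
      trim := hrn.trim.trans (by gcongr)
      tail := hrn.tail.trans (by gcongr)
      variance := fun h => (hrn.variance h).trans (by gcongr)
      large := hrn.large.trans (by gcongr) }
  have hls := hrn.pos_ls
  rw [Set.ofPred_exists]
  refine (measure_iUnion_le _).trans ?_
  calc _ ≤ ∑' _i : ι n, ENNReal.ofReal (2 * Real.exp (-(4 * Real.log (p n)))) := by
        refine ENNReal.tsum_le_tsum fun i => ?_
        refine measure_deviation_le_of_rateRelations (hS n).measurable (hS n).indep (hS n).law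
          hwm (fun z => (M n).w_nonneg _) (M n).testLaw_eq_withDensity hK hq hrn' hl1 hlK
          (hZ n i) (hR n i) (hR0 n i) (fun z => (hZRn i z).trans ?_)
          ((hRn i).trans (ENNReal.ofReal_le_ofReal l4))
          (hwn.trans (ENNReal.ofReal_le_ofReal l2))
          (fun h => (hZn h i).trans (ENNReal.ofReal_le_ofReal l5))
        have := hR0 n i z
        gcongr
    _ = Fintype.card (ι n) * ENNReal.ofReal (2 * Real.exp (-(4 * Real.log (p n)))) := by
        rw [tsum_fintype, Finset.sum_const, Finset.card_univ, nsmul_eq_mul]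
    _ ≤ ENNReal.ofReal ((p n + 1) ^ 2) *
        ENNReal.ofReal (2 * Real.exp (-(4 * Real.log (p n)))) := by
        gcongr
        rw [← ENNReal.ofReal_natCast]
        refine ENNReal.ofReal_le_ofReal ?_
        exact_mod_cast hι n
    _ = _ := (ENNReal.ofReal_mul (by positivity)).symm

/-! ### First-order conditions of the best linear predictor -/

section BestLinearPredictor

variable {p : ℕ} {M : ShiftModel p} {a : ℝ} {b : Fin p → ℝ}

lemma ShiftModel.IsBestLinearPredictor.memLp_aug (h : M.IsBestLinearPredictor a b)
    (i : Fin (p + 1)) : MemLp (fun z : (Fin p → ℝ) × ℝ => aug z.1 i) 2 M.testLaw := by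
  refine Fin.cases ?_ (fun j => ?_) i
  · simpa [aug] using memLp_const (1 : ℝ)
  · simpa [aug] using h.2.1 j

lemma ShiftModel.IsBestLinearPredictor.memLp_residual (h : M.IsBestLinearPredictor a b)
    (a' : ℝ) (b' : Fin p → ℝ) : MemLp (residual a' b') 2 M.testLaw := by
  unfold residual dotProduct
  exact h.1.sub ((memLp_const a').add (memLp_finsetSum _ fun j _ => (h.2.1 j).const_mul (b' j)))

/-- Moving one coefficient by t changes the risk by a quadratic in t that is nonnegative everywhere
and has no constant term, so its linear coefficient vanishes. Under misspecification this
orthogonality replaces a zero conditional mean of the noise. -/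
lemma ShiftModel.IsBestLinearPredictor.integral_aug_mul_residual
    (h : M.IsBestLinearPredictor a b) (i : Fin (p + 1)) :
    ∫ z, aug z.1 i * residual a b z ∂M.testLaw = 0 := by
  have hx := h.memLp_aug i
  have he := h.memLp_residual a b
  have hxe : Integrable (fun z => aug z.1 i * residual a b z) M.testLaw := hx.integrable_mul he
  have key : ∀ t : ℝ, 0 ≤ t ^ 2 * ∫ z, aug z.1 i ^ 2 ∂M.testLaw
      - 2 * t * ∫ z, aug z.1 i * residual a b z ∂M.testLaw := by
    intro t
    obtain ⟨a', b', hab⟩ : ∃ a' b', ∀ z : (Fin p → ℝ) × ℝ,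
        residual a' b' z = residual a b z - t * aug z.1 i := by
      refine Fin.cases ⟨a + t, b, fun z => ?_⟩ (fun j => ⟨a, b + Pi.single j t, fun z => ?_⟩) i
      · simp [residual, aug]; ring
      · simp [residual, aug, add_dotProduct]; ring
    have h1 := h.2.2 a' b'
    have h2 : ∫ z, residual a' b' z ^ 2 ∂M.testLaw = ∫ z, residual a b z ^ 2 ∂M.testLaw
        - 2 * t * ∫ z, aug z.1 i * residual a b z ∂M.testLaw
        + t ^ 2 * ∫ z, aug z.1 i ^ 2 ∂M.testLaw := by
      rw [← integral_const_mul, ← integral_const_mul, ← integral_sub he.integrable_sq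
        (hxe.const_mul _), ← integral_add (f := fun z => residual a b z ^ 2
          - 2 * t * (aug z.1 i * residual a b z)) (he.integrable_sq.sub (hxe.const_mul _))
        (hx.integrable_sq.const_mul _)]
      refine integral_congr_ae (Eventually.of_forall fun z => ?_)
      simp only [hab]
      ring
    linarith
  set e := ∫ z, aug z.1 i * residual a b z ∂M.testLaw
  set v := ∫ z, aug z.1 i ^ 2 ∂M.testLaw
  have hv : 0 ≤ v := integral_nonneg fun z => sq_nonneg _
  by_contra hne
  -- Dividing by v + 1 instead of v covers the case v = 0.
  have := key (e / (v + 1))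
  have h2 : (e / (v + 1)) ^ 2 * v - 2 * (e / (v + 1)) * e
      = -(e / (v + 1)) ^ 2 * (v + 2) := by
    field_simp; ring
  rw [h2] at this
  have h3 : 0 < (e / (v + 1)) ^ 2 := by positivity
  nlinarith

end BestLinearPredictor

/-! ### Sample moments under the true trimmed weights -/

section Events

variable {p : ℕ → ℕ} {M : ∀ n, ShiftModel (p n)} {α : ℕ → ℝ} {β : ∀ n, Fin (p n) → ℝ}
  {Ω : ℕ → Type*} [∀ n, MeasurableSpace (Ω n)] {P : ∀ n, Measure (Ω n)}
  {ζ : ∀ n, Fin n → Ω n → (Fin (p n) → ℝ) × ℝ} {γ q η θ₀ Mw Mη : ℝ}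

/-- Second moments of the covariates. -/
theorem tendsto_measure_covariate_deviation (hS : ∀ n, IsSample (M n) (P n) (ζ n))
    (hγ : γ < 1) (hp : (fun n => Real.log (p n)) =O[atTop] (fun n : ℕ => (n : ℝ) ^ γ))
    (hp' : Tendsto p atTop atTop) (hq : 0 < q) (hη : 0 < η ∧ η ≤ 2) (hMw : 0 < Mw)
    (hMη : 1 / η + 1 / 2 ≤ Mη) (hθ₀ : 0 < θ₀)
    (hw : ∃ K : ℝ, ∀ᶠ n in atTop, ∫⁻ z, ENNReal.ofReal ((M n).w z.1 ^ q) ∂(M n).testLaw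
      ≤ ENNReal.ofReal K)
    (hx : ∃ K : ℝ, ∀ᶠ n in atTop, ∀ i j : Fin (p n + 1),
      ∫⁻ z, ENNReal.ofReal (Real.exp (θ₀ * |aug z.1 i * aug z.1 j|)) ∂(M n).testLaw
        ≤ ENNReal.ofReal K) :
    ∃ A : ℝ, 0 < A ∧ Tendsto (fun n => P n {ω | ∃ i j : Fin (p n + 1), A * dRate p q η n ≤
      |(n : ℝ)⁻¹ * ∑ t, min ((M n).w (ζ n t ω).1) (bTrim p q Mw Mη n)
        * (aug (ζ n t ω).1 i * aug (ζ n t ω).1 j)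
        - ∫ z, aug z.1 i * aug z.1 j ∂(M n).testLaw|}) atTop (𝓝 0) := by
  obtain ⟨A, hA, hlim⟩ := tendsto_measure_exists_deviation M hS hγ hp hp' hq hη.1 hMw hMη hw
    (ι := fun n => Fin (p n + 1) × Fin (p n + 1)) (fun n => by simp [sq])
    (Z := fun n i z => aug z.1 i.1 * aug z.1 i.2)
    (R := fun n i z => θ₀ * |aug z.1 i.1 * aug z.1 i.2|)
    (fun n i => by fun_prop) (fun n i => by fun_prop) (fun n i z => by positivity)
    ⟨1 / θ₀, by
      filter_upwards [eventually_one_le_log] with n hl i z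
      -- Products of two covariates are of size log n; because η ≤ 2, the power of log n dictated by
      -- the cross moments covers them.
      have h1 : Real.log n ^ (1 : ℝ) ≤ Real.log n ^ (1 / η + 1 / 2) := by
        refine Real.rpow_le_rpow_of_exponent_le hl ?_
        have : 1 / 2 ≤ 1 / η := one_div_le_one_div_of_le hη.1 hη.2
        linarith
      rw [Real.rpow_one] at h1
      have h0 := abs_nonneg (aug z.1 i.1 * aug z.1 i.2)
      calc |aug z.1 i.1 * aug z.1 i.2|
          = 1 / θ₀ * Real.log n * (θ₀ * |aug z.1 i.1 * aug z.1 i.2| / Real.log n) := by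
            field_simp
        _ ≤ 1 / θ₀ * Real.log n ^ (1 / η + 1 / 2)
            * (1 + θ₀ * |aug z.1 i.1 * aug z.1 i.2| / Real.log n) := by
            gcongr
            linarith⟩
    (by
      obtain ⟨K, hK⟩ := hx
      exact ⟨K, hK.mono fun n hn i => hn i.1 i.2⟩)
    (fun hq1 => by
      obtain ⟨K, hK⟩ := hx
      obtain ⟨C, hC, hle⟩ := exists_rpow_le_mul_exp
        (show 0 ≤ 2 * (q / (q - 1)) by
          have : 0 < q - 1 := by linarith
          positivity) hθ₀
      refine ⟨C * K, hK.mono fun n hn i => lintegral_ofReal_le_of_le_mul hC.le (by fun_prop)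
        (fun z => ?_) (hn i.1 i.2)⟩
      refine le_trans (le_of_eq ?_) (hle _ (abs_nonneg _))
      rw [← sq_abs, ← Real.rpow_natCast, ← Real.rpow_mul (abs_nonneg _)]
      norm_num)
  refine ⟨A, hA, hlim.congr fun n => ?_⟩
  congr 1
  ext ω
  simp only [Set.mem_ofPred_eq, Prod.exists]

/-- Largest training noise. -/
theorem tendsto_measure_noise_large (hS : ∀ n, IsSample (M n) (P n) (ζ n))
    (hη : 0 < η) (hθ₀ : 0 < θ₀)
    (he : ∃ K : ℝ, ∀ᶠ n in atTop, ∫⁻ z, ENNReal.ofReal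
      (Real.exp (θ₀ * |residual (α n) (β n) z| ^ η)) ∂(M n).trainLaw ≤ ENNReal.ofReal K) :
    Tendsto (fun n => P n {ω | ∃ t, (4 * Real.log n / θ₀) ^ (1 / η) <
      |residual (α n) (β n) (ζ n t ω)|}) atTop (𝓝 0) := by
  obtain ⟨K, hK⟩ := he
  have hlim : Tendsto (fun n : ℕ => ENNReal.ofReal (|K| * ((n : ℝ)⁻¹))) atTop (𝓝 0) := by
    rw [← ENNReal.ofReal_zero]
    refine ENNReal.tendsto_ofReal ?_
    have := (tendsto_inv_atTop_zero.comp tendsto_natCast_atTop_atTop).const_mul |K|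
    rwa [mul_zero] at this
  refine tendsto_of_tendsto_of_tendsto_of_le_of_le' tendsto_const_nhds hlim
    (Eventually.of_forall fun _ => bot_le) ?_
  filter_upwards [hK, eventually_one_le_log, eventually_gt_atTop 0] with n hn hl hn0
  have hn' : (1 : ℝ) ≤ n := by exact_mod_cast hn0
  -- At this threshold the exponential moment exceeds n⁴, so Markov's inequality leaves room for a
  -- union bound over the n observations.
  have hset : ∀ z, (4 * Real.log n / θ₀) ^ (1 / η) < |residual (α n) (β n) z| →
      (1 : ℝ) ≤ ((n : ℝ)⁻¹) ^ 4 * Real.exp (θ₀ * |residual (α n) (β n) z| ^ η) := by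
    intro z hz
    have h1 : 4 * Real.log n / θ₀ ≤ |residual (α n) (β n) z| ^ η := by
      have := Real.rpow_le_rpow (by positivity) hz.le hη.le
      rwa [← Real.rpow_mul (by positivity), one_div_mul_cancel hη.ne', Real.rpow_one] at this
    have h2 : 4 * Real.log n ≤ θ₀ * |residual (α n) (β n) z| ^ η := by
      rw [div_le_iff₀ hθ₀] at h1; linarith
    have h3 : (n : ℝ) ^ 4 ≤ Real.exp (θ₀ * |residual (α n) (β n) z| ^ η) := by
      calc (n : ℝ) ^ 4 = Real.exp (4 * Real.log n) := by
            rw [← Real.exp_log (show (0 : ℝ) < (n : ℝ) ^ 4 by positivity), Real.log_pow]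
            norm_num
        _ ≤ _ := Real.exp_le_exp.mpr h2
    rw [inv_pow, ← div_eq_inv_mul, one_le_div (by positivity)]
    exact h3
  have hone : ∀ t, P n {ω | (4 * Real.log n / θ₀) ^ (1 / η) <
      |residual (α n) (β n) (ζ n t ω)|} ≤ ENNReal.ofReal (((n : ℝ)⁻¹) ^ 4 * K) := by
    intro t
    have hm : MeasurableSet {z | (4 * Real.log n / θ₀) ^ (1 / η) < |residual (α n) (β n) z|} :=
      measurableSet_lt measurable_const (by fun_prop)
    calc P n {ω | (4 * Real.log n / θ₀) ^ (1 / η) < |residual (α n) (β n) (ζ n t ω)|}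
        = (M n).trainLaw {z | (4 * Real.log n / θ₀) ^ (1 / η) < |residual (α n) (β n) z|} := by
          rw [← (hS n).law t, Measure.map_apply ((hS n).measurable t) hm]; rfl
      _ = ∫⁻ z, Set.indicator {z | (4 * Real.log n / θ₀) ^ (1 / η) <
            |residual (α n) (β n) z|} 1 z ∂(M n).trainLaw := (lintegral_indicator_one hm).symm
      _ ≤ ∫⁻ z, ENNReal.ofReal (((n : ℝ)⁻¹) ^ 4 *
            Real.exp (θ₀ * |residual (α n) (β n) z| ^ η)) ∂(M n).trainLaw := by
          refine lintegral_mono fun z => ?_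
          by_cases hz : z ∈ {z | (4 * Real.log n / θ₀) ^ (1 / η) < |residual (α n) (β n) z|}
          · rw [Set.indicator_of_mem hz, Pi.one_apply, ← ENNReal.ofReal_one]
            exact ENNReal.ofReal_le_ofReal (hset z hz)
          · rw [Set.indicator_of_notMem hz]; exact bot_le
      _ ≤ _ := lintegral_ofReal_le_of_le_mul (by positivity) (by fun_prop)
          (fun z => le_rfl) hn
  rw [Set.ofPred_exists]
  refine (measure_iUnion_le _).trans ?_
  calc _ ≤ ∑' _t : Fin n, ENNReal.ofReal (((n : ℝ)⁻¹) ^ 4 * K) :=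
        ENNReal.tsum_le_tsum fun t => hone t
    _ = ENNReal.ofReal (n * (((n : ℝ)⁻¹) ^ 4 * K)) := by
        rw [tsum_fintype, Finset.sum_const, Finset.card_univ, nsmul_eq_mul, Fintype.card_fin,
          ENNReal.ofReal_mul (p := (n : ℝ)) (by positivity), ENNReal.ofReal_natCast]
    _ ≤ _ := by
        refine ENNReal.ofReal_le_ofReal ?_
        have h1 : (n : ℝ)⁻¹ ≤ 1 := inv_le_one_of_one_le₀ hn'
        calc n * (((n : ℝ)⁻¹) ^ 4 * K) ≤ n * (((n : ℝ)⁻¹) ^ 4 * |K|) := by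
              gcongr; exact le_abs_self K
          _ = |K| * (n : ℝ)⁻¹ * ((n : ℝ)⁻¹ ^ 2) := by field_simp
          _ ≤ |K| * (n : ℝ)⁻¹ * 1 ^ 2 := by gcongr
          _ = _ := by ring

end Events

section Events

variable {p : ℕ → ℕ} {M : ∀ n, ShiftModel (p n)} {α : ℕ → ℝ} {β : ∀ n, Fin (p n) → ℝ}
  {Ω : ℕ → Type*} [∀ n, MeasurableSpace (Ω n)] {P : ∀ n, Measure (Ω n)}
  {ζ : ∀ n, Fin n → Ω n → (Fin (p n) → ℝ) × ℝ} {γ q η θ₀ Mw Mη : ℝ}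

lemma exists_abs_rpow_le_mul_exp {r η θ : ℝ} (hr : 0 ≤ r) (hη : 0 < η) (hθ : 0 < θ) :
    ∃ C : ℝ, 0 < C ∧ ∀ x : ℝ, |x| ^ r ≤ C * Real.exp (θ * |x| ^ η) := by
  obtain ⟨C, hC, hle⟩ := exists_rpow_le_mul_exp (r := r / η) (by positivity) hθ
  refine ⟨C, hC, fun x => ?_⟩
  have := hle (|x| ^ η) (by positivity)
  rwa [← Real.rpow_mul (abs_nonneg x), mul_div_cancel₀ _ hη.ne'] at this

/-- Truncating the noise changes the (vanishing) cross moments by `O(1 / n)`. -/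
lemma abs_integral_aug_mul_truncated_le {p : ℕ} {M : ShiftModel p} {a : ℝ} {b : Fin p → ℝ}
    (hblp : M.IsBestLinearPredictor a b) {η θ₀ C K n : ℝ} (hη : 0 < η) (hθ₀ : 0 < θ₀)
    (hC0 : 0 < C) (hK0 : 0 ≤ K) (hn : 1 ≤ n)
    (hC : ∀ x : ℝ, |x| ^ (2 : ℝ) ≤ C * Real.exp (θ₀ / 2 * |x| ^ η))
    (hx : ∀ i j : Fin (p + 1),
      ∫⁻ z, ENNReal.ofReal (Real.exp (θ₀ * |aug z.1 i * aug z.1 j|)) ∂M.testLaw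
        ≤ ENNReal.ofReal K)
    (he : ∫⁻ z, ENNReal.ofReal (Real.exp (θ₀ * |residual a b z| ^ η)) ∂M.testLaw
      ≤ ENNReal.ofReal K) (i : Fin (p + 1)) :
    |∫ z, (if |residual a b z| ≤ (4 * Real.log n / θ₀) ^ (1 / η) then
      aug z.1 i * residual a b z else 0) ∂M.testLaw| ≤ (1 / θ₀ + C) * K * n⁻¹ := by
  set L := (4 * Real.log n / θ₀) ^ (1 / η) with hL
  have hn0 : 0 < n := by linarith
  have hl : 0 ≤ Real.log n := Real.log_nonneg hn
  have hset : MeasurableSet {z | |residual a b z| ≤ L} :=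
    measurableSet_le (by fun_prop) measurable_const
  have hm : Measurable fun z => if |residual a b z| ≤ L then aug z.1 i * residual a b z else 0 :=
    Measurable.ite hset (by fun_prop) measurable_const
  have hint : Integrable (fun z => aug z.1 i * residual a b z) M.testLaw :=
    (hblp.memLp_aug i).integrable_mul (hblp.memLp_residual a b)
  have hint' : Integrable (fun z => if |residual a b z| ≤ L then
      aug z.1 i * residual a b z else 0) M.testLaw := by
    refine hint.norm.mono' hm.aestronglyMeasurable (Eventually.of_forall fun z => ?_)
    split_ifs
    · exact le_rfl
    · simp only [norm_zero]; positivity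
  have h0 := hblp.integral_aug_mul_residual i
  rw [show (∫ z, (if |residual a b z| ≤ L then aug z.1 i * residual a b z else 0) ∂M.testLaw)
    = ∫ z, ((if |residual a b z| ≤ L then aug z.1 i * residual a b z else 0)
      - aug z.1 i * residual a b z) ∂M.testLaw by rw [integral_sub hint' hint, h0, sub_zero]]
  refine abs_integral_le_integral_abs.trans ?_
  refine integral_le_of_lintegral_ofReal_le (by positivity)
    (hm.sub (by fun_prop)).abs (fun z => abs_nonneg _) ?_
  refine (lintegral_ofReal_le_of_le_add (C := n⁻¹ * (1 / θ₀)) (D := n⁻¹ * C)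
    (by positivity) (by positivity) hK0 hK0 (by fun_prop) (by fun_prop) (fun z => ?_) (hx i i)
    he).trans (ENNReal.ofReal_le_ofReal (le_of_eq (by ring)))
  set u := aug z.1 i
  set e := residual a b z
  have hA : 0 ≤ n⁻¹ * (1 / θ₀) * Real.exp (θ₀ * |u * u|) := by positivity
  have hB : 0 ≤ n⁻¹ * C * Real.exp (θ₀ * |e| ^ η) := by positivity
  split_ifs with h
  · rw [sub_self, abs_zero]; linarith
  · rw [zero_sub, abs_neg, abs_mul]
    -- The covariate gets the weight 1/n of the final bound. The factor n on the noise is paid by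
    -- the truncation: half of the exponential moment yields n^(-2) there.
    have h1 : |u| * |e| ≤ n⁻¹ * u ^ 2 + n * e ^ 2 := by
      have h2 : (0 : ℝ) ≤ n⁻¹ * (|u| - n * |e|) ^ 2 := by positivity
      have h3 : n⁻¹ * (|u| - n * |e|) ^ 2 = n⁻¹ * u ^ 2 - 2 * (|u| * |e|) + n * e ^ 2 := by
        rw [← sq_abs u, ← sq_abs e]; field_simp; ring
      have h4 : 0 ≤ |u| * |e| := by positivity
      linarith
    have h2 : u ^ 2 ≤ 1 / θ₀ * Real.exp (θ₀ * |u * u|) := by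
      have := Real.add_one_le_exp (θ₀ * |u * u|)
      rw [abs_mul_self] at *
      rw [div_mul_eq_mul_div, le_div_iff₀ hθ₀]
      nlinarith
    have h5 : 4 * Real.log n ≤ θ₀ * |e| ^ η := by
      have h6 := Real.rpow_le_rpow (by positivity) (not_le.mp h).le hη.le
      rw [hL, ← Real.rpow_mul (by positivity), one_div_mul_cancel hη.ne', Real.rpow_one,
        div_le_iff₀ hθ₀] at h6
      linarith
    have h7 : e ^ 2 ≤ C * ((n⁻¹) ^ 2 * Real.exp (θ₀ * |e| ^ η)) := by
      have h8 := hC e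
      rw [Real.rpow_two, sq_abs] at h8
      refine h8.trans ?_
      gcongr
      have : (n⁻¹) ^ 2 = Real.exp (-(2 * Real.log n)) := by
        rw [Real.exp_neg, two_mul, Real.exp_add, Real.exp_log hn0]; field_simp
      rw [this, ← Real.exp_add]
      exact Real.exp_le_exp.mpr (by linarith)
    calc |u| * |e| ≤ n⁻¹ * u ^ 2 + n * e ^ 2 := h1
      _ ≤ n⁻¹ * (1 / θ₀ * Real.exp (θ₀ * |u * u|))
          + n * (C * ((n⁻¹) ^ 2 * Real.exp (θ₀ * |e| ^ η))) := by gcongr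
      _ = _ := by field_simp

/-- Cross moments of covariates and noise. -/
theorem tendsto_measure_cross_deviation (hS : ∀ n, IsSample (M n) (P n) (ζ n))
    (hblp : ∀ n, (M n).IsBestLinearPredictor (α n) (β n))
    (hγ : γ < 1) (hp : (fun n => Real.log (p n)) =O[atTop] (fun n : ℕ => (n : ℝ) ^ γ))
    (hp' : Tendsto p atTop atTop) (hq : 0 < q) (hη : 0 < η) (hMw : 0 < Mw)
    (hMη : 1 / η + 1 / 2 ≤ Mη) (hθ₀ : 0 < θ₀)
    (hw : ∃ K : ℝ, ∀ᶠ n in atTop, ∫⁻ z, ENNReal.ofReal ((M n).w z.1 ^ q) ∂(M n).testLaw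
      ≤ ENNReal.ofReal K)
    (hx : ∃ K : ℝ, ∀ᶠ n in atTop, ∀ i j : Fin (p n + 1),
      ∫⁻ z, ENNReal.ofReal (Real.exp (θ₀ * |aug z.1 i * aug z.1 j|)) ∂(M n).testLaw
        ≤ ENNReal.ofReal K)
    (hetr : ∃ K : ℝ, ∀ᶠ n in atTop, ∫⁻ z, ENNReal.ofReal
      (Real.exp (θ₀ * |residual (α n) (β n) z| ^ η)) ∂(M n).trainLaw ≤ ENNReal.ofReal K)
    (hete : ∃ K : ℝ, ∀ᶠ n in atTop, ∫⁻ z, ENNReal.ofReal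
      (Real.exp (θ₀ * |residual (α n) (β n) z| ^ η)) ∂(M n).testLaw ≤ ENNReal.ofReal K) :
    ∃ A : ℝ, 0 < A ∧ Tendsto (fun n => P n {ω | ∃ i : Fin (p n + 1), A * dRate p q η n ≤
      |(n : ℝ)⁻¹ * ∑ t, min ((M n).w (ζ n t ω).1) (bTrim p q Mw Mη n)
        * (aug (ζ n t ω).1 i * residual (α n) (β n) (ζ n t ω))|}) atTop (𝓝 0) := by
  have hnoise := tendsto_measure_noise_large hS hη hθ₀ hetr
  obtain ⟨K, hK⟩ := hx
  obtain ⟨Ke, hKe⟩ := hete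
  obtain ⟨C2, hC2, hC2le⟩ := exists_abs_rpow_le_mul_exp (r := 2) (by norm_num) hη
    (half_pos hθ₀)
  -- The noise is truncated at a level that no training residual exceeds with probability tending to
  -- one. It then contributes (log n)^(1/η) and the covariate, whose square has an exponential
  -- moment, (log n)^(1/2); this is the origin of the exponent 1/η + 1/2.
  set L : ℕ → ℝ := fun n => (4 * Real.log n / θ₀) ^ (1 / η) with hL
  have hL0 : ∀ n, 0 ≤ L n := fun n => Real.rpow_nonneg
    (div_nonneg (mul_nonneg (by norm_num) (Real.log_natCast_nonneg n)) hθ₀.le) _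
  set Z : ∀ n, Fin (p n + 1) → (Fin (p n) → ℝ) × ℝ → ℝ := fun n i z =>
    if |residual (α n) (β n) z| ≤ L n then aug z.1 i * residual (α n) (β n) z else 0 with hZ
  have hZm : ∀ n i, Measurable (Z n i) := fun n i =>
    Measurable.ite (measurableSet_le (by fun_prop) measurable_const) (by fun_prop)
      measurable_const
  have hZabs : ∀ n i z, |Z n i z| ≤ |aug z.1 i * residual (α n) (β n) z| := by
    intro n i z
    simp only [hZ]
    split_ifs
    · exact le_rfl
    · simp only [abs_zero]; positivity
  obtain ⟨A, hA, hlim⟩ := tendsto_measure_exists_deviation M hS hγ hp hp' hq hη hMw hMη hw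
    (ι := fun n => Fin (p n + 1)) (fun n => by simp [sq])
    (Z := Z) (R := fun n i z => θ₀ * |aug z.1 i * aug z.1 i|)
    hZm (fun n i => by fun_prop) (fun n i z => by positivity)
    ⟨(4 / θ₀) ^ (1 / η) * (1 + 1 / θ₀), by
      filter_upwards [eventually_one_le_log] with n hl i z
      have hl0 : 0 < Real.log n := by linarith
      have h1 : |Z n i z| ≤ L n * |aug z.1 i| := by
        simp only [hZ]
        split_ifs with h
        · rw [abs_mul, mul_comm]; gcongr
        · rw [abs_zero]; exact mul_nonneg (hL0 n) (abs_nonneg _)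
      have h2 : L n = (4 / θ₀) ^ (1 / η) * Real.log n ^ (1 / η) := by
        rw [← Real.mul_rpow (by positivity) hl0.le, div_mul_eq_mul_div]
      set u := aug z.1 i
      have h3 : |u| ≤ (1 + 1 / θ₀) * Real.log n ^ (1 / 2 : ℝ)
          * (1 + θ₀ * |u * u| / Real.log n) := by
        rw [← Real.sqrt_eq_rpow, abs_mul_self]
        set r := √(Real.log n) with hr
        have hr0 : 0 < r := Real.sqrt_pos.mpr hl0
        have hrr : Real.log n = r * r := (Real.mul_self_sqrt hl0.le).symm
        rw [hrr]
        have h4 : |u| ≤ r * (1 + u * u / (r * r)) := by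
          have : r * (1 + u * u / (r * r)) - |u| = ((|u| - r) ^ 2 + |u| * r) / r := by
            rw [← abs_mul_abs_self u]; field_simp; ring
          have h5 : 0 ≤ ((|u| - r) ^ 2 + |u| * r) / r := by positivity
          linarith
        refine h4.trans ?_
        have h6 : 1 + u * u / (r * r) ≤ (1 + 1 / θ₀) * (1 + θ₀ * (u * u) / (r * r)) := by
          have h7 : (1 + 1 / θ₀) * (1 + θ₀ * (u * u) / (r * r)) = 1 + u * u / (r * r)
              + (1 / θ₀ + θ₀ * (u * u) / (r * r)) := by field_simp; ring
          have h8 : 0 ≤ 1 / θ₀ + θ₀ * (u * u) / (r * r) := by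
            have := mul_self_nonneg u
            positivity
          linarith
        nlinarith
      refine h1.trans ?_
      rw [h2, Real.rpow_add hl0]
      have h9 : 0 ≤ (4 / θ₀) ^ (1 / η) * Real.log n ^ (1 / η) := by positivity
      calc (4 / θ₀) ^ (1 / η) * Real.log n ^ (1 / η) * |u|
          ≤ (4 / θ₀) ^ (1 / η) * Real.log n ^ (1 / η) * ((1 + 1 / θ₀)
            * Real.log n ^ (1 / 2 : ℝ) * (1 + θ₀ * |u * u| / Real.log n)) := by gcongr
        _ = _ := by ring⟩
    ⟨K, hK.mono fun n hn i => hn i i⟩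
    (fun hq1 => by
      have hq2 : 0 < q / (q - 1) := div_pos hq (by linarith)
      obtain ⟨C, hC, hle⟩ := exists_rpow_le_mul_exp
        (show 0 ≤ 2 * (q / (q - 1)) by positivity) hθ₀
      obtain ⟨C', hC', hle'⟩ := exists_abs_rpow_le_mul_exp
        (show 0 ≤ 4 * (q / (q - 1)) by positivity) hη hθ₀
      refine ⟨C * |K| + C' * |Ke|, ?_⟩
      filter_upwards [hK, hKe] with n hn hne i
      refine lintegral_ofReal_le_of_le_add hC.le hC'.le (abs_nonneg _) (abs_nonneg _)
        (by fun_prop) (by fun_prop) (fun z => ?_)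
        ((hn i i).trans (ENNReal.ofReal_le_ofReal (le_abs_self K)))
        (hne.trans (ENNReal.ofReal_le_ofReal (le_abs_self Ke)))
      set u := aug z.1 i
      set e := residual (α n) (β n) z
      set r := q / (q - 1)
      have h1 : (Z n i z ^ 2) ^ r ≤ |u * e| ^ (2 * r) := by
        rw [← sq_abs, ← Real.rpow_natCast, ← Real.rpow_mul (abs_nonneg _)]
        push_cast
        exact Real.rpow_le_rpow (abs_nonneg _) (hZabs n i z) (by positivity)
      have h2 : |u * e| ^ (2 * r) ≤ |u * u| ^ (2 * r) + |e| ^ (4 * r) := by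
        rw [abs_mul, abs_mul, Real.mul_rpow (abs_nonneg _) (abs_nonneg _),
          Real.mul_rpow (abs_nonneg _) (abs_nonneg _), show 4 * r = 2 * r + 2 * r by ring,
          Real.rpow_add_of_nonneg (abs_nonneg e) (by positivity) (by positivity)]
        nlinarith [sq_nonneg (|u| ^ (2 * r) - |e| ^ (2 * r)), sq_nonneg (|u| ^ (2 * r)),
          sq_nonneg (|e| ^ (2 * r))]
      have h3 := hle _ (abs_nonneg (u * u))
      have h4 := hle' e
      linarith)
  obtain ⟨K1, hK1, hrate⟩ := exists_eventually_rateRelations hγ hp hp' hq hη hMw hMη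
  set B := (1 / θ₀ + C2) * (|K| + |Ke|) with hB
  have hB0 : 0 ≤ B := by positivity
  refine ⟨A + B, by positivity, ?_⟩
  have hsum := hlim.add hnoise
  rw [add_zero] at hsum
  refine tendsto_of_tendsto_of_tendsto_of_le_of_le' tendsto_const_nhds hsum
    (Eventually.of_forall fun _ => bot_le) ?_
  filter_upwards [hK, hKe, hrate, eventually_gt_atTop 0] with n hn hne hr hn0
  refine (measure_mono fun ω hω => ?_).trans (measure_union_le _ _)
  obtain ⟨i, hi⟩ := hω
  by_cases hbig : ∃ t, L n < |residual (α n) (β n) (ζ n t ω)|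
  · exact Or.inr hbig
  left
  push Not at hbig
  refine ⟨i, ?_⟩
  have hsumeq : ∑ t, min ((M n).w (ζ n t ω).1) (bTrim p q Mw Mη n)
        * (aug (ζ n t ω).1 i * residual (α n) (β n) (ζ n t ω))
      = ∑ t, min ((M n).w (ζ n t ω).1) (bTrim p q Mw Mη n) * Z n i (ζ n t ω) :=
    Finset.sum_congr rfl fun t _ => by simp only [hZ]; rw [if_pos (hbig t)]
  rw [hsumeq] at hi
  -- The untruncated cross moment is zero by orthogonality; truncation shifts it by O(1/n), which is
  -- below d since 1/n ≤ c² ≤ c ≤ d.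
  have hbias : |∫ z, Z n i z ∂(M n).testLaw| ≤ B * dRate p q η n := by
    have h1 := abs_integral_aug_mul_truncated_le (hblp n) hη hθ₀ hC2
      (show 0 ≤ |K| + |Ke| by positivity) (show (1 : ℝ) ≤ n by exact_mod_cast hn0) hC2le
      (fun i j => (hn i j).trans (ENNReal.ofReal_le_ofReal
        (by linarith [le_abs_self K, abs_nonneg Ke])))
      (hne.trans (ENNReal.ofReal_le_ofReal (by linarith [le_abs_self Ke, abs_nonneg K]))) i
    refine h1.trans ?_
    have h2 : (n : ℝ)⁻¹ ≤ dRate p q η n := by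
      have := hr.one_div_le
      have h3 := hr.c_le_one
      have h4 := hr.pos_c
      have h5 := hr.le_d
      nlinarith
    gcongr
  have htri := abs_sub_abs_le_abs_sub ((n : ℝ)⁻¹ * ∑ t, min ((M n).w (ζ n t ω).1)
    (bTrim p q Mw Mη n) * Z n i (ζ n t ω)) (∫ z, Z n i z ∂(M n).testLaw)
  linarith

/-- The weighted mean square of the noise. -/
theorem tendsto_measure_noise_sq (hS : ∀ n, IsSample (M n) (P n) (ζ n))
    (hγ : γ < 1) (hp : (fun n => Real.log (p n)) =O[atTop] (fun n : ℕ => (n : ℝ) ^ γ))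
    (hp' : Tendsto p atTop atTop) (hq : 0 < q) (hη : 0 < η) (hMw : 0 < Mw)
    (hMη : 1 / η + 1 / 2 ≤ Mη) (hθ₀ : 0 < θ₀)
    (hw : ∃ K : ℝ, ∀ᶠ n in atTop, ∫⁻ z, ENNReal.ofReal ((M n).w z.1 ^ q) ∂(M n).testLaw
      ≤ ENNReal.ofReal K)
    (hete : ∃ K : ℝ, ∀ᶠ n in atTop, ∫⁻ z, ENNReal.ofReal
      (Real.exp (θ₀ * |residual (α n) (β n) z| ^ η)) ∂(M n).testLaw ≤ ENNReal.ofReal K)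
    (hnoise : ∃ c : ℝ, 0 < c ∧ ∀ᶠ n in atTop, ENNReal.ofReal c ≤
      ∫⁻ z, ENNReal.ofReal ((residual (α n) (β n) z) ^ 2) ∂(M n).testLaw) :
    ∃ c C : ℝ, 0 < c ∧ Tendsto (fun n => P n {ω | ¬ (c ≤
      (n : ℝ)⁻¹ * ∑ t, min ((M n).w (ζ n t ω).1) (bTrim p q Mw Mη n)
        * residual (α n) (β n) (ζ n t ω) ^ 2 ∧
      (n : ℝ)⁻¹ * ∑ t, min ((M n).w (ζ n t ω).1) (bTrim p q Mw Mη n)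
        * residual (α n) (β n) (ζ n t ω) ^ 2 ≤ C)}) atTop (𝓝 0) := by
  obtain ⟨K, hK⟩ := hw
  obtain ⟨Ke, hKe⟩ := hete
  obtain ⟨c, hc, hcn⟩ := hnoise
  obtain ⟨C4, hC4, hC4le⟩ := exists_abs_rpow_le_mul_exp (r := 4) (by norm_num) hη hθ₀
  obtain ⟨C2, hC2, hC2le⟩ := exists_abs_rpow_le_mul_exp (r := 2) (by norm_num) hη hθ₀
  obtain ⟨K1, hK1, hrate⟩ := exists_eventually_rateRelations hγ hp hp' hq hη hMw hMη
  set F := C4 * (|Ke| + 1) with hF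
  have hF0 : 0 < F := by positivity
  -- The trimming loss of the squared noise is bounded by a fourth moment weighted by δ, which costs
  -- δF = c/4, plus a term of order b^(-q)/δ, eventually below c/4. Half of c then survives
  -- trimming, and the sampling error takes another quarter.
  set δ := c / (4 * F) with hδ
  have hδ0 : 0 < δ := by positivity
  have hd := tendsto_dRate (η := η) hγ hp hq
  have hsmall : ∀ᶠ n in atTop, δ⁻¹ * (K1 * dRate p q η n) * (|K| + 1) ≤ c / 4 := by
    have h := ((hd.const_mul K1).const_mul δ⁻¹).mul_const (|K| + 1)
    rw [mul_zero, mul_zero, zero_mul] at h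
    exact h.eventually_le_const (by positivity)
  refine ⟨c / 4, C2 * |Ke| + c / 4, by positivity, ?_⟩
  have hbn := tendsto_bTrim_div hγ hp hp' hq hMw
    (show 0 ≤ Mη by have : 0 < 1 / η := by positivity
                    linarith)
  have hlim : Tendsto (fun n : ℕ => ENNReal.ofReal (F * (bTrim p q Mw Mη n / n)
      / (c / 4) ^ 2)) atTop (𝓝 0) := by
    rw [← ENNReal.ofReal_zero]
    refine ENNReal.tendsto_ofReal ?_
    have := (hbn.const_mul F).div_const ((c / 4) ^ 2)
    rwa [mul_zero, zero_div] at this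
  refine tendsto_of_tendsto_of_tendsto_of_le_of_le' tendsto_const_nhds hlim
    (Eventually.of_forall fun _ => bot_le) ?_
  filter_upwards [hK, hKe, hcn, hrate, hsmall, eventually_one_le_log] with
    n hn hne hcn hr hs hl
  set b := bTrim p q Mw Mη n with hbdef
  have hb := hr.pos_b
  set e := residual (α n) (β n) with hedef
  have hem : Measurable e := measurable_residual _ _
  set w : (Fin (p n) → ℝ) × ℝ → ℝ := fun z => (M n).w z.1 with hwdef
  have hwm : Measurable w := (M n).measurable_w.comp measurable_fst
  have hw0 : ∀ z, 0 ≤ w z := fun z => (M n).w_nonneg _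
  have hτ := (M n).testLaw_eq_withDensity
  have hV0 : ∀ z, 0 ≤ min (w z) b := fun z => le_min (hw0 z) hb.le
  have hexpm : Measurable fun z => Real.exp (θ₀ * |e z| ^ η) := by fun_prop
  have he4 : ∫⁻ z, ENNReal.ofReal (e z ^ 4) ∂(M n).testLaw ≤ ENNReal.ofReal F := by
    refine (lintegral_ofReal_le_of_le_mul hC4.le hexpm (fun z => ?_) hne).trans
      (ENNReal.ofReal_le_ofReal ?_)
    · have := hC4le (e z)
      rwa [show (4 : ℝ) = (4 : ℕ) by norm_num, Real.rpow_natCast, Even.pow_abs (by decide)] at this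
    · rw [hF]; gcongr; linarith [le_abs_self Ke]
  have he2 : ∫⁻ z, ENNReal.ofReal (e z ^ 2) ∂(M n).testLaw ≤ ENNReal.ofReal (C2 * |Ke|) := by
    refine (lintegral_ofReal_le_of_le_mul hC2.le hexpm (fun z => ?_) hne).trans
      (ENNReal.ofReal_le_ofReal ?_)
    · have := hC2le (e z)
      rwa [Real.rpow_two, sq_abs] at this
    · gcongr; exact le_abs_self Ke
  have he2i : Integrable (fun z => e z ^ 2) (M n).testLaw :=
    integrable_of_lintegral_ofReal_le (by fun_prop) (fun z => (abs_of_nonneg (sq_nonneg _)).le) he2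
  have hwe : Integrable (fun z => w z * e z ^ 2) (M n).trainLaw :=
    (integrable_withDensity_ofReal hwm hw0 hτ).mp he2i
  have hVe : Integrable (fun z => min (w z) b * e z ^ 2) (M n).trainLaw := by
    refine hwe.mono' (by fun_prop) (Eventually.of_forall fun z => ?_)
    rw [Real.norm_eq_abs, abs_of_nonneg (mul_nonneg (hV0 z) (sq_nonneg _))]
    gcongr; exact min_le_left _ _
  have hup : ∫ z, min (w z) b * e z ^ 2 ∂(M n).trainLaw ≤ C2 * |Ke| := by
    calc ∫ z, min (w z) b * e z ^ 2 ∂(M n).trainLaw ≤ ∫ z, w z * e z ^ 2 ∂(M n).trainLaw :=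
          integral_mono hVe hwe fun z => by
            dsimp only; gcongr; exact min_le_left _ _
      _ = ∫ z, e z ^ 2 ∂(M n).testLaw := (integral_withDensity_ofReal hwm hw0 hτ _).symm
      _ ≤ _ := integral_le_of_lintegral_ofReal_le (by positivity) (by fun_prop)
          (fun z => sq_nonneg _) he2
  have hclow : c ≤ ∫ z, w z * e z ^ 2 ∂(M n).trainLaw := by
    rw [← integral_withDensity_ofReal hwm hw0 hτ, integral_eq_lintegral_of_nonneg_ae
      (Eventually.of_forall fun z => sq_nonneg _) (by fun_prop)]
    rw [← ENNReal.toReal_ofReal hc.le]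
    exact ENNReal.toReal_mono (he2.trans_lt ENNReal.ofReal_lt_top).ne hcn
  have hdiff : ∫ z, (w z * e z ^ 2 - min (w z) b * e z ^ 2) ∂(M n).trainLaw ≤ c / 2 := by
    have hwq : ∀ z, 0 ≤ w z ^ q := fun z => Real.rpow_nonneg (hw0 z) q
    have hwqm : Measurable fun z => w z ^ q := hwm.pow_const q
    have hbq : 0 < b ^ (-q) := Real.rpow_pos_of_pos hb _
    refine integral_le_of_lintegral_ofReal_le (by positivity) (by fun_prop) (fun z => ?_) ?_
    · rw [← sub_mul]
      exact mul_nonneg (sub_nonneg.mpr (min_le_left _ _)) (sq_nonneg _)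
    calc ∫⁻ z, ENNReal.ofReal (w z * e z ^ 2 - min (w z) b * e z ^ 2) ∂(M n).trainLaw
        ≤ ∫⁻ z, ENNReal.ofReal (w z * (δ * e z ^ 4 + δ⁻¹ * b ^ (-q) * w z ^ q))
            ∂(M n).trainLaw := by
          refine lintegral_mono fun z => ENNReal.ofReal_le_ofReal ?_
          have h0 := hw0 z
          have h5 := hwq z
          rcases le_or_gt (w z) b with h | h
          · rw [min_eq_left h, sub_self]; positivity
          · have h4 : 1 ≤ b ^ (-q) * w z ^ q := by
              rw [Real.rpow_neg hb.le, ← div_eq_inv_mul, one_le_div (by positivity)]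
              exact Real.rpow_le_rpow hb.le h.le hq.le
            have h6 : e z ^ 2 ≤ δ * e z ^ 4 + δ⁻¹ * 1 := by
              have h7 : 0 ≤ δ⁻¹ * (δ * e z ^ 2 - 1) ^ 2 := by positivity
              have h8 : δ⁻¹ * (δ * e z ^ 2 - 1) ^ 2
                  = δ * e z ^ 4 - 2 * e z ^ 2 + δ⁻¹ * 1 := by field_simp; ring
              nlinarith [sq_nonneg (e z)]
            have h9 : 0 ≤ min (w z) b * e z ^ 2 := mul_nonneg (hV0 z) (sq_nonneg _)
            have h10 : δ⁻¹ * 1 ≤ δ⁻¹ * (b ^ (-q) * w z ^ q) := by gcongr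
            have h11 : e z ^ 2 ≤ δ * e z ^ 4 + δ⁻¹ * b ^ (-q) * w z ^ q := by
              rw [mul_assoc]; linarith
            have := mul_le_mul_of_nonneg_left h11 h0
            linarith
      _ = ∫⁻ z, ENNReal.ofReal (δ * e z ^ 4 + δ⁻¹ * b ^ (-q) * w z ^ q) ∂(M n).testLaw :=
          (lintegral_ofReal_withDensity hwm hw0 hτ (by fun_prop)).symm
      _ ≤ ENNReal.ofReal (δ * F + δ⁻¹ * b ^ (-q) * (|K| + 1)) :=
          lintegral_ofReal_le_of_le_add hδ0.le (by positivity) hF0.le (by positivity)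
            (by fun_prop) hwqm (fun z => le_rfl) he4
            (hn.trans (ENNReal.ofReal_le_ofReal (by linarith [le_abs_self K])))
      _ ≤ ENNReal.ofReal (c / 2) := by
          refine ENNReal.ofReal_le_ofReal ?_
          have h1 : δ * F = c / 4 := by rw [hδ]; field_simp
          have h2 : b ^ (-q) ≤ K1 * dRate p q η n := by
            refine le_trans ?_ hr.trim
            have : 1 ≤ Real.log n ^ (1 / η + 1 / 2) := Real.one_le_rpow hl (by positivity)
            nlinarith
          have h3 : δ⁻¹ * b ^ (-q) * (|K| + 1)
              ≤ δ⁻¹ * (K1 * dRate p q η n) * (|K| + 1) := by gcongr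
          linarith
  rw [integral_sub hwe hVe] at hdiff
  have hH : ∫⁻ z, ENNReal.ofReal ((min (w z) b * e z ^ 2) ^ 2) ∂(M n).trainLaw
      ≤ ENNReal.ofReal (F * b) := by
    calc ∫⁻ z, ENNReal.ofReal ((min (w z) b * e z ^ 2) ^ 2) ∂(M n).trainLaw
        ≤ ∫⁻ z, ENNReal.ofReal (w z * (b * e z ^ 4)) ∂(M n).trainLaw := by
          refine lintegral_mono fun z => ENNReal.ofReal_le_ofReal ?_
          have h0 := hw0 z
          have h1 := hV0 z
          calc (min (w z) b * e z ^ 2) ^ 2 = min (w z) b * (min (w z) b * e z ^ 4) := by ring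
            _ ≤ w z * (b * e z ^ 4) := by
              have := min_le_left (w z) b
              have := min_le_right (w z) b
              gcongr
      _ = ∫⁻ z, ENNReal.ofReal (b * e z ^ 4) ∂(M n).testLaw :=
          (lintegral_ofReal_withDensity hwm hw0 hτ (by fun_prop)).symm
      _ ≤ ENNReal.ofReal (b * F) :=
          lintegral_ofReal_le_of_le_mul hb.le (by fun_prop) (fun z => le_rfl) he4
      _ = _ := by rw [mul_comm]
  -- No rate is needed here, so Chebyshev suffices: in the square one weight is bounded by b and the
  -- other changes the measure.
  have hcheb := measure_abs_mean_sub_ge_le_of_sq hr.pos_n (hS n).measurable (hS n).indep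
    (hS n).law (f := fun z => min (w z) b * e z ^ 2) (by fun_prop)
    (show 0 ≤ F * b by positivity) hH (show 0 < c / 4 by positivity)
  refine (measure_mono fun ω hω => ?_).trans (hcheb.trans (ENNReal.ofReal_le_ofReal ?_))
  · rw [Set.mem_ofPred_eq] at hω ⊢
    by_contra hlt
    have habs := abs_lt.mp (not_le.mp hlt)
    exact hω ⟨by linarith [habs.1], by linarith [habs.2]⟩
  · apply le_of_eq
    field_simp

end Events

/-! ### Perturbed normal equations -/

section Gram

variable {ι : Type*} [DecidableEq ι]

/-- Extension of a vector indexed by `J` by zero. -/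
def extendZero (J : Finset ι) (b : J → ℝ) (i : ι) : ℝ := if h : i ∈ J then b ⟨i, h⟩ else 0

lemma extendZero_of_notMem {J : Finset ι} (b : J → ℝ) {i : ι} (h : i ∉ J) :
    extendZero J b i = 0 := dif_neg h

end Gram

section Gram

variable {ι : Type*} [Fintype ι]

lemma abs_dotProduct_le {u v : ι → ℝ} {e : ℝ} (h : ∀ i, |v i| ≤ e) :
    |u ⬝ᵥ v| ≤ (∑ i, |u i|) * e := by
  rw [dotProduct, Finset.sum_mul]
  refine (Finset.abs_sum_le_sum_abs _ _).trans (Finset.sum_le_sum fun i _ => ?_)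
  rw [abs_mul]
  exact mul_le_mul_of_nonneg_left (h i) (abs_nonneg _)

lemma abs_mulVec_le {A : Matrix ι ι ℝ} {e : ℝ} (h : ∀ i j, |A i j| ≤ e) (v : ι → ℝ) (i : ι) :
    |(A *ᵥ v) i| ≤ (∑ i, |v i|) * e := by
  rw [mulVec, dotProduct_comm]
  exact abs_dotProduct_le (h i)

lemma abs_quadratic_sub_le {A B : Matrix ι ι ℝ} {e : ℝ} (h : ∀ i j, |A i j - B i j| ≤ e)
    (v : ι → ℝ) : |v ⬝ᵥ A *ᵥ v - v ⬝ᵥ B *ᵥ v| ≤ e * (∑ i, |v i|) ^ 2 := by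
  rw [← dotProduct_sub, ← sub_mulVec]
  refine (abs_dotProduct_le fun i => abs_mulVec_le (A := A - B) (e := e) (fun i j => h i j) v i).trans
    (le_of_eq (by ring))

lemma sq_sum_abs_le {J : Finset ι} {v : ι → ℝ} (h : ∀ i ∉ J, v i = 0) :
    (∑ i, |v i|) ^ 2 ≤ J.card * ∑ i, v i ^ 2 := by
  rw [← Finset.sum_subset (Finset.subset_univ J) fun i _ hi => by rw [h i hi, abs_zero],
    ← Finset.sum_subset (Finset.subset_univ J) fun i _ hi => by rw [h i hi]; simp]
  simpa using sq_sum_le_card_mul_sum_sq (s := J) (f := fun i => |v i|)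

/-- Excess of the mean squared residual over the mean squared noise. -/
def excess (Sh : Matrix ι ι ℝ) (r δ : ι → ℝ) : ℝ := δ ⬝ᵥ Sh *ᵥ δ + 2 * (δ ⬝ᵥ r)

lemma excess_add {Sh : Matrix ι ι ℝ} (hsymm : Shᵀ = Sh) (r δ h : ι → ℝ) :
    excess Sh r (δ + h) = excess Sh r δ + 2 * (h ⬝ᵥ (Sh *ᵥ δ + r)) + h ⬝ᵥ Sh *ᵥ h := by
  have h1 : δ ⬝ᵥ Sh *ᵥ h = h ⬝ᵥ Sh *ᵥ δ := by
    rw [dotProduct_mulVec, ← mulVec_transpose, hsymm, dotProduct_comm]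
  simp only [excess, mulVec_add, dotProduct_add, add_dotProduct, h1]
  ring

/-- `A` is coercive with constant `κ` on vectors supported in `J`. -/
def CoerciveOn (A : Matrix ι ι ℝ) (κ : ℝ) (J : Finset ι) : Prop :=
  ∀ v : ι → ℝ, (∀ i ∉ J, v i = 0) → κ * ∑ i, v i ^ 2 ≤ v ⬝ᵥ A *ᵥ v

/-- An entrywise error e costs e‖v‖₁², at most e|J|‖v‖₂² on vectors supported in J. This is why the
number of iterations is capped at a small multiple of 1/d. -/
lemma coerciveOn_of_perturbation {S Sh : Matrix ι ι ℝ} {e c : ℝ} {J : Finset ι} (he : 0 ≤ e)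
    (hS : ∀ v : ι → ℝ, c * ∑ i, v i ^ 2 ≤ v ⬝ᵥ S *ᵥ v) (h : ∀ i j, |Sh i j - S i j| ≤ e)
    (hJ : J.card * e ≤ c / 2) : CoerciveOn Sh (c / 2) J := by
  intro v hv
  have h1 := (abs_le.mp (abs_quadratic_sub_le h v)).1
  have h2 := hS v
  have h3 : e * (∑ i, |v i|) ^ 2 ≤ e * (J.card * ∑ i, v i ^ 2) := by
    gcongr; exact sq_sum_abs_le hv
  have h4 : 0 ≤ ∑ i, v i ^ 2 := Finset.sum_nonneg fun i _ => sq_nonneg _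
  nlinarith

/-- Population and sample excess risks differ little. -/
lemma abs_excess_sub_le {S Sh : Matrix ι ι ℝ} {r δ : ι → ℝ} {e : ℝ}
    (hS : ∀ i j, |Sh i j - S i j| ≤ e) (hr : ∀ i, |r i| ≤ e) :
    |excess Sh r δ - δ ⬝ᵥ S *ᵥ δ| ≤ e * (∑ i, |δ i|) ^ 2 + 2 * e * ∑ i, |δ i| := by
  have h1 := abs_le.mp (abs_quadratic_sub_le hS δ)
  have h2 := abs_le.mp (abs_dotProduct_le (u := δ) hr)
  rw [excess, abs_le]
  constructor <;> linarith [h1.1, h1.2, h2.1, h2.2]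

variable [DecidableEq ι]

lemma sum_mul_extendZero (J : Finset ι) (b : J → ℝ) (f : ι → ℝ) :
    ∑ i, f i * extendZero J b i = ∑ j : J, f j * b j := by
  rw [← Finset.sum_subset (Finset.subset_univ J)
    fun i _ hi => by rw [extendZero_of_notMem b hi, mul_zero], ← Finset.sum_coe_sort]
  refine Finset.sum_congr rfl fun j _ => ?_
  simp [extendZero]

lemma sum_abs_extendZero (J : Finset ι) (b : J → ℝ) :
    ∑ i, |extendZero J b i| = ∑ j : J, |b j| := by
  rw [← Finset.sum_subset (Finset.subset_univ J)
    fun i _ hi => by rw [extendZero_of_notMem b hi, abs_zero], ← Finset.sum_coe_sort]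
  refine Finset.sum_congr rfl fun j _ => ?_
  simp [extendZero]

lemma mulVec_extendZero (A : Matrix ι ι ℝ) (J : Finset ι) (b : J → ℝ) (i : J) :
    (A *ᵥ extendZero J b) i
      = (A.submatrix (fun i : J => (i : ι)) (fun i : J => (i : ι)) *ᵥ b) i :=
  sum_mul_extendZero J b (A i)

/-- Coercivity makes the principal submatrix injective, so the matrix inverse in the fit is a
genuine one. -/
lemma CoerciveOn.mulVec_extendZero_inv {A : Matrix ι ι ℝ} {κ : ℝ} {J : Finset ι}
    (h : CoerciveOn A κ J) (hκ : 0 < κ) (s : J → ℝ) (i : J) :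
    (A *ᵥ extendZero J ((A.submatrix (fun i : J => (i : ι)) (fun i : J => (i : ι)))⁻¹ *ᵥ s)) i
      = s i := by
  rw [mulVec_extendZero]
  set B := A.submatrix (fun i : J => (i : ι)) (fun i : J => (i : ι)) with hB
  have hinj : ∀ u : J → ℝ, B *ᵥ u = 0 → u = 0 := by
    intro u hu
    have h1 := h (extendZero J u) fun i hi => extendZero_of_notMem u hi
    have h2 : extendZero J u ⬝ᵥ A *ᵥ extendZero J u = 0 := by
      rw [dotProduct_comm, dotProduct, sum_mul_extendZero]
      refine Finset.sum_eq_zero fun j _ => ?_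
      rw [mulVec_extendZero, ← hB, hu]
      simp
    have h3 : ∑ i, extendZero J u i ^ 2 = 0 :=
      le_antisymm (by nlinarith) (Finset.sum_nonneg fun i _ => sq_nonneg _)
    ext j
    have h4 := (Finset.sum_eq_zero_iff_of_nonneg fun i _ => sq_nonneg _).mp h3 j
      (Finset.mem_univ _)
    simpa [extendZero] using h4
  have hunit : IsUnit B.det := by
    rw [← Matrix.isUnit_iff_isUnit_det, ← Matrix.mulVec_injective_iff_isUnit]
    intro u v huv
    have := hinj (u - v) (by rw [mulVec_sub]; exact sub_eq_zero.mpr huv)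
    exact sub_eq_zero.mp this
  rw [mulVec_mulVec, Matrix.mul_nonsing_inv _ hunit, one_mulVec]

/-- The `ℓ₁` norm of the coefficient error of a perturbed least squares fit in model `J`. -/
lemma sum_abs_error_le {S Sh : Matrix ι ι ℝ} {r β δ : ι → ℝ} {e κ L : ℝ} {J : Finset ι}
    (he : 0 ≤ e) (hκ : 0 < κ) (hL : 0 ≤ L) (hSc : CoerciveOn S κ J) (hShc : CoerciveOn Sh κ J)
    (hS : ∀ i j, |Sh i j - S i j| ≤ e) (hr : ∀ i, |r i| ≤ e)
    (hpart : ∀ j ∉ J, ∑ i : J, |((S.submatrix (fun i : J => (i : ι)) (fun i : J => (i : ι)))⁻¹ *ᵥ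
      (fun i : J => S i j)) i| ≤ L)
    (hδ : ∀ i ∉ J, δ i = β i) (hnormal : ∀ i ∈ J, (Sh *ᵥ δ + r) i = 0)
    (hcard : J.card * e ≤ κ) :
    ∑ i, |δ i| ≤ e / κ * J.card + 2 * (1 + L) * ∑ i ∈ Jᶜ, |β i| := by
  set b := ∑ i ∈ Jᶜ, |β i| with hb
  have hb0 : 0 ≤ b := Finset.sum_nonneg fun i _ => abs_nonneg _
  set a : ι → ι → ℝ := fun j => extendZero J
    ((S.submatrix (fun i : J => (i : ι)) (fun i : J => (i : ι)))⁻¹ *ᵥ (fun i : J => S i j)) with ha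
  have haL : ∀ j ∉ J, ∑ i, |a j i| ≤ L := fun j hj => by
    rw [ha, sum_abs_extendZero]; exact hpart j hj
  have haS : ∀ j, ∀ i ∈ J, (S *ᵥ a j) i = S i j := fun j i hi =>
    hSc.mulVec_extendZero_inv hκ (fun i : J => S i j) ⟨i, hi⟩
  -- The vector -z is the error of the population fit in J: it equals β off J and S annihilates it
  -- on J. So h = δ + z is the sampling part alone. It is supported in J, where Sh is coercive, and
  -- on J the vector Sh h involves only r and (Sh - S)z.
  set z : ι → ℝ := ∑ j ∈ Jᶜ, β j • (a j - Pi.single j 1) with hz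
  set h : ι → ℝ := δ + z with hh
  have hzl1 : ∑ i, |z i| ≤ (1 + L) * b := by
    calc ∑ i, |z i| ≤ ∑ i, ∑ j ∈ Jᶜ, |β j| * (|a j i| + |(Pi.single j 1 : ι → ℝ) i|) := by
          refine Finset.sum_le_sum fun i _ => ?_
          rw [hz, Finset.sum_apply]
          refine (Finset.abs_sum_le_sum_abs _ _).trans (Finset.sum_le_sum fun j _ => ?_)
          rw [Pi.smul_apply, Pi.sub_apply, smul_eq_mul, abs_mul]
          gcongr
          exact abs_sub _ _
      _ = ∑ j ∈ Jᶜ, |β j| * (∑ i, |a j i| + ∑ i, |(Pi.single j 1 : ι → ℝ) i|) := by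
          rw [Finset.sum_comm]
          refine Finset.sum_congr rfl fun j _ => ?_
          rw [← Finset.mul_sum, Finset.sum_add_distrib]
      _ ≤ ∑ j ∈ Jᶜ, |β j| * (L + 1) := by
          refine Finset.sum_le_sum fun j hj => ?_
          have h1 : ∑ i, |(Pi.single j 1 : ι → ℝ) i| = 1 := by
            rw [Finset.sum_eq_single j]
            · simp
            · intro i _ hij; simp [hij]
            · simp
          rw [h1]
          gcongr
          exact haL j (Finset.mem_compl.mp hj)
      _ = _ := by rw [← Finset.sum_mul, hb]; ring
  have hsupp : ∀ i ∉ J, h i = 0 := by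
    intro i hi
    have h1 : z i = -β i := by
      rw [hz, Finset.sum_apply, Finset.sum_eq_single i]
      · simp [ha, extendZero_of_notMem _ hi]
      · intro j _ hij
        simp [ha, extendZero_of_notMem _ hi, hij.symm]
      · intro h2; exact absurd (Finset.mem_compl.mpr hi) h2
    rw [hh, Pi.add_apply, h1, hδ i hi, add_neg_cancel]
  have hSh : ∀ i ∈ J, |(Sh *ᵥ h) i| ≤ e * (1 + (1 + L) * b) := by
    intro i hi
    have h1 : (Sh *ᵥ δ) i = -r i := by
      have := hnormal i hi
      rw [Pi.add_apply] at this; linarith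
    have h2 : |(Sh *ᵥ z) i| ≤ e * ((1 + L) * b) := by
      have h3 : (S *ᵥ z) i = 0 := by
        rw [hz, mulVec_sum, Finset.sum_apply]
        refine Finset.sum_eq_zero fun j _ => ?_
        rw [mulVec_smul, Pi.smul_apply, mulVec_sub, Pi.sub_apply, haS j i hi, mulVec_single_one]
        simp
      have h4 : (Sh *ᵥ z) i = ((Sh - S) *ᵥ z) i := by
        rw [sub_mulVec, Pi.sub_apply, h3, sub_zero]
      rw [h4]
      refine (abs_mulVec_le (e := e) (fun i j => hS i j) z i).trans ?_
      rw [mul_comm]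
      gcongr
    rw [hh, mulVec_add, Pi.add_apply, h1]
    calc |-r i + (Sh *ᵥ z) i| ≤ |-r i| + |(Sh *ᵥ z) i| := abs_add_le _ _
      _ ≤ e + e * ((1 + L) * b) := by rw [abs_neg]; exact add_le_add (hr i) h2
      _ = _ := by ring
  set l := ∑ i, |h i| with hl
  have hl0 : 0 ≤ l := Finset.sum_nonneg fun i _ => abs_nonneg _
  have hquad : h ⬝ᵥ Sh *ᵥ h ≤ l * (e * (1 + (1 + L) * b)) := by
    rw [dotProduct, hl, Finset.sum_mul]
    refine Finset.sum_le_sum fun i _ => ?_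
    by_cases hi : i ∈ J
    · calc h i * (Sh *ᵥ h) i ≤ |h i * (Sh *ᵥ h) i| := le_abs_self _
        _ = |h i| * |(Sh *ᵥ h) i| := abs_mul _ _
        _ ≤ _ := by gcongr; exact hSh i hi
    · rw [hsupp i hi]; simp
  have h1 := hShc h hsupp
  have h2 := sq_sum_abs_le hsupp
  have hm0 : (0 : ℝ) ≤ J.card := by positivity
  have h3 : κ * l ^ 2 ≤ J.card * (l * (e * (1 + (1 + L) * b))) := by
    calc κ * l ^ 2 ≤ κ * (J.card * ∑ i, h i ^ 2) := by gcongr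
      _ = J.card * (κ * ∑ i, h i ^ 2) := by ring
      _ ≤ J.card * (l * (e * (1 + (1 + L) * b))) := by exact mul_le_mul_of_nonneg_left (h1.trans hquad) hm0
  -- After division by l, the product |J|·e·(1 + L)b is absorbed through |J|·e ≤ κ.
  have h4 : l ≤ e / κ * J.card + (1 + L) * b := by
    have h5 : κ * l ≤ J.card * (e * (1 + (1 + L) * b)) := by
      rcases hl0.eq_or_lt with h0 | h0
      · rw [← h0, mul_zero]; positivity
      · refine le_of_mul_le_mul_left ?_ h0
        linarith
    have h6 : κ * l ≤ κ * (e / κ * J.card + (1 + L) * b) := by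
      have h7 : κ * (e / κ * J.card + (1 + L) * b) = J.card * e + κ * ((1 + L) * b) := by
        field_simp
      have h8 : J.card * e * ((1 + L) * b) ≤ κ * ((1 + L) * b) := by gcongr
      linarith
    exact le_of_mul_le_mul_left h6 hκ
  have h5 : ∑ i, |δ i| ≤ l + ∑ i, |z i| := by
    rw [hl, ← Finset.sum_add_distrib]
    refine Finset.sum_le_sum fun i _ => ?_
    have : δ i = h i - z i := by rw [hh, Pi.add_apply]; ring
    rw [this]; exact abs_sub _ _
  linarith

/-- The least squares fit minimizes the excess. -/
lemma excess_le_of_normal {Sh : Matrix ι ι ℝ} (hsymm : Shᵀ = Sh) {r β δ δ' : ι → ℝ} {κ : ℝ}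
    {J : Finset ι} (hκ : 0 ≤ κ) (hShc : CoerciveOn Sh κ J)
    (hδ : ∀ i ∉ J, δ i = β i) (hnormal : ∀ i ∈ J, (Sh *ᵥ δ + r) i = 0)
    (hδ' : ∀ i ∉ J, δ' i = β i) : excess Sh r δ ≤ excess Sh r δ' := by
  have hsupp : ∀ i ∉ J, (δ' - δ) i = 0 := fun i hi => by
    rw [Pi.sub_apply, hδ i hi, hδ' i hi, sub_self]
  have h1 := excess_add hsymm r δ (δ' - δ)
  rw [add_sub_cancel] at h1
  have h2 : (δ' - δ) ⬝ᵥ (Sh *ᵥ δ + r) = 0 := by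
    refine Finset.sum_eq_zero fun i _ => ?_
    by_cases hi : i ∈ J
    · rw [hnormal i hi, mul_zero]
    · rw [hsupp i hi, zero_mul]
  have h3 := hShc _ hsupp
  have h4 : 0 ≤ κ * ∑ i, (δ' - δ) i ^ 2 :=
    mul_nonneg hκ (Finset.sum_nonneg fun i _ => sq_nonneg _)
  linarith

/-- Adding the variable `j` decreases the excess by at least the squared score of `j`. -/
lemma excess_insert_le {Sh : Matrix ι ι ℝ} (hsymm : Shᵀ = Sh) {r β δ δ' : ι → ℝ} {κ : ℝ}
    {J : Finset ι} {j : ι} (hκ : 0 ≤ κ) (hShc : CoerciveOn Sh κ (insert j J))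
    (hjj : 0 < Sh j j) (hδ : ∀ i ∉ J, δ i = β i) (hδ' : ∀ i ∉ insert j J, δ' i = β i)
    (hnormal : ∀ i ∈ insert j J, (Sh *ᵥ δ' + r) i = 0) :
    excess Sh r δ' ≤ excess Sh r δ - (Sh *ᵥ δ + r) j ^ 2 / Sh j j := by
  set g := (Sh *ᵥ δ + r) j with hg
  -- The minimizer of the excess along coordinate j; refitting on the enlarged model does at least
  -- as well.
  set t := -(g / Sh j j) with ht
  have h1 : excess Sh r δ' ≤ excess Sh r (δ + Pi.single j t) := by
    refine excess_le_of_normal hsymm hκ hShc hδ' hnormal fun i hi => ?_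
    rw [Finset.mem_insert, not_or] at hi
    rw [Pi.add_apply, Pi.single_apply, if_neg hi.1, add_zero, hδ i hi.2]
  have h2 : (Pi.single j t : ι → ℝ) ⬝ᵥ Sh *ᵥ (Pi.single j t) = t ^ 2 * Sh j j := by
    rw [single_dotProduct, mulVec_single]
    simp; ring
  have h3 : excess Sh r (δ + Pi.single j t) = excess Sh r δ - g ^ 2 / Sh j j := by
    rw [excess_add hsymm, h2, single_dotProduct, ← hg, ht]
    field_simp; ring
  linarith

/-- Pair δ with Sh δ + r: the latter vanishes on J, and off J the former is β, so only the omitted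
coefficients and the largest remaining correlation count. A large risk thus forces a large greedy
gain. -/
lemma quadratic_le_of_normal {S Sh : Matrix ι ι ℝ} {r β δ : ι → ℝ} {e G : ℝ} {J : Finset ι}
    (hS : ∀ i j, |Sh i j - S i j| ≤ e) (hr : ∀ i, |r i| ≤ e)
    (hδ : ∀ i ∉ J, δ i = β i) (hnormal : ∀ i ∈ J, (Sh *ᵥ δ + r) i = 0)
    (hG : ∀ i ∉ J, |(Sh *ᵥ δ + r) i| ≤ G) :
    δ ⬝ᵥ S *ᵥ δ ≤ (∑ i ∈ Jᶜ, |β i|) * G + (e * (∑ i, |δ i|) ^ 2 + e * ∑ i, |δ i|) := by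
  have h1 := (abs_le.mp (abs_quadratic_sub_le hS δ)).1
  have h2 := (abs_le.mp (abs_dotProduct_le (u := δ) hr)).1
  have h3 : δ ⬝ᵥ (Sh *ᵥ δ + r) ≤ (∑ i ∈ Jᶜ, |β i|) * G := by
    rw [dotProduct, ← Finset.sum_subset (Finset.subset_univ Jᶜ), Finset.sum_mul]
    · refine Finset.sum_le_sum fun i hi => ?_
      rw [Finset.mem_compl] at hi
      calc δ i * (Sh *ᵥ δ + r) i ≤ |δ i * (Sh *ᵥ δ + r) i| := le_abs_self _
        _ = |β i| * |(Sh *ᵥ δ + r) i| := by rw [abs_mul, hδ i hi]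
        _ ≤ _ := by gcongr; exact hG i hi
    · intro i _ hi
      rw [hnormal i (by simpa using hi), mul_zero]
  rw [dotProduct_add] at h3
  linarith

end Gram

/-! ### Scalar recursions -/

section Recursion

/-- Discrete form of a' = -c a^(1+κ), along which a^(-κ) grows linearly with slope κc. Bernoulli's
inequality (1 - x)^κ ≤ 1 - κx, which needs κ ≤ 1, carries one step. -/
lemma mul_le_rpow_neg_of_recursion {a : ℕ → ℝ} {c κ : ℝ} {m : ℕ} (hκ0 : 0 < κ) (hκ1 : κ ≤ 1)
    (hc : 0 < c) (hpos : ∀ i ≤ m, 0 < a i)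
    (hstep : ∀ i < m, a (i + 1) ≤ a i - c * a i ^ (1 + κ)) :
    ∀ i ≤ m, κ * c * i ≤ a i ^ (-κ) := by
  intro i
  induction i with
  | zero => intro _; simp only [CharP.cast_eq_zero, mul_zero]; exact Real.rpow_nonneg (hpos 0 (Nat.zero_le _)).le _
  | succ i ih =>
    intro hi
    have h0 := hpos i (by omega)
    have h1 := hpos (i + 1) hi
    have h2 := ih (by omega)
    have h3 := hstep i (by omega)
    set z := a i ^ κ with hz
    have hz0 : 0 < z := Real.rpow_pos_of_pos h0 _
    have h4 : a i ^ (1 + κ) = a i * z := by rw [Real.rpow_add h0, Real.rpow_one]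
    set x := c * z with hx
    have hx0 : 0 < x := mul_pos hc hz0
    have h5 : a (i + 1) ≤ a i * (1 - x) := by rw [h4] at h3; rw [hx]; linarith
    have hx1 : x < 1 := by
      by_contra h
      have : a i * (1 - x) ≤ 0 := mul_nonpos_of_nonneg_of_nonpos h0.le (by linarith)
      linarith
    have h6 : a (i + 1) ^ κ ≤ z * (1 - κ * x) := by
      calc a (i + 1) ^ κ ≤ (a i * (1 - x)) ^ κ := Real.rpow_le_rpow h1.le h5 hκ0.le
        _ = z * (1 - x) ^ κ := Real.mul_rpow h0.le (by linarith)
        _ ≤ z * (1 - κ * x) := by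
          have := rpow_one_add_le_one_add_mul_self (show -1 ≤ -x by linarith) hκ0.le hκ1
          gcongr
          calc (1 - x) ^ κ = (1 + -x) ^ κ := by ring_nf
            _ ≤ 1 + κ * -x := this
            _ = _ := by ring
    have hz1 : 0 < a (i + 1) ^ κ := Real.rpow_pos_of_pos h1 _
    rw [Real.rpow_neg h0.le] at h2
    rw [Real.rpow_neg h1.le, le_inv_comm₀ (by positivity) hz1]
    have h7 : κ * x < 1 := by nlinarith
    have h8 : z * (1 - κ * x) * (z⁻¹ + κ * c) ≤ 1 := by
      have : z * (1 - κ * x) * (z⁻¹ + κ * c) = 1 - (κ * x) ^ 2 := by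
        rw [hx]; field_simp; ring
      nlinarith [sq_nonneg (κ * x)]
    have h9 : κ * c * ((i + 1 : ℕ) : ℝ) ≤ z⁻¹ + κ * c := by push_cast; linarith
    have h10 : 0 < κ * c * ((i + 1 : ℕ) : ℝ) := by positivity
    refine h6.trans ?_
    rw [← one_div, le_div_iff₀ h10]
    have h11 : 0 ≤ z * (1 - κ * x) := mul_nonneg hz0.le (by linarith)
    calc z * (1 - κ * x) * (κ * c * ((i + 1 : ℕ) : ℝ)) ≤ z * (1 - κ * x) * (z⁻¹ + κ * c) := by
          gcongr
      _ ≤ 1 := h8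

variable {κ : ℝ}

/-- True at zero as well, since exponents with sum one cannot both vanish. -/
lemma rpow_half_mul_rpow_half {x : ℝ} (hx : 0 ≤ x) :
    x ^ ((1 + κ) / 2) * x ^ ((1 - κ) / 2) = x := by
  rcases hx.eq_or_lt with rfl | h
  · by_cases h1 : (1 + κ) / 2 = 0
    · have : (1 - κ) / 2 ≠ 0 := by linarith
      rw [Real.zero_rpow this, mul_zero]
    · rw [Real.zero_rpow h1, zero_mul]
  · rw [← Real.rpow_add h]
    have : (1 + κ) / 2 + (1 - κ) / 2 = 1 := by ring
    rw [this, Real.rpow_one]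

/-- The cross term `d Q ^ ((1 - κ) / 2)` is at most `Q / A₀` for `Q` above `A₀² ρ`. -/
lemma mul_rpow_le_div {d ρ Q A : ℝ} (hκ0 : 0 < κ) (hρ : 0 ≤ ρ)
    (hρd : ρ ^ ((1 + κ) / 2) = d) (hA : 1 ≤ A) (hQ : A ^ 2 * ρ ≤ Q) :
    d * Q ^ ((1 - κ) / 2) ≤ Q / A := by
  have hQ0 : 0 ≤ Q := le_trans (by positivity) hQ
  have h1 : A * d ≤ Q ^ ((1 + κ) / 2) := by
    calc A * d = (A ^ 2) ^ ((1 : ℝ) / 2) * ρ ^ ((1 + κ) / 2) := by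
          rw [← Real.sqrt_eq_rpow, Real.sqrt_sq (by linarith), hρd]
      _ ≤ (A ^ 2) ^ ((1 + κ) / 2) * ρ ^ ((1 + κ) / 2) := by
          gcongr
          · exact one_le_pow₀ hA
          · linarith
      _ = (A ^ 2 * ρ) ^ ((1 + κ) / 2) := (Real.mul_rpow (by positivity) hρ).symm
      _ ≤ _ := Real.rpow_le_rpow (by positivity) hQ (by linarith)
  rw [le_div_iff₀ (by linarith)]
  calc d * Q ^ ((1 - κ) / 2) * A = (A * d) * Q ^ ((1 - κ) / 2) := by ring
    _ ≤ Q ^ ((1 + κ) / 2) * Q ^ ((1 - κ) / 2) := by gcongr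
    _ = Q := rpow_half_mul_rpow_half hQ0

/-- The other regime, Q at most a multiple of ρ: by monotonicity Q may be replaced by Aρ, and d =
ρ^((1+κ)/2) restores the power one. -/
lemma mul_rpow_le_of_le {d ρ Q A : ℝ} (hκ0 : 0 < κ) (hκ1 : κ ≤ 1) (hd : 0 ≤ d) (hρ : 0 ≤ ρ)
    (hρd : ρ ^ ((1 + κ) / 2) = d) (hA : 1 ≤ A) (hQ0 : 0 ≤ Q) (hQ : Q ≤ A * ρ) :
    d * Q ^ ((1 - κ) / 2) ≤ A * ρ := by
  calc d * Q ^ ((1 - κ) / 2) ≤ d * (A * ρ) ^ ((1 - κ) / 2) := by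
        gcongr
    _ = A ^ ((1 - κ) / 2) * (ρ ^ ((1 + κ) / 2) * ρ ^ ((1 - κ) / 2)) := by
        rw [Real.mul_rpow (by linarith) hρ, hρd]; ring
    _ = A ^ ((1 - κ) / 2) * ρ := by rw [rpow_half_mul_rpow_half hρ]
    _ ≤ A ^ (1 : ℝ) * ρ := by gcongr; linarith
    _ = A * ρ := by rw [Real.rpow_one]

/-- The error terms of the greedy recursion: below a multiple of `ρ`, up to half of `Q`. -/
lemma error_le_half_of_le {d ρ Q b C₂ C₄ B x : ℝ} (hκ0 : 0 < κ) (hd : 0 ≤ d)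
    (hρ : 0 ≤ ρ) (hρd : ρ ^ ((1 + κ) / 2) = d) (hC₂ : 0 ≤ C₂) (hC₄ : 0 ≤ C₄)
    (hB : 0 ≤ B) (hb0 : 0 ≤ b) (hbB : b ≤ B) (hbQ : b ≤ C₄ * Q ^ ((1 - κ) / 2))
    (hx : x ≤ ρ)
    (hQ : (2 * C₂ * (1 + (1 + B) * C₄) + 1) ^ 2 * ρ ≤ Q) :
    C₂ * (x + d * (b * (1 + b))) ≤ Q / 2 := by
  set A := 2 * C₂ * (1 + (1 + B) * C₄) + 1 with hAdef
  have hA : 1 ≤ A := by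
    have : 0 ≤ 2 * C₂ * (1 + (1 + B) * C₄) := by positivity
    linarith
  have hQ0 : 0 ≤ Q := le_trans (by positivity) hQ
  have h1 := mul_rpow_le_div hκ0 hρ hρd hA hQ
  have h2 : x ≤ Q / A := by
    rw [le_div_iff₀ (by linarith)]
    calc x * A ≤ ρ * A := by gcongr
      _ = ρ * (A * 1) := by ring
      _ ≤ ρ * (A * A) := by gcongr
      _ = A ^ 2 * ρ := by ring
      _ ≤ Q := hQ
  have h3 : d * (b * (1 + b)) ≤ (1 + B) * C₄ * (Q / A) := by
    calc d * (b * (1 + b)) ≤ d * (C₄ * Q ^ ((1 - κ) / 2) * (1 + B)) := by gcongr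
      _ = (1 + B) * C₄ * (d * Q ^ ((1 - κ) / 2)) := by ring
      _ ≤ _ := by gcongr
  calc C₂ * (x + d * (b * (1 + b))) ≤ C₂ * (Q / A + (1 + B) * C₄ * (Q / A)) := by gcongr
    _ = (A - 1) / 2 * (Q / A) := by rw [hAdef]; ring
    _ ≤ A / 2 * (Q / A) := by gcongr; linarith
    _ = Q / 2 := by field_simp

lemma error_le_of_le {d ρ Q b C₂ C₄ B x A : ℝ} (hκ0 : 0 < κ) (hκ1 : κ ≤ 1) (hd : 0 ≤ d)
    (hρ : 0 ≤ ρ) (hρd : ρ ^ ((1 + κ) / 2) = d) (hC₂ : 0 ≤ C₂) (hC₄ : 0 ≤ C₄)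
    (hB : 0 ≤ B) (hb0 : 0 ≤ b) (hbB : b ≤ B) (hbQ : b ≤ C₄ * Q ^ ((1 - κ) / 2))
    (hA : 1 ≤ A) (hQ0 : 0 ≤ Q) (hQ : Q ≤ A * ρ) :
    C₂ * (x + d * (b * (1 + b))) ≤ C₂ * x + C₂ * (1 + B) * C₄ * A * ρ := by
  have h1 := mul_rpow_le_of_le hκ0 hκ1 hd hρ hρd hA hQ0 hQ
  have h3 : d * (b * (1 + b)) ≤ (1 + B) * C₄ * (A * ρ) := by
    calc d * (b * (1 + b)) ≤ d * (C₄ * Q ^ ((1 - κ) / 2) * (1 + B)) := by gcongr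
      _ = (1 + B) * C₄ * (d * Q ^ ((1 - κ) / 2)) := by ring
      _ ≤ _ := by gcongr
  calc C₂ * (x + d * (b * (1 + b))) ≤ C₂ * (x + (1 + B) * C₄ * (A * ρ)) := by gcongr
    _ = _ := by ring

/-- Excess risk along the greedy path. -/
theorem exists_greedy_excess_le (hκ0 : 0 < κ) (hκ1 : κ ≤ 1) {C₂ C₄ B C₅ m₀ : ℝ} (hC₂ : 0 ≤ C₂)
    (hC₄ : 0 < C₄) (hB : 0 ≤ B) (hC₅ : 0 < C₅) (hm₀ : 0 < m₀) :
    ∃ C : ℝ, 0 ≤ C ∧ ∀ (d ρ : ℝ) (D Q b s : ℕ → ℝ) (m : ℕ), 0 ≤ d → 0 < ρ →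
      ρ ^ ((1 + κ) / 2) = d →
      (∀ i ≤ m, |D i - Q i| ≤ C₂ * (i * d ^ 2 + d * (b i * (1 + b i)))) →
      (∀ i < m, Q i ≤ b i * (C₅ * s i) + C₂ * (i * d ^ 2 + d * (b i * (1 + b i)))) →
      (∀ i < m, 0 ≤ s i) →
      (∀ i ≤ m, 0 ≤ Q i ∧ 0 ≤ b i ∧ b i ≤ B ∧ b i ≤ C₄ * Q i ^ ((1 - κ) / 2)) →
      (∀ i < m, D (i + 1) ≤ D i - s i ^ 2) → m * d ^ 2 ≤ ρ →
      (m₀ * ρ ^ (-κ) ≤ m ∨ Q m ≤ C₂ * (m * d ^ 2)) → D m ≤ C * ρ := by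
  set A := (2 * C₂ * (1 + (1 + B) * C₄) + 1) ^ 2 + C₂ with hAdef
  have hA : 1 ≤ A := by
    have h0 : 0 ≤ 2 * C₂ * (1 + (1 + B) * C₄) := by positivity
    have : 1 ≤ (2 * C₂ * (1 + (1 + B) * C₄) + 1) ^ 2 := one_le_pow₀ (by linarith)
    linarith
  -- The 9 is 4 · 9/4: Q^(1+κ) ≤ (2C₄C₅s)², and D ≤ (3/2)Q with 1 + κ ≤ 2.
  set c := 1 / (9 * (C₄ * C₅) ^ 2) with hc
  have hc0 : 0 < c := by positivity
  refine ⟨A + C₂ + C₂ * (1 + B) * C₄ * A + (κ * c * m₀) ^ (-(1 / κ)), by positivity, ?_⟩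
  intro d ρ D Q b s m hd hρ hρd hDQ hQs hs hb hD hm hend
  have hκc : 0 ≤ (κ * c * m₀) ^ (-(1 / κ)) := by positivity
  have hX : 0 ≤ C₂ * (1 + B) * C₄ * A := by positivity
  have him : ∀ i ≤ m, (i : ℝ) * d ^ 2 ≤ ρ := fun i hi => by
    have : (i : ℝ) ≤ m := by exact_mod_cast hi
    calc (i : ℝ) * d ^ 2 ≤ m * d ^ 2 := by gcongr
      _ ≤ ρ := hm
  have hanti : ∀ j i, i + j ≤ m → D (i + j) ≤ D i := by
    intro j
    induction j with
    | zero => intro i _; simp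
    | succ j ih =>
      intro i hij
      have h1 := ih i (by omega)
      have h2 := hD (i + j) (by omega)
      have h3 := sq_nonneg (s (i + j))
      rw [← add_assoc]; linarith
  have hsmall : ∀ i ≤ m, Q i ≤ A * ρ → D m ≤ (A + C₂ + C₂ * (1 + B) * C₄ * A) * ρ := by
    intro i hi hQ
    obtain ⟨hQ0, hb0, hbB, hbQ⟩ := hb i hi
    have h1 := (abs_le.mp (hDQ i hi)).2
    have h2 := error_le_of_le (x := i * d ^ 2) hκ0 hκ1 hd hρ.le hρd hC₂ hC₄.le hB hb0 hbB hbQ hA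
      hQ0 hQ
    have h3 : C₂ * (i * d ^ 2) ≤ C₂ * ρ := by gcongr; exact him i hi
    have h4 := hanti (m - i) i (by omega)
    rw [show i + (m - i) = m by omega] at h4
    linarith
  -- Q need not decrease along the path, but D does: once Q is of order ρ, D stays of that order.
  -- Otherwise Q dominates the error terms at every step, D and Q are comparable, and the recursion
  -- applies throughout.
  by_cases hex : ∃ i ≤ m, Q i ≤ A * ρ
  · obtain ⟨i, hi, hQ⟩ := hex
    have := hsmall i hi hQ
    have h2 : 0 ≤ (κ * c * m₀) ^ (-(1 / κ)) * ρ := by positivity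
    linarith
  push Not at hex
  have hbig : ∀ i ≤ m, Q i / 2 ≤ D i ∧ D i ≤ 3 / 2 * Q i ∧
      C₂ * (i * d ^ 2 + d * (b i * (1 + b i))) ≤ Q i / 2 := by
    intro i hi
    obtain ⟨hQ0, hb0, hbB, hbQ⟩ := hb i hi
    have h1 := error_le_half_of_le (x := i * d ^ 2) hκ0 hd hρ.le hρd hC₂ hC₄.le hB hb0 hbB hbQ
      (him i hi) (by
        have h2 := hex i hi
        have h3 : 0 ≤ C₂ * ρ := by positivity
        rw [hAdef] at h2; linarith)
    have h2 := abs_le.mp (hDQ i hi)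
    exact ⟨by linarith [h2.1], by linarith [h2.2], h1⟩
  have hQpos : ∀ i ≤ m, 0 < Q i := fun i hi => lt_trans (by positivity) (hex i hi)
  have hrec : ∀ i < m, D (i + 1) ≤ D i - c * D i ^ (1 + κ) := by
    intro i hi
    obtain ⟨hQ0, hb0, hbB, hbQ⟩ := hb i hi.le
    obtain ⟨h1, h2, h3⟩ := hbig i hi.le
    have h4 := hQs i hi
    have hq := hQpos i hi.le
    have hsi := hs i hi
    have hpow : 0 < Q i ^ ((1 - κ) / 2) := Real.rpow_pos_of_pos hq _
    have h5 : Q i ≤ 2 * (C₄ * Q i ^ ((1 - κ) / 2) * (C₅ * s i)) := by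
      have : b i * (C₅ * s i) ≤ C₄ * Q i ^ ((1 - κ) / 2) * (C₅ * s i) := by gcongr
      linarith
    have h6 : Q i ^ ((1 + κ) / 2) ≤ 2 * (C₄ * C₅) * s i := by
      refine le_of_mul_le_mul_right ?_ hpow
      rw [rpow_half_mul_rpow_half hQ0]
      linarith
    have h7 : Q i ^ (1 + κ) ≤ (2 * (C₄ * C₅) * s i) ^ 2 := by
      calc Q i ^ (1 + κ) = (Q i ^ ((1 + κ) / 2)) ^ 2 := by
            rw [← Real.rpow_natCast, ← Real.rpow_mul hQ0]; congr 1; push_cast; ring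
        _ ≤ _ := by gcongr
    have h8 : D i ^ (1 + κ) ≤ 9 / 4 * Q i ^ (1 + κ) := by
      calc D i ^ (1 + κ) ≤ (3 / 2 * Q i) ^ (1 + κ) :=
            Real.rpow_le_rpow (by linarith) h2 (by linarith)
        _ = (3 / 2 : ℝ) ^ (1 + κ) * Q i ^ (1 + κ) := Real.mul_rpow (by norm_num) hQ0
        _ ≤ (3 / 2 : ℝ) ^ (2 : ℝ) * Q i ^ (1 + κ) := by
            gcongr
            · norm_num
            · linarith
        _ = _ := by norm_num
    have h9 : c * D i ^ (1 + κ) ≤ s i ^ 2 := by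
      calc c * D i ^ (1 + κ) ≤ c * (9 / 4 * (2 * (C₄ * C₅) * s i) ^ 2) := by
            gcongr; linarith
        _ = s i ^ 2 := by rw [hc]; field_simp; ring
    linarith [hD i hi]
  have hDpos : ∀ i ≤ m, 0 < D i := fun i hi => by
    have := (hbig i hi).1
    have := hQpos i hi
    linarith
  have hfin := mul_le_rpow_neg_of_recursion hκ0 hκ1 hc0 hDpos hrec m le_rfl
  -- Either there were enough iterations, or Q m is already at most C₂ρ (the case where all
  -- covariates are in the model), which contradicts `hex`.
  rcases hend with hend | hend
  · have hDm := hDpos m le_rfl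
    have h1 : (κ * c * m₀) * ρ ^ (-κ) ≤ D m ^ (-κ) := by
      calc (κ * c * m₀) * ρ ^ (-κ) = κ * c * (m₀ * ρ ^ (-κ)) := by ring
        _ ≤ κ * c * m := by gcongr
        _ ≤ _ := hfin
    have h2 : D m ≤ (κ * c * m₀) ^ (-(1 / κ)) * ρ := by
      have h3 := Real.rpow_le_rpow_of_nonpos (by positivity) h1
        (show -(1 / κ) ≤ 0 by have : 0 < 1 / κ := by positivity
                              linarith)
      rw [← Real.rpow_mul hDm.le, Real.mul_rpow (by positivity) (by positivity),
        ← Real.rpow_mul hρ.le, show -κ * -(1 / κ) = 1 by field_simp, Real.rpow_one,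
        Real.rpow_one] at h3
      exact h3
    have h3 : 0 ≤ (A + C₂ + C₂ * (1 + B) * C₄ * A) * ρ := by positivity
    linarith
  · have h1 := hex m le_rfl
    have h2 : C₂ * (m * d ^ 2) ≤ C₂ * ρ := by gcongr
    have h3 : C₂ * ρ ≤ A * ρ := by
      gcongr
      have := sq_nonneg (2 * C₂ * (1 + (1 + B) * C₄) + 1)
      linarith
    linarith

/-- Excess risk of the model selected by the information criterion. -/
theorem exists_criterion_excess_le (hκ0 : 0 < κ) (hκ1 : κ ≤ 1) {C₂ C₄ B C₆ c E₁ sa : ℝ}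
    (hC₂ : 0 ≤ C₂) (hC₄ : 0 ≤ C₄) (hB : 0 ≤ B) (hC₆ : 0 ≤ C₆) (hE₁ : 0 ≤ E₁)
    (hsa0 : 0 ≤ sa) (hsa : 2 * C₂ ≤ sa * c) :
    ∃ C δ : ℝ, 0 ≤ C ∧ 0 < δ ∧ ∀ (d ρ E Dk Dm Q b : ℝ) (k m : ℕ), 0 ≤ d → 0 < ρ → ρ ≤ 1 →
      ρ ^ ((1 + κ) / 2) = d → C₂ * d + δ * ρ ≤ c / 2 → c ≤ E → E ≤ E₁ →
      (1 + sa * (k + 1) * d ^ 2) * (E + Dk) ≤ (1 + sa * (m + 1) * d ^ 2) * (E + Dm) →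
      Dm ≤ C₆ * ρ → |Dk - Q| ≤ C₂ * (k * d ^ 2 + d * (b * (1 + b))) → 1 ≤ m →
      m * d ^ 2 ≤ ρ → k * d ≤ 1 →
      0 ≤ Q → 0 ≤ b → b ≤ B → b ≤ C₄ * Q ^ ((1 - κ) / 2) → Q ≤ C * ρ := by
  set A₀ := 2 * C₂ * (1 + (1 + B) * C₄) + 1 with hA₀
  set A := A₀ ^ 2 with hAdef
  have hA0 : 1 ≤ A₀ := by
    have h0 : 0 ≤ 2 * C₂ * (1 + (1 + B) * C₄) := by positivity
    linarith
  have hA : 1 ≤ A := one_le_pow₀ hA0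
  set C₇ := C₂ * (1 + B) * C₄ * A + 1 with hC₇
  have hX : 0 ≤ C₂ * (1 + B) * C₄ * A := by positivity
  have hC₇0 : 0 < C₇ := by positivity
  refine ⟨2 * (C₆ + C₇ + 2 * sa * (E₁ + C₆)), C₇, by positivity, hC₇0, ?_⟩
  intro d ρ E Dk Dm Q b k m hd hρ hρ1 hρd hsmall hcE hE hcrit hDm hDQ hm1 hm hk hQ0 hb0 hbB hbQ
  have hkd : (k : ℝ) * d ^ 2 ≤ d := by
    calc (k : ℝ) * d ^ 2 = k * d * d := by ring
      _ ≤ 1 * d := by gcongr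
      _ = d := one_mul d
  have hkd0 : 0 ≤ (k : ℝ) * d ^ 2 := by positivity
  have herr : C₂ * (d * (b * (1 + b))) ≤ Q / 2 + C₇ * ρ := by
    rcases le_total (A * ρ) Q with h | h
    · have := error_le_half_of_le (x := 0) hκ0 hd hρ.le hρd hC₂ hC₄ hB hb0 hbB hbQ
        hρ.le h
      rw [zero_add] at this
      have h2 : 0 ≤ C₇ * ρ := by positivity
      linarith
    · have := error_le_of_le (x := 0) hκ0 hκ1 hd hρ.le hρd hC₂ hC₄ hB hb0 hbB hbQ hA hQ0 h
      rw [zero_add, mul_zero, zero_add] at this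
      have h2 : C₂ * (1 + B) * C₄ * A * ρ ≤ C₇ * ρ := by gcongr; linarith
      linarith
  have hDk := (abs_le.mp hDQ).1
  have hDk' : Q / 2 - C₂ * (k * d ^ 2) - C₇ * ρ ≤ Dk := by
    have := mul_add C₂ (k * d ^ 2) (d * (b * (1 + b)))
    linarith
  -- The residual variance of the selected model stays away from zero, so the multiplicative penalty
  -- costs at least sa(k+1)d²·c/2. Here kd ≤ 1 keeps the error kd² below d.
  have hEDk : c / 2 ≤ E + Dk := by
    have : C₂ * (k * d ^ 2) ≤ C₂ * d := by gcongr
    linarith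
  have h1 : sa * (k + 1) * d ^ 2 * (c / 2) ≤ sa * (k + 1) * d ^ 2 * (E + Dk) := by gcongr
  have h1' : sa * k * d ^ 2 * (c / 2) ≤ sa * (k + 1) * d ^ 2 * (c / 2) := by
    have hc2 : 0 ≤ c / 2 := le_trans (by positivity) hsmall
    gcongr; linarith
  have h2 : sa * (m + 1) * d ^ 2 * (E + Dm) ≤ sa * (2 * ρ) * (E₁ + C₆) := by
    have h3 : (m + 1 : ℝ) * d ^ 2 ≤ 2 * ρ := by
      have : (1 : ℝ) ≤ m := by exact_mod_cast hm1
      have : d ^ 2 ≤ m * d ^ 2 := le_mul_of_one_le_left (sq_nonneg d) this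
      linarith
    have h4 : E + Dm ≤ E₁ + C₆ := by
      have : C₆ * ρ ≤ C₆ * 1 := by gcongr
      linarith
    calc sa * (m + 1) * d ^ 2 * (E + Dm) ≤ sa * (m + 1) * d ^ 2 * (E₁ + C₆) := by gcongr
      _ = sa * ((m + 1) * d ^ 2) * (E₁ + C₆) := by ring
      _ ≤ sa * (2 * ρ) * (E₁ + C₆) := by gcongr
  -- The lower bound on sa makes the penalty pay for the part of the error that grows with k, so the
  -- size of the selected model drops out.
  have h5 : C₂ * (k * d ^ 2) ≤ sa * k * d ^ 2 * (c / 2) := by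
    have : sa * k * d ^ 2 * (c / 2) = sa * c / 2 * (k * d ^ 2) := by ring
    rw [this]
    gcongr; linarith
  rw [add_mul, one_mul, add_mul, one_mul] at hcrit
  have h6 : 2 * (C₆ + C₇ + 2 * sa * (E₁ + C₆)) * ρ
      = 2 * (C₆ * ρ) + 2 * (C₇ * ρ) + 2 * (sa * (2 * ρ) * (E₁ + C₆)) := by ring
  rw [h6]
  linarith only [hcrit, h1, h1', h2, h5, hDk', hDm]

end Recursion

/-! ### Algebra of weighted least squares -/

section WeightedMean

variable {n p : ℕ} {w : Fin n → ℝ}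

lemma wMean_add (f g : Fin n → ℝ) :
    wMean w (fun t => f t + g t) = wMean w f + wMean w g := by
  simp only [wMean, mul_add, Finset.sum_add_distrib]

lemma wMean_sub (f g : Fin n → ℝ) :
    wMean w (fun t => f t - g t) = wMean w f - wMean w g := by
  simp only [wMean, mul_sub, Finset.sum_sub_distrib]

lemma wMean_const_mul (c : ℝ) (f : Fin n → ℝ) :
    wMean w (fun t => c * f t) = c * wMean w f := by
  simp only [wMean, mul_left_comm _ c, ← Finset.mul_sum]

lemma wMean_mul_const (c : ℝ) (f : Fin n → ℝ) :
    wMean w (fun t => f t * c) = wMean w f * c := by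
  simp only [mul_comm _ c, wMean_const_mul]

lemma wMean_sum {ι : Type*} (s : Finset ι) (f : ι → Fin n → ℝ) :
    wMean w (fun t => ∑ i ∈ s, f i t) = ∑ i ∈ s, wMean w (f i) := by
  simp only [wMean, Finset.mul_sum]
  rw [Finset.sum_comm]

lemma wMean_const (h1 : wMean w (fun _ => 1) = 1) (c : ℝ) : wMean w (fun _ => c) = c := by
  have := wMean_const_mul (w := w) c (fun _ => 1)
  simpa [h1] using this

lemma wMean_centered_mul (h1 : wMean w (fun _ => 1) = 1) (f g : Fin n → ℝ) :
    wMean w (fun t => (f t - wMean w f) * (g t - wMean w g))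
      = wMean w (fun t => f t * g t) - wMean w f * wMean w g := by
  have h : (fun t => (f t - wMean w f) * (g t - wMean w g)) = fun t =>
      (f t * g t - wMean w f * g t) - (f t * wMean w g - wMean w f * wMean w g) := by
    ext t; ring
  rw [h, wMean_sub, wMean_sub, wMean_sub, wMean_const_mul, wMean_mul_const, wMean_const h1]
  ring

/-- Weighted covariance of covariates and noise. -/
noncomputable def noiseCov (w : Fin n → ℝ) (x : Fin n → Fin p → ℝ) (e : Fin n → ℝ) (j : Fin p) : ℝ :=
  wMean w fun t => (x t j - muX w x j) * (e t - wMean w e)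

/-- Error of the weighted least squares slope of model `J`. -/
noncomputable def slopeError (w : Fin n → ℝ) (x : Fin n → Fin p → ℝ) (y : Fin n → ℝ) (b : Fin p → ℝ)
    (J : Finset (Fin p)) : Fin p → ℝ :=
  b - extendZero J (betaHat w x y J)

lemma slopeError_of_notMem (w : Fin n → ℝ) (x : Fin n → Fin p → ℝ) (y : Fin n → ℝ)
    (b : Fin p → ℝ) {J : Finset (Fin p)} {i : Fin p} (h : i ∉ J) :
    slopeError w x y b J i = b i := by
  simp [slopeError, extendZero_of_notMem _ h]

lemma sigmaHat_transpose (w : Fin n → ℝ) (x : Fin n → Fin p → ℝ) :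
    (sigmaHat w x)ᵀ = sigmaHat w x := by
  ext i j
  simp only [sigmaHat, transpose_apply, of_apply]
  congr 1
  ext t
  ring

variable {x : Fin n → Fin p → ℝ} {y e : Fin n → ℝ} {a : ℝ} {b : Fin p → ℝ}

lemma sigmaHat_mulVec (v : Fin p → ℝ) (j : Fin p) :
    (sigmaHat w x *ᵥ v) j
      = wMean w fun t => (x t j - muX w x j) * ∑ i, v i * (x t i - muX w x i) := by
  simp only [mulVec, dotProduct, sigmaHat, of_apply, Finset.mul_sum]
  rw [wMean_sum]
  refine Finset.sum_congr rfl fun i _ => ?_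
  rw [← wMean_mul_const]
  congr 1
  ext t
  ring

lemma dotProduct_sigmaHat_mulVec (v : Fin p → ℝ) :
    v ⬝ᵥ sigmaHat w x *ᵥ v = wMean w fun t => (∑ i, v i * (x t i - muX w x i)) ^ 2 := by
  simp only [dotProduct, sigmaHat_mulVec, ← wMean_const_mul]
  rw [← wMean_sum]
  congr 1
  ext t
  rw [sq, Finset.sum_mul]
  refine Finset.sum_congr rfl fun i _ => ?_
  ring

lemma wMean_response (h1 : wMean w (fun _ => 1) = 1) (hy : ∀ t, y t = a + b ⬝ᵥ x t + e t) :
    wMean w y = a + ∑ i, b i * muX w x i + wMean w e := by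
  have h : y = fun t => a + ∑ i, b i * x t i + e t := funext hy
  rw [h, wMean_add, wMean_add, wMean_const h1, wMean_sum]
  simp only [wMean_const_mul]
  rfl

lemma response_sub_wMean (h1 : wMean w (fun _ => 1) = 1) (hy : ∀ t, y t = a + b ⬝ᵥ x t + e t)
    (t : Fin n) :
    y t - wMean w y = ∑ i, b i * (x t i - muX w x i) + (e t - wMean w e) := by
  rw [hy t, wMean_response h1 hy]
  simp only [mul_sub, Finset.sum_sub_distrib, dotProduct]
  ring

lemma sHat_eq (h1 : wMean w (fun _ => 1) = 1) (hy : ∀ t, y t = a + b ⬝ᵥ x t + e t) (j : Fin p) :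
    sHat w x y j = (sigmaHat w x *ᵥ b + noiseCov w x e) j := by
  rw [Pi.add_apply, sigmaHat_mulVec, noiseCov, ← wMean_add, sHat]
  congr 1
  ext t
  rw [response_sub_wMean h1 hy]
  ring

lemma normal_equations (h1 : wMean w (fun _ => 1) = 1) (hy : ∀ t, y t = a + b ⬝ᵥ x t + e t)
    {J : Finset (Fin p)} {κ : ℝ} (hκ : 0 < κ) (hc : CoerciveOn (sigmaHat w x) κ J) :
    ∀ i ∈ J, (sigmaHat w x *ᵥ slopeError w x y b J + noiseCov w x e) i = 0 := by
  intro i hi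
  have h2 := hc.mulVec_extendZero_inv hκ (fun j : J => sHat w x y j) ⟨i, hi⟩
  have h3 := sHat_eq h1 hy i
  rw [Pi.add_apply] at h3
  rw [slopeError, mulVec_sub, Pi.add_apply, Pi.sub_apply]
  simp only [betaHat]
  rw [h2, h3]
  ring

lemma alphaHat_eq (h1 : wMean w (fun _ => 1) = 1) (hy : ∀ t, y t = a + b ⬝ᵥ x t + e t)
    (J : Finset (Fin p)) :
    alphaHat w x y J = a + ∑ i, slopeError w x y b J i * muX w x i + wMean w e := by
  rw [alphaHat, wMean_response h1 hy]
  have : ∑ j : J, betaHat w x y J j * muX w x j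
      = ∑ i, muX w x i * extendZero J (betaHat w x y J) i := by
    rw [sum_mul_extendZero]
    exact Finset.sum_congr rfl fun j _ => mul_comm _ _
  rw [this]
  simp only [slopeError, Pi.sub_apply, sub_mul, Finset.sum_sub_distrib, mul_comm (muX w x _)]
  ring

/-- The fitted intercept makes the fit pass through the weighted means, so the error is centred at
them and only the weighted mean of the noise is left over. -/
lemma sub_predict (h1 : wMean w (fun _ => 1) = 1) (hy : ∀ t, y t = a + b ⬝ᵥ x t + e t)
    (J : Finset (Fin p)) (u : Fin p → ℝ) :
    a + b ⬝ᵥ u - predict w x y J u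
      = ∑ i, slopeError w x y b J i * (u i - muX w x i) - wMean w e := by
  rw [predict, alphaHat_eq h1 hy]
  have : ∑ j : J, betaHat w x y J j * u j = ∑ i, u i * extendZero J (betaHat w x y J) i := by
    rw [sum_mul_extendZero]
    exact Finset.sum_congr rfl fun j _ => mul_comm _ _
  rw [this]
  simp only [slopeError, Pi.sub_apply, sub_mul, mul_sub, Finset.sum_sub_distrib, dotProduct,
    mul_comm (u _)]
  ring

lemma response_sub_predict (h1 : wMean w (fun _ => 1) = 1)
    (hy : ∀ t, y t = a + b ⬝ᵥ x t + e t) (J : Finset (Fin p)) (t : Fin n) :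
    y t - predict w x y J (x t)
      = ∑ i, slopeError w x y b J i * (x t i - muX w x i) + (e t - wMean w e) := by
  have := sub_predict h1 hy J (x t)
  rw [hy t]
  linarith

/-- The first summand does not depend on J: comparing models means comparing excesses. -/
lemma resVar_eq (h1 : wMean w (fun _ => 1) = 1) (hy : ∀ t, y t = a + b ⬝ᵥ x t + e t)
    (J : Finset (Fin p)) :
    resVar w x y J = wMean w (fun t => (e t - wMean w e) * (e t - wMean w e))
      + excess (sigmaHat w x) (noiseCov w x e) (slopeError w x y b J) := by
  set δ := slopeError w x y b J with hδ
  have h2 : δ ⬝ᵥ noiseCov w x e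
      = wMean w fun t => (∑ i, δ i * (x t i - muX w x i)) * (e t - wMean w e) := by
    simp only [dotProduct, noiseCov, ← wMean_const_mul]
    rw [← wMean_sum]
    congr 1
    ext t
    rw [Finset.sum_mul]
    exact Finset.sum_congr rfl fun i _ => by ring
  rw [excess, dotProduct_sigmaHat_mulVec, h2, ← wMean_const_mul, ← wMean_add, ← wMean_add, resVar]
  congr 1
  ext t
  rw [response_sub_predict h1 hy]
  ring

lemma score_eq (h1 : wMean w (fun _ => 1) = 1) (hy : ∀ t, y t = a + b ⬝ᵥ x t + e t)
    (J : Finset (Fin p)) (j : Fin p) :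
    score w x y J j = (sigmaHat w x *ᵥ slopeError w x y b J + noiseCov w x e) j /
      √(sigmaHat w x j j) := by
  rw [score, Pi.add_apply, sigmaHat_mulVec, noiseCov, ← wMean_add]
  congr 2
  ext t
  rw [response_sub_predict h1 hy]
  ring

end WeightedMean

/-! ### The prediction error -/

lemma memLp_testX {p : ℕ} {M : ShiftModel p} {a : ℝ} {b : Fin p → ℝ}
    (h : M.IsBestLinearPredictor a b) (j : Fin p) :
    MemLp (fun u : Fin p → ℝ => u j) 2 M.testX := by
  rw [← M.map_fst_testLaw]
  exact (memLp_map_measure_iff (measurable_pi_apply j).aestronglyMeasurable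
    measurable_fst.aemeasurable).mpr (h.2.1 j)

/-- Second moment as variance plus squared mean under the test law. The squared mean is the price of
estimating the intercept and will be of order d². -/
lemma mcpe_eq {n p : ℕ} {M : ShiftModel p} {w : Fin n → ℝ} {x : Fin n → Fin p → ℝ}
    {y e : Fin n → ℝ} {a : ℝ} {b : Fin p → ℝ}
    (hblp : M.IsBestLinearPredictor a b) (h1 : wMean w (fun _ => 1) = 1)
    (hy : ∀ t, y t = a + b ⬝ᵥ x t + e t) (J : Finset (Fin p)) :
    mcpe M a b w x y J = slopeError w x y b J ⬝ᵥ M.SigmaTe *ᵥ slopeError w x y b J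
      + (∑ i, slopeError w x y b J i * ((∫ u, u i ∂M.testX) - muX w x i) - wMean w e) ^ 2 := by
  set δ := slopeError w x y b J with hδ
  have hL := memLp_testX hblp
  set g : (Fin p → ℝ) → ℝ := fun u => ∑ i, δ i * u i with hg
  set c := ∑ i, δ i * muX w x i + wMean w e with hc
  have hgL : MemLp g 2 M.testX := memLp_finsetSum _ fun i _ => (hL i).const_mul (δ i)
  have hgc : MemLp (fun u => g u - c) 2 M.testX := hgL.sub (memLp_const c)
  have hvar : variance (fun u => g u - c) M.testX = δ ⬝ᵥ M.SigmaTe *ᵥ δ := by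
    rw [variance_sub_const hgL.aestronglyMeasurable, hg,
      variance_fun_sum fun i => (hL i).const_mul (δ i)]
    simp only [dotProduct, mulVec, ShiftModel.SigmaTe, of_apply, covariance_const_mul_left,
      covariance_const_mul_right, Finset.mul_sum]
    exact Finset.sum_congr rfl fun i _ => Finset.sum_congr rfl fun j _ => by ring
  have hmean : ∫ u, (g u - c) ∂M.testX
      = ∑ i, δ i * ((∫ u, u i ∂M.testX) - muX w x i) - wMean w e := by
    rw [integral_sub (hgL.integrable (by norm_num)) (integrable_const c), hg,
      integral_finsetSum _ fun i _ => ((hL i).integrable (by norm_num)).const_mul (δ i)]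
    simp only [integral_const_mul, mul_sub, Finset.sum_sub_distrib, hc]
    simp
    ring
  rw [← hmean, ← hvar, variance_eq_sub hgc, mcpe, sub_add_cancel]
  refine integral_congr_ae (Eventually.of_forall fun u => ?_)
  simp only [Pi.pow_apply]
  rw [sub_predict h1 hy, hg, hc, ← hδ]
  simp only [mul_sub, Finset.sum_sub_distrib]
  ring

/-! ### Risk bound on the event of accurate sample moments -/

/-- Weighted sample moments are within `ε` of the test moments, and the weighted variance of the
noise is between `c` and `E₁`. -/
structure SampleAccuracy {n p : ℕ} (M : ShiftModel p) (w : Fin n → ℝ) (x : Fin n → Fin p → ℝ)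
    (e : Fin n → ℝ) (ε c E₁ : ℝ) : Prop where
  one : wMean w (fun _ => 1) = 1
  sigma : ∀ i j, |sigmaHat w x i j - M.SigmaTe i j| ≤ ε
  noise : ∀ j, |noiseCov w x e j| ≤ ε
  mean : ∀ j, |(∫ u, u j ∂M.testX) - muX w x j| ≤ ε
  noiseMean : |wMean w e| ≤ ε
  le_var : c ≤ wMean w (fun t => (e t - wMean w e) * (e t - wMean w e))
  var_le : wMean w (fun t => (e t - wMean w e) * (e t - wMean w e)) ≤ E₁

lemma wMean_normWeight {n : ℕ} (v f : Fin n → ℝ) :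
    wMean (normWeight v) f = ((n : ℝ)⁻¹ * ∑ t, v t * f t) / ((n : ℝ)⁻¹ * ∑ t, v t) := by
  simp only [wMean, normWeight, Finset.mul_sum, Finset.sum_div]
  refine Finset.sum_congr rfl fun t _ => ?_
  ring

lemma SigmaTe_eq {p : ℕ} {M : ShiftModel p} {a : ℝ} {b : Fin p → ℝ}
    (hblp : M.IsBestLinearPredictor a b) (i j : Fin p) :
    M.SigmaTe i j = ∫ u, u i * u j ∂M.testX - (∫ u, u i ∂M.testX) * ∫ u, u j ∂M.testX := by
  rw [ShiftModel.SigmaTe, of_apply, covariance_eq_sub (memLp_testX hblp i) (memLp_testX hblp j)]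
  rfl

/-- Index zero of the augmented vector shows that the normalizing mean S of the weights is near one,
so dividing by it is harmless. A moment then has error ε₁ = 2(1+B)ε, from S⁻¹ ≤ 2, and a covariance
(2+2B)ε₁, from one product moment and two means. -/
theorem sampleAccuracy_of_moments {n p : ℕ} {M : ShiftModel p} {a : ℝ} {b : Fin p → ℝ}
    (hblp : M.IsBestLinearPredictor a b) {v : Fin n → ℝ} {x : Fin n → Fin p → ℝ}
    {e : Fin n → ℝ} {ε B c E₁ : ℝ} (hB : 1 ≤ B) (hε0 : 0 ≤ ε) (hc : 0 ≤ c)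
    (hB' : ∀ i j : Fin (p + 1), |∫ u, aug u i * aug u j ∂M.testX| ≤ B)
    (hxx : ∀ i j : Fin (p + 1), |(n : ℝ)⁻¹ * ∑ t, v t * (aug (x t) i * aug (x t) j)
      - ∫ u, aug u i * aug u j ∂M.testX| ≤ ε)
    (hxe : ∀ i : Fin (p + 1), |(n : ℝ)⁻¹ * ∑ t, v t * (aug (x t) i * e t)| ≤ ε)
    (hee : c ≤ (n : ℝ)⁻¹ * ∑ t, v t * (e t * e t) ∧ (n : ℝ)⁻¹ * ∑ t, v t * (e t * e t) ≤ E₁)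
    (hε1 : 2 * (1 + B) * ε ≤ 1) (hεc : 2 * (1 + B) * ε ≤ c / 6) :
    SampleAccuracy M (normWeight v) x e (4 * (1 + B) ^ 2 * ε) (c / 2) (2 * E₁) := by
  set S := (n : ℝ)⁻¹ * ∑ t, v t with hS
  set ε₁ := 2 * (1 + B) * ε with hε₁
  have hε₁0 : 0 ≤ ε₁ := by positivity
  have hε₁' : 4 * (1 + B) ^ 2 * ε = (2 + 2 * B) * ε₁ := by rw [hε₁]; ring
  rw [hε₁']
  have hle : ε₁ ≤ (2 + 2 * B) * ε₁ := by nlinarith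
  have hSε : |S - 1| ≤ ε := by
    have := hxx 0 0
    simpa [aug, hS] using this
  have hεs : ε ≤ 1 / 4 := by rw [hε₁] at hε1; nlinarith
  have hS1 := abs_le.mp hSε
  have hSpos : 0 < S := by linarith [hS1.1]
  have hS2 : 1 / 2 ≤ S := by linarith [hS1.1]
  have hone : wMean (normWeight v) (fun _ => 1) = 1 := by
    rw [wMean_normWeight]
    simp only [mul_one]
    exact div_self hSpos.ne'
  have hinv : S⁻¹ ≤ 2 := by rw [inv_le_comm₀ hSpos two_pos]; linarith
  have hxxw : ∀ i j : Fin (p + 1), |wMean (normWeight v) (fun t => aug (x t) i * aug (x t) j)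
      - ∫ u, aug u i * aug u j ∂M.testX| ≤ ε₁ := by
    intro i j
    rw [wMean_normWeight, ← hS]
    set r := (n : ℝ)⁻¹ * ∑ t, v t * (aug (x t) i * aug (x t) j)
    set m := ∫ u, aug u i * aug u j ∂M.testX with hm
    have h1 : r / S - m = ((r - m) - (S - 1) * m) * S⁻¹ := by field_simp; ring
    rw [h1, abs_mul, abs_of_pos (inv_pos.mpr hSpos)]
    have h2 : |(r - m) - (S - 1) * m| ≤ ε + ε * B := by
      refine (abs_sub _ _).trans (add_le_add (hxx i j) ?_)
      rw [abs_mul]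
      exact mul_le_mul hSε (hB' i j) (abs_nonneg _) hε0
    calc |(r - m) - (S - 1) * m| * S⁻¹ ≤ (ε + ε * B) * 2 := by gcongr
      _ = ε₁ := by rw [hε₁]; ring
  have hxew : ∀ i : Fin (p + 1), |wMean (normWeight v) (fun t => aug (x t) i * e t)| ≤ ε₁ := by
    intro i
    rw [wMean_normWeight, ← hS, div_eq_mul_inv, abs_mul, abs_of_pos (inv_pos.mpr hSpos)]
    calc _ ≤ ε * 2 := by gcongr; exact hxe i
      _ ≤ ε₁ := by rw [hε₁]; nlinarith
  have hebar : |wMean (normWeight v) e| ≤ ε₁ := by simpa [aug] using hxew 0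
  have hmu : ∀ j, |muX (normWeight v) x j - ∫ u, u j ∂M.testX| ≤ ε₁ := fun j => by
    simpa [aug, muX] using hxxw 0 j.succ
  have hmB : ∀ j, |∫ u, u j ∂M.testX| ≤ B := fun j => by simpa [aug] using hB' 0 j.succ
  have hmuB : ∀ j, |muX (normWeight v) x j| ≤ B + 1 := fun j => by
    have h1 := abs_sub_abs_le_abs_sub (muX (normWeight v) x j) (∫ u, u j ∂M.testX)
    linarith [hmu j, hmB j]
  have hvar := wMean_centered_mul hone e e
  have hee' : wMean (normWeight v) (fun t => e t * e t)
      = ((n : ℝ)⁻¹ * ∑ t, v t * (e t * e t)) / S := wMean_normWeight _ _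
  have hesq : wMean (normWeight v) e * wMean (normWeight v) e ≤ c / 6 := by
    have h1 : wMean (normWeight v) e * wMean (normWeight v) e ≤ ε₁ * ε₁ := by
      rw [← abs_mul_abs_self]; gcongr
    nlinarith
  have hE₁ : 0 ≤ E₁ := hc.trans (hee.1.trans hee.2)
  refine ⟨hone, fun i j => ?_, fun j => ?_, fun j => ?_, hebar.trans hle, ?_, ?_⟩
  · have h1 := wMean_centered_mul hone (fun t => x t i) (fun t => x t j)
    have h2 : sigmaHat (normWeight v) x i j
        = wMean (normWeight v) (fun t => x t i * x t j)
          - muX (normWeight v) x i * muX (normWeight v) x j := h1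
    rw [h2, SigmaTe_eq hblp]
    have h3 : |wMean (normWeight v) (fun t => x t i * x t j) - ∫ u, u i * u j ∂M.testX| ≤ ε₁ := by
      simpa [aug] using hxxw i.succ j.succ
    set X := wMean (normWeight v) (fun t => x t i * x t j)
    set Y := ∫ u, u i * u j ∂M.testX
    set s := muX (normWeight v) x i
    set t := muX (normWeight v) x j
    set s' := ∫ u, u i ∂M.testX
    set t' := ∫ u, u j ∂M.testX
    have h4 : X - s * t - (Y - s' * t') = (X - Y) - (s * (t - t') + t' * (s - s')) := by ring
    rw [h4]
    calc |(X - Y) - (s * (t - t') + t' * (s - s'))|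
        ≤ |X - Y| + |s * (t - t') + t' * (s - s')| := abs_sub _ _
      _ ≤ |X - Y| + (|s * (t - t')| + |t' * (s - s')|) := by gcongr; exact abs_add_le _ _
      _ ≤ ε₁ + ((B + 1) * ε₁ + B * ε₁) := by
          rw [abs_mul, abs_mul]
          have := hmuB i
          have := hmu j
          have := hmB j
          have := hmu i
          gcongr
      _ = _ := by ring
  · have h1 : noiseCov (normWeight v) x e j = wMean (normWeight v) (fun t => x t j * e t)
        - muX (normWeight v) x j * wMean (normWeight v) e :=
      wMean_centered_mul hone (fun t => x t j) e
    rw [h1]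
    have h3 : |wMean (normWeight v) (fun t => x t j * e t)| ≤ ε₁ := by
      simpa [aug] using hxew j.succ
    calc _ ≤ |wMean (normWeight v) (fun t => x t j * e t)|
          + |muX (normWeight v) x j * wMean (normWeight v) e| := abs_sub _ _
      _ ≤ ε₁ + (B + 1) * ε₁ := by
          rw [abs_mul]
          have := hmuB j
          gcongr
      _ ≤ _ := by nlinarith
  · rw [abs_sub_comm]; exact (hmu j).trans hle
  · rw [hvar, hee']
    -- From S ≤ 3/2; subtracting the squared mean of the noise, at most c/6, leaves c/2.
    have h1 : 2 / 3 * c ≤ ((n : ℝ)⁻¹ * ∑ t, v t * (e t * e t)) / S := by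
      rw [le_div_iff₀ hSpos]
      have : S ≤ 3 / 2 := by linarith [hS1.2]
      have h2 : 2 / 3 * c * S ≤ 2 / 3 * c * (3 / 2) := by gcongr
      linarith [hee.1]
    linarith
  · rw [hvar, hee']
    have h1 : ((n : ℝ)⁻¹ * ∑ t, v t * (e t * e t)) / S ≤ 2 * E₁ := by
      rw [div_le_iff₀ hSpos]
      nlinarith [hee.2]
    linarith [mul_self_nonneg (wMean (normWeight v) e)]

lemma IsGreedyPath.card {n p m : ℕ} {w : Fin n → ℝ} {x : Fin n → Fin p → ℝ} {y : Fin n → ℝ}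
    {J : ℕ → Finset (Fin p)} (h : IsGreedyPath w x y m J) : ∀ i ≤ m, (J i).card = i := by
  intro i
  induction i with
  | zero => intro _; rw [h.1]; rfl
  | succ i ih =>
    intro hi
    obtain ⟨j, hj, hJ, -⟩ := h.2 i (by omega)
    rw [hJ, Finset.card_insert_of_notMem hj, ih (by omega)]

/-- Eigenvalues of Σ - cI are those of Σ shifted by -c, hence nonnegative; being symmetric, Σ - cI
is then positive semidefinite. -/
lemma SigmaTe_quadratic_ge {p : ℕ} {M : ShiftModel p} {c : ℝ}
    (h : ∀ l : ℝ, Module.End.HasEigenvalue (Matrix.toLin' M.SigmaTe) l → c ≤ l)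
    (v : Fin p → ℝ) : c * ∑ i, v i ^ 2 ≤ v ⬝ᵥ M.SigmaTe *ᵥ v := by
  have hsymm : M.SigmaTe.IsHermitian := by
    ext i j
    simp only [ShiftModel.SigmaTe, conjTranspose_apply, of_apply, star_trivial]
    exact covariance_comm _ _
  have hsub : (M.SigmaTe - c • (1 : Matrix (Fin p) (Fin p) ℝ)).IsHermitian := by
    refine hsymm.sub ?_
    rw [Matrix.IsHermitian, conjTranspose_smul, conjTranspose_one, star_trivial]
  have hpsd : (M.SigmaTe - c • (1 : Matrix (Fin p) (Fin p) ℝ)).PosSemidef := by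
    rw [hsub.posSemidef_iff_eigenvalues_nonneg]
    intro i
    have h1 := hsub.mulVec_eigenvectorBasis i
    set z : Fin p → ℝ := (hsub.eigenvectorBasis i).ofLp with hz
    have hz0 : z ≠ 0 := by
      intro h0
      have := hsub.eigenvectorBasis.orthonormal.ne_zero i
      apply this
      ext k
      exact congrFun h0 k
    have h2 : Module.End.HasEigenvalue (Matrix.toLin' M.SigmaTe) (hsub.eigenvalues i + c) := by
      refine Module.End.hasEigenvalue_of_hasEigenvector (x := z) ⟨?_, hz0⟩
      rw [Module.End.mem_eigenspace_iff, toLin'_apply]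
      rw [sub_mulVec, smul_mulVec, one_mulVec, sub_eq_iff_eq_add] at h1
      rw [h1, add_smul]
    have := h _ h2
    simp only [Pi.zero_apply]
    linarith
  have h3 := hpsd.dotProduct_mulVec_nonneg v
  rw [sub_mulVec, smul_mulVec, one_mulVec, dotProduct_sub, dotProduct_smul, star_trivial] at h3
  have h4 : v ⬝ᵥ v = ∑ i, v i ^ 2 := by
    rw [dotProduct]; exact Finset.sum_congr rfl fun i _ => (sq _).symm
  rw [h4, smul_eq_mul] at h3
  linarith

section RiskBound

/-- Coefficient in the bound on the `ℓ₁` norm of the slope error. -/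
noncomputable def slopeConst (A c₀ L : ℝ) : ℝ := A / (c₀ / 2) + 2 * (1 + L)

/-- Coefficient of the error terms in the excess risk. -/
noncomputable def riskConst (A c₀ L : ℝ) : ℝ :=
  A * (2 * slopeConst A c₀ L ^ 2 + 2 * slopeConst A c₀ L)

variable {n p : ℕ} {M : ShiftModel p} {a : ℝ} {b : Fin p → ℝ} {w : Fin n → ℝ}
  {x : Fin n → Fin p → ℝ} {y e : Fin n → ℝ} {A c₀ L d c E₁ : ℝ} {J : Finset (Fin p)}

lemma slopeConst_nonneg (hA : 0 ≤ A) (hc₀ : 0 < c₀) (hL : 0 ≤ L) : 0 ≤ slopeConst A c₀ L := by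
  unfold slopeConst; positivity

lemma riskConst_nonneg (hA : 0 ≤ A) (hc₀ : 0 < c₀) (hL : 0 ≤ L) : 0 ≤ riskConst A c₀ L := by
  have := slopeConst_nonneg hA hc₀ hL
  unfold riskConst; positivity

/-- The constant is halved only to agree with the sample version, since `sum_abs_error_le` uses a
single κ. -/
lemma coerciveOn_SigmaTe
    (heig : ∀ l : ℝ, Module.End.HasEigenvalue (Matrix.toLin' M.SigmaTe) l → c₀ ≤ l)
    (hc₀ : 0 < c₀) : CoerciveOn M.SigmaTe (c₀ / 2) J := by
  intro v _
  have h1 := SigmaTe_quadratic_ge heig v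
  have h2 : 0 ≤ ∑ i, v i ^ 2 := Finset.sum_nonneg fun i _ => sq_nonneg _
  nlinarith

lemma SampleAccuracy.coerciveOn (h : SampleAccuracy M w x e (A * d) c E₁)
    (heig : ∀ l : ℝ, Module.End.HasEigenvalue (Matrix.toLin' M.SigmaTe) l → c₀ ≤ l)
    (hA : 0 ≤ A) (hd : 0 ≤ d) (hJ : J.card * (A * d) ≤ c₀ / 2) :
    CoerciveOn (sigmaHat w x) (c₀ / 2) J :=
  coerciveOn_of_perturbation (by positivity) (SigmaTe_quadratic_ge heig) h.sigma hJ

/-- `ℓ₁` norm of the slope error of a model of moderate size. -/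
lemma SampleAccuracy.sum_abs_slopeError_le (h : SampleAccuracy M w x e (A * d) c E₁)
    (heig : ∀ l : ℝ, Module.End.HasEigenvalue (Matrix.toLin' M.SigmaTe) l → c₀ ≤ l)
    (hA : 0 ≤ A) (hd : 0 ≤ d) (hc₀ : 0 < c₀) (hL : 0 ≤ L)
    (hy : ∀ t, y t = a + b ⬝ᵥ x t + e t)
    (hpart : 1 ≤ J.card → ∀ j ∉ J, partialL1 M.SigmaTe J j ≤ L)
    (hJ : J.card * (A * d) ≤ c₀ / 2) :
    ∑ i, |slopeError w x y b J i|
      ≤ slopeConst A c₀ L * (J.card * d + ∑ i ∈ Jᶜ, |b i|) := by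
  have hcoer := h.coerciveOn heig hA hd hJ
  have hpart' : ∀ j ∉ J, partialL1 M.SigmaTe J j ≤ L := by
    intro j hj
    rcases Nat.eq_zero_or_pos J.card with h0 | h0
    · obtain rfl := Finset.card_eq_zero.mp h0
      simpa [partialL1] using hL
    · exact hpart h0 j hj
  have h1 := sum_abs_error_le (β := b) (by positivity) (by positivity) hL
    (coerciveOn_SigmaTe heig hc₀) hcoer h.sigma h.noise hpart'
    (fun i hi => slopeError_of_notMem w x y b hi)
    (normal_equations h.one hy (by positivity) hcoer) hJ
  refine h1.trans ?_
  have hb0 : 0 ≤ ∑ i ∈ Jᶜ, |b i| := Finset.sum_nonneg fun i _ => abs_nonneg _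
  have hm0 : (0 : ℝ) ≤ J.card := by positivity
  have h2 : 0 ≤ A / (c₀ / 2) := by positivity
  have h3 : A * d / (c₀ / 2) * J.card = A / (c₀ / 2) * (J.card * d) := by ring
  have h4 : 0 ≤ J.card * d := by positivity
  rw [h3, slopeConst]
  nlinarith [mul_nonneg h2 hb0, mul_nonneg hL h4]

/-- The condition md ≤ 1 turns (md)² into md, so the error is linear in the model size, just as the
penalty is. -/
lemma error_le_riskConst {l m s : ℝ} (hA : 0 ≤ A) (hc₀ : 0 < c₀) (hL : 0 ≤ L) (hd : 0 ≤ d)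
    (hm : 0 ≤ m) (hmd : m * d ≤ 1) (hs : 0 ≤ s) (hl0 : 0 ≤ l)
    (hl : l ≤ slopeConst A c₀ L * (m * d + s)) :
    A * d * l ^ 2 + 2 * (A * d) * l ≤ riskConst A c₀ L * (m * d ^ 2 + d * (s * (1 + s))) := by
  set C := slopeConst A c₀ L with hC
  have hC0 : 0 ≤ C := slopeConst_nonneg hA hc₀ hL
  set u := m * d with hu
  have hu0 : 0 ≤ u := by positivity
  have h1 : l ^ 2 ≤ C ^ 2 * (2 * (u + s * (1 + s))) := by
    calc l ^ 2 ≤ (C * (u + s)) ^ 2 := by gcongr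
      _ = C ^ 2 * (u + s) ^ 2 := by ring
      _ ≤ C ^ 2 * (2 * (u + s * (1 + s))) := by
        gcongr
        nlinarith [sq_nonneg (u - s)]
  have h2 : l ≤ C * (u + s * (1 + s)) := by
    refine hl.trans ?_
    gcongr
    nlinarith
  have hAd : 0 ≤ A * d := by positivity
  calc A * d * l ^ 2 + 2 * (A * d) * l
      ≤ A * d * (C ^ 2 * (2 * (u + s * (1 + s)))) + 2 * (A * d) * (C * (u + s * (1 + s))) := by
        gcongr
    _ = A * (2 * C ^ 2 + 2 * C) * (u * d + d * (s * (1 + s))) := by ring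
    _ = _ := by rw [riskConst, hu]; ring

/-- The selected model attains the oracle rate on the event of accurate sample moments. -/
theorem exists_mcpe_le {B Cξ ξ Cd Mk sa : ℝ} (hA : 0 < A) (hc₀ : 0 < c₀) (hL : 0 ≤ L)
    (hB : 0 ≤ B) (hCξ : 0 < Cξ) (hξ : 0 ≤ ξ) (hCd : 0 ≤ Cd) (hMk0 : 0 < Mk) (hMk1 : Mk ≤ 1)
    (hMkA : A * Mk ≤ c₀ / 2) (hc : 0 < c) (hE₁ : 0 ≤ E₁) (hsa0 : 0 ≤ sa)
    (hsa : 2 * riskConst A c₀ L ≤ sa * c) :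
    ∃ C d₀ : ℝ, 0 ≤ C ∧ 0 < d₀ ∧ ∀ {n p : ℕ} {M : ShiftModel p} {a : ℝ} {b : Fin p → ℝ}
      {w : Fin n → ℝ} {x : Fin n → Fin p → ℝ} {y e : Fin n → ℝ} {d : ℝ}
      {J : ℕ → Finset (Fin p)} {k : ℕ}, 1 ≤ p → 0 < d → d ≤ d₀ →
      M.IsBestLinearPredictor a b → SampleAccuracy M w x e (A * d) c E₁ →
      (∀ t, y t = a + b ⬝ᵥ x t + e t) →
      (∀ l : ℝ, Module.End.HasEigenvalue (Matrix.toLin' M.SigmaTe) l → c₀ ≤ l) →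
      (∀ j, M.SigmaTe j j ≤ Cd) → l2On b Finset.univ ≤ B →
      (∀ J : Finset (Fin p), l1On b J ≤ Cξ * l2On b J ^ (2 * ξ / (2 * ξ + 1))) →
      (∀ J : Finset (Fin p), 1 ≤ J.card → J.card ≤ ⌊Mk / d⌋₊ → ∀ j ∉ J,
        partialL1 M.SigmaTe J j ≤ L) →
      IsGreedyPath w x y (min ⌊Mk / d⌋₊ p) J →
      IsCriterionMin sa d w x y (min ⌊Mk / d⌋₊ p) J k →
      mcpe M a b w x y (J k) ≤ C * d ^ ((1 + 2 * ξ) / (1 + ξ)) := by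
  -- Chosen so that the sparsity exponent is 1 - κ; the target rate ρ is then the solution of
  -- ρ^((1+κ)/2) = d.
  set κ := 1 / (2 * ξ + 1) with hκ
  have hκ0 : 0 < κ := by positivity
  have hκ1 : κ ≤ 1 := by rw [hκ, div_le_one (by positivity)]; linarith
  have hκτ : 2 * ξ / (2 * ξ + 1) = 1 - κ := by rw [hκ]; field_simp; ring
  set C₁ := slopeConst A c₀ L with hC₁
  set C₂ := riskConst A c₀ L with hC₂
  have hC₁0 : 0 ≤ C₁ := slopeConst_nonneg hA.le hc₀ hL
  have hC₂0 : 0 ≤ C₂ := riskConst_nonneg hA.le hc₀ hL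
  set C₄ := Cξ * c₀⁻¹ ^ ((1 - κ) / 2) with hC₄
  have hC₄0 : 0 < C₄ := by positivity
  set Bb := Cξ * B ^ (1 - κ) with hBb
  have hBb0 : 0 ≤ Bb := by positivity
  set C₅ := √(Cd + A) with hC₅
  have hC₅0 : 0 < C₅ := Real.sqrt_pos.mpr (by positivity)
  obtain ⟨C₆, hC₆0, hgreedy⟩ := exists_greedy_excess_le hκ0 hκ1 hC₂0 hC₄0 hBb0 hC₅0
    (show 0 < Mk / 2 by positivity)
  obtain ⟨C₇, δ₀, hC₇0, hδ₀, hcrit⟩ := exists_criterion_excess_le hκ0 hκ1 hC₂0 hC₄0.le hBb0 hC₆0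
    hE₁ hsa0 hsa
  -- The bound Mk^(1+ξ) on d ensures that the ideal number of iterations is at least one; the last
  -- bound gives C₂d + δ₀ρ ≤ c/2, as the criterion step requires.
  refine ⟨C₇ + (A * (C₁ * (1 + Bb) + 1)) ^ 2,
    min (min 1 (Mk ^ (1 + ξ))) (c / 2 / (C₂ + δ₀)), by positivity, by positivity, ?_⟩
  intro n p M a b w x y e d J k hp hd hd₀ hblp hacc hy heig hdiag hl2 hsparse hpart hpath hmin
  have hd1 : d ≤ 1 := hd₀.trans ((min_le_left _ _).trans (min_le_left _ _))
  have hdMk : d ≤ Mk ^ (1 + ξ) := hd₀.trans ((min_le_left _ _).trans (min_le_right _ _))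
  have hdc : d ≤ c / 2 / (C₂ + δ₀) := hd₀.trans (min_le_right _ _)
  set ρ := d ^ ((1 + 2 * ξ) / (1 + ξ)) with hρ
  have hρ0 : 0 < ρ := Real.rpow_pos_of_pos hd _
  have hρ1 : ρ ≤ 1 := Real.rpow_le_one hd.le hd1 (by positivity)
  have hρd : ρ ^ ((1 + κ) / 2) = d := by
    rw [hρ, ← Real.rpow_mul hd.le, hκ,
      show (1 + 2 * ξ) / (1 + ξ) * ((1 + 1 / (2 * ξ + 1)) / 2) = 1 by field_simp; ring,
      Real.rpow_one]
  have hρκ : ρ ^ (-κ) = d ^ (-(1 / (1 + ξ))) := by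
    rw [hρ, ← Real.rpow_mul hd.le, hκ]
    congr 1
    field_simp
    ring
  have hρle : ρ ≤ d := by
    calc ρ ≤ d ^ (1 : ℝ) := by
          refine Real.rpow_le_rpow_of_exponent_ge hd hd1 ?_
          rw [le_div_iff₀ (by positivity)]; linarith
      _ = d := Real.rpow_one d
  have hd2ρ : d ^ 2 ≤ ρ := by
    calc d ^ 2 = d ^ (2 : ℝ) := (Real.rpow_two d).symm
      _ ≤ ρ := by
        refine Real.rpow_le_rpow_of_exponent_ge hd hd1 ?_
        rw [div_le_iff₀ (by positivity)]; linarith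
  set m := min ⌊Mk / d⌋₊ p with hm
  obtain ⟨hk1, hkm, hkmin⟩ := hmin
  have hfl : ∀ i ≤ m, (i : ℝ) * d ≤ Mk := fun i hi => by
    have h1 : (i : ℝ) ≤ Mk / d :=
      (Nat.le_floor_iff (by positivity)).mp (hi.trans (min_le_left _ _))
    rwa [le_div_iff₀ hd] at h1
  have hcard := hpath.card
  have hcardA : ∀ i ≤ m, ((J i).card : ℝ) * (A * d) ≤ c₀ / 2 := fun i hi => by
    rw [hcard i hi]
    calc (i : ℝ) * (A * d) = A * (i * d) := by ring
      _ ≤ A * Mk := by gcongr; exact hfl i hi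
      _ ≤ _ := hMkA
  have hcoer : ∀ i ≤ m, CoerciveOn (sigmaHat w x) (c₀ / 2) (J i) := fun i hi =>
    hacc.coerciveOn heig hA.le hd.le (hcardA i hi)
  set Sh := sigmaHat w x with hSh
  set r := noiseCov w x e with hr
  set δ : ℕ → Fin p → ℝ := fun i => slopeError w x y b (J i) with hδ
  set Q : ℕ → ℝ := fun i => δ i ⬝ᵥ M.SigmaTe *ᵥ δ i with hQ
  set D : ℕ → ℝ := fun i => excess Sh r (δ i) with hD
  set s : ℕ → ℝ := fun i => ∑ j ∈ (J i)ᶜ, |b j| with hs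
  set l : ℕ → ℝ := fun i => ∑ j, |δ i j| with hl
  have hs0 : ∀ i, 0 ≤ s i := fun i => Finset.sum_nonneg fun _ _ => abs_nonneg _
  have hl0 : ∀ i, 0 ≤ l i := fun i => Finset.sum_nonneg fun _ _ => abs_nonneg _
  have hnormal : ∀ i ≤ m, ∀ j ∈ J i, (Sh *ᵥ δ i + r) j = 0 := fun i hi =>
    normal_equations hacc.one hy (by positivity) (hcoer i hi)
  have hoff : ∀ i, ∀ j ∉ J i, δ i j = b j := fun i j hj => slopeError_of_notMem w x y b hj
  have hlle : ∀ i ≤ m, l i ≤ C₁ * (i * d + s i) := fun i hi => by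
    have := hacc.sum_abs_slopeError_le heig hA.le hd.le hc₀ hL hy
      (fun h1 => hpart (J i) h1 (by rw [hcard i hi]; exact hi.trans (min_le_left _ _)))
      (hcardA i hi)
    rwa [hcard i hi] at this
  have herr : ∀ i ≤ m, A * d * l i ^ 2 + 2 * (A * d) * l i
      ≤ C₂ * (i * d ^ 2 + d * (s i * (1 + s i))) := fun i hi =>
    error_le_riskConst hA.le hc₀ hL hd.le (by positivity) ((hfl i hi).trans hMk1) (hs0 i) (hl0 i)
      (hlle i hi)
  have hDQ : ∀ i ≤ m, |D i - Q i| ≤ C₂ * (i * d ^ 2 + d * (s i * (1 + s i))) := fun i hi =>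
    (abs_excess_sub_le hacc.sigma hacc.noise).trans (herr i hi)
  have hQge : ∀ i, c₀ * ∑ j, δ i j ^ 2 ≤ Q i := fun i => SigmaTe_quadratic_ge heig (δ i)
  have hQ0 : ∀ i, 0 ≤ Q i := fun i => le_trans
    (mul_nonneg hc₀.le (Finset.sum_nonneg fun _ _ => sq_nonneg _)) (hQge i)
  -- The slope error equals the true slope off the model, so the smallest eigenvalue bounds the
  -- omitted coefficients by the risk.
  have hl2Q : ∀ i, l2On b (J i)ᶜ ^ 2 ≤ c₀⁻¹ * Q i := fun i => by
    rw [l2On, Real.sq_sqrt (Finset.sum_nonneg fun _ _ => sq_nonneg _), ← div_eq_inv_mul,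
      le_div_iff₀ hc₀, mul_comm]
    refine le_trans ?_ (hQge i)
    gcongr
    calc ∑ j ∈ (J i)ᶜ, b j ^ 2 = ∑ j ∈ (J i)ᶜ, δ i j ^ 2 :=
          Finset.sum_congr rfl fun j hj => by rw [hoff i j (Finset.mem_compl.mp hj)]
      _ ≤ ∑ j, δ i j ^ 2 := Finset.sum_le_sum_of_subset_of_nonneg (Finset.subset_univ _)
          fun _ _ _ => sq_nonneg _
  have hl2nn : ∀ i, 0 ≤ l2On b (J i)ᶜ := fun i => Real.sqrt_nonneg _
  have hsl : ∀ i, s i ≤ Cξ * l2On b (J i)ᶜ ^ (1 - κ) := fun i => by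
    have := hsparse (J i)ᶜ
    rwa [hκτ] at this
  have hsB : ∀ i, s i ≤ Bb := fun i => by
    refine (hsl i).trans ?_
    have h1 : l2On b (J i)ᶜ ≤ B := by
      refine le_trans (Real.sqrt_le_sqrt ?_) hl2
      exact Finset.sum_le_sum_of_subset_of_nonneg (Finset.subset_univ _)
        fun _ _ _ => sq_nonneg _
    have h2 := hl2nn i
    have h3 : 0 ≤ 1 - κ := by linarith
    rw [hBb]
    gcongr
  have hsQ : ∀ i, s i ≤ C₄ * Q i ^ ((1 - κ) / 2) := fun i => by
    refine (hsl i).trans ?_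
    have h1 : l2On b (J i)ᶜ ^ (1 - κ) ≤ (c₀⁻¹ * Q i) ^ ((1 - κ) / 2) := by
      calc l2On b (J i)ᶜ ^ (1 - κ) = (l2On b (J i)ᶜ ^ 2) ^ ((1 - κ) / 2) := by
            rw [← Real.rpow_natCast, ← Real.rpow_mul (hl2nn i)]
            congr 1; push_cast; ring
        _ ≤ _ := Real.rpow_le_rpow (sq_nonneg _) (hl2Q i) (by linarith)
    rw [hC₄, mul_assoc, ← Real.mul_rpow (by positivity) (hQ0 i)]
    gcongr
  have hK1 : 1 ≤ m := hk1.trans hkm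
  have hdA : A * d ≤ c₀ / 2 := by
    have h1 := hfl 1 hK1
    rw [Nat.cast_one, one_mul] at h1
    exact (by gcongr : A * d ≤ A * Mk).trans hMkA
  have hShpos : ∀ j, 0 < Sh j j := fun j => by
    have h1 := hacc.coerciveOn (J := {j}) heig hA.le hd.le (by simpa using hdA)
      (Pi.single j 1) (fun i hi => by
        rw [Finset.mem_singleton] at hi; simp [hi])
    have h2 : ∑ i, (Pi.single j (1 : ℝ) : Fin p → ℝ) i ^ 2 = 1 := by
      rw [Finset.sum_eq_single j]
      · simp
      · intro i _ hij; simp [hij]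
      · simp
    rw [h2, mulVec_single_one, single_one_dotProduct] at h1
    change c₀ / 2 * 1 ≤ Sh j j at h1
    linarith
  have hShle : ∀ j, √(Sh j j) ≤ C₅ := fun j => by
    refine Real.sqrt_le_sqrt ?_
    have h1 := (abs_le.mp (hacc.sigma j j)).2
    have h2 := hdiag j
    have h3 : A * d ≤ A * 1 := by gcongr
    change Sh j j - _ ≤ _ at h1
    linarith
  -- Stated for all i, with the dummy value 0 past the path, so that the gains can be chosen as one
  -- sequence.
  have hstep : ∀ i, ∃ g : ℝ, i < m → 0 ≤ g ∧ D (i + 1) ≤ D i - g ^ 2 ∧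
      ∀ j ∉ J i, |(Sh *ᵥ δ i + r) j| ≤ C₅ * g := by
    intro i
    by_cases hi : i < m
    · obtain ⟨j, hj, hJ, hmax⟩ := hpath.2 i hi
      refine ⟨|score w x y (J i) j|, fun _ => ⟨abs_nonneg _, ?_, fun j' hj' => ?_⟩⟩
      · have h1 := excess_insert_le (sigmaHat_transpose w x) (r := r) (β := b) (δ := δ i)
          (δ' := δ (i + 1)) (show (0 : ℝ) ≤ c₀ / 2 by positivity) (hJ ▸ hcoer (i + 1) hi)
          (hShpos j) (hoff i) (hJ ▸ hoff (i + 1)) (hJ ▸ hnormal (i + 1) hi)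
        rw [sq_abs, score_eq hacc.one hy, div_pow, Real.sq_sqrt (hShpos j).le]
        exact h1
      · have h1 := hmax j' hj'
        have h2 : (Sh *ᵥ δ i + r) j' = √(Sh j' j') * score w x y (J i) j' := by
          rw [score_eq hacc.one hy, mul_div_cancel₀ _ (Real.sqrt_pos.mpr (hShpos j')).ne']
        rw [h2, abs_mul, abs_of_nonneg (Real.sqrt_nonneg _)]
        exact mul_le_mul (hShle j') h1 (abs_nonneg _) hC₅0.le
    · exact ⟨0, fun h => absurd h hi⟩
  choose g hg using hstep
  have hQg : ∀ i < m, Q i ≤ s i * (C₅ * g i)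
      + C₂ * (i * d ^ 2 + d * (s i * (1 + s i))) := by
    intro i hi
    have h1 := quadratic_le_of_normal (S := M.SigmaTe) hacc.sigma hacc.noise (hoff i)
      (hnormal i hi.le) (hg i hi).2.2
    have h2 := herr i hi.le
    have h3 : 0 ≤ A * d * l i := mul_nonneg (by positivity) (hl0 i)
    linarith
  -- The ideal stopping time: here m^(-(2ξ+1)) from the recursion and the penalty md² are both of
  -- order ρ. It serves only as a competitor in the criterion, so the procedure need not know ξ.
  set z := Mk * d ^ (-(1 / (1 + ξ))) with hz
  have hz1 : 1 ≤ z := by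
    rw [hz, Real.rpow_neg hd.le, ← div_eq_mul_inv, one_le_div (by positivity)]
    calc d ^ (1 / (1 + ξ)) ≤ (Mk ^ (1 + ξ)) ^ (1 / (1 + ξ)) :=
          Real.rpow_le_rpow hd.le hdMk (by positivity)
      _ = Mk := by
          rw [← Real.rpow_mul hMk0.le, mul_one_div_cancel (by positivity), Real.rpow_one]
  have hzle : z ≤ Mk / d := by
    rw [hz, show Mk / d = Mk * d ^ (-1 : ℝ) by rw [Real.rpow_neg_one, div_eq_mul_inv]]
    refine mul_le_mul_of_nonneg_left ?_ hMk0.le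
    refine Real.rpow_le_rpow_of_exponent_ge hd hd1 ?_
    rw [neg_le_neg_iff, div_le_one (by positivity)]; linarith
  set ks := min ⌊z⌋₊ p with hks
  have hksm : ks ≤ m := min_le_min (Nat.floor_mono hzle) le_rfl
  have hks1 : 1 ≤ ks := le_min ((Nat.one_le_floor_iff z).mpr hz1) hp
  have hksρ : (ks : ℝ) * d ^ 2 ≤ ρ := by
    have h1 : (ks : ℝ) ≤ z := (Nat.le_floor_iff (by linarith)).mp (min_le_left _ _)
    calc (ks : ℝ) * d ^ 2 ≤ z * d ^ 2 := by gcongr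
      _ = Mk * (d ^ (-(1 / (1 + ξ))) * d ^ 2) := by rw [hz]; ring
      _ = Mk * ρ := by
          rw [← Real.rpow_natCast, ← Real.rpow_add hd, hρ]
          congr 2; push_cast; field_simp; ring
      _ ≤ 1 * ρ := by gcongr
      _ = ρ := one_mul ρ
  -- The factor 1/2 covers rounding down a number at least one. If p is smaller than the ideal time,
  -- the path ends with the full model, which omits nothing and has only estimation error.
  have hend : Mk / 2 * ρ ^ (-κ) ≤ ks ∨ Q ks ≤ C₂ * (ks * d ^ 2) := by
    rcases le_total ⌊z⌋₊ p with h1 | h1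
    · left
      rw [hks, min_eq_left h1, hρκ]
      have h2 := Nat.lt_floor_add_one z
      have h3 : (1 : ℝ) ≤ ⌊z⌋₊ := by exact_mod_cast (Nat.one_le_floor_iff z).mpr hz1
      have h4 : Mk / 2 * d ^ (-(1 / (1 + ξ))) = z / 2 := by rw [hz]; ring
      rw [h4]; linarith
    · right
      have h2 : ks = p := min_eq_right h1
      have h3 : (J ks).card = p := by rw [hcard ks hksm, h2]
      have h4 : J ks = Finset.univ :=
        Finset.eq_univ_of_card _ (by rw [h3, Fintype.card_fin])
      have h5 : s ks = 0 := by simp [hs, h4]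
      have h6 := quadratic_le_of_normal (S := M.SigmaTe) (G := 0) hacc.sigma hacc.noise (hoff ks)
        (hnormal ks hksm) (fun i hi => absurd (Finset.mem_univ i) (h4 ▸ hi))
      have h7 := herr ks hksm
      rw [h5] at h7
      have h8 : 0 ≤ A * d * l ks := mul_nonneg (by positivity) (hl0 ks)
      simp only [zero_mul, mul_zero, add_zero, zero_add] at h6 h7
      linarith
  have hDks := hgreedy d ρ D Q s g ks hd.le hρ0 hρd (fun i hi => hDQ i (hi.trans hksm))
    (fun i hi => hQg i (hi.trans_le hksm)) (fun i hi => (hg i (hi.trans_le hksm)).1)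
    (fun i _ => ⟨hQ0 i, hs0 i, hsB i, hsQ i⟩) (fun i hi => (hg i (hi.trans_le hksm)).2.1)
    hksρ hend
  set E := wMean w (fun t => (e t - wMean w e) * (e t - wMean w e)) with hE
  have hcr := hkmin ks hks1 hksm
  rw [hdiwic, hdiwic, resVar_eq hacc.one hy, resVar_eq hacc.one hy, hcard k hkm,
    hcard ks hksm] at hcr
  have hsmall : C₂ * d + δ₀ * ρ ≤ c / 2 := by
    rw [le_div_iff₀ (by positivity)] at hdc
    have : δ₀ * ρ ≤ δ₀ * d := by gcongr
    linarith
  have hQk : Q k ≤ C₇ * ρ := hcrit d ρ E (D k) (D ks) (Q k) (s k) k ks hd.le hρ0 hρ1 hρd hsmall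
    hacc.le_var hacc.var_le hcr hDks (hDQ k hkm) hks1 hksρ ((hfl k hkm).trans hMk1) (hQ0 k)
    (hs0 k) (hsB k) (hsQ k)
  rw [mcpe_eq hblp hacc.one hy]
  have hlk : l k ≤ C₁ * (1 + Bb) := by
    refine (hlle k hkm).trans ?_
    have h1 := (hfl k hkm).trans hMk1
    have h2 := hsB k
    gcongr
  have hdev : |∑ i, δ k i * ((∫ u, u i ∂M.testX) - muX w x i) - wMean w e|
      ≤ A * (C₁ * (1 + Bb) + 1) * d := by
    have h1 : |δ k ⬝ᵥ fun i => (∫ u, u i ∂M.testX) - muX w x i| ≤ l k * (A * d) :=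
      abs_dotProduct_le hacc.mean
    calc _ ≤ |∑ i, δ k i * ((∫ u, u i ∂M.testX) - muX w x i)| + |wMean w e| := abs_sub _ _
      _ ≤ l k * (A * d) + A * d := add_le_add h1 hacc.noiseMean
      _ ≤ C₁ * (1 + Bb) * (A * d) + A * d := by gcongr
      _ = _ := by ring
  have hsq : (∑ i, δ k i * ((∫ u, u i ∂M.testX) - muX w x i) - wMean w e) ^ 2
      ≤ (A * (C₁ * (1 + Bb) + 1)) ^ 2 * ρ := by
    calc _ = |∑ i, δ k i * ((∫ u, u i ∂M.testX) - muX w x i) - wMean w e| ^ 2 :=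
          (sq_abs _).symm
      _ ≤ (A * (C₁ * (1 + Bb) + 1) * d) ^ 2 := by gcongr
      _ = (A * (C₁ * (1 + Bb) + 1)) ^ 2 * d ^ 2 := by ring
      _ ≤ _ := by gcongr
  rw [add_mul]
  exact add_le_add hQk hsq

end RiskBound

/-! ### From the assumptions to the event of accurate moments -/

lemma residual_eq_iff {p : ℕ} {a : ℝ} {b : Fin p → ℝ} {x : Fin p → ℝ} {y e : ℝ} :
    e = residual a b (x, y) ↔ y = a + b ⬝ᵥ x + e := by
  rw [residual]; constructor <;> intro h <;> linarith

/-- Independence of the pairs (noise, covariates) is independence of the sample. -/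
lemma isSample_of_residual {n p : ℕ} {M : ShiftModel p} {Ω : Type*} [MeasurableSpace Ω]
    {P : Measure Ω} {a : ℝ} {b : Fin p → ℝ} {X : Fin n → Ω → Fin p → ℝ} {Y e : Fin n → Ω → ℝ}
    (hX : ∀ t, Measurable (X t)) (hY : ∀ t, Measurable (Y t))
    (hlaw : ∀ t, P.map (fun ω => (X t ω, Y t ω)) = M.trainLaw)
    (he : ∀ t ω, e t ω = residual a b (X t ω, Y t ω))
    (hind : iIndepFun (fun t ω => (e t ω, X t ω)) P) :
    IsSample M P (fun t ω => (X t ω, Y t ω)) where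
  measurable t := (hX t).prodMk (hY t)
  law := hlaw
  indep := by
    have h := hind.comp (fun _ z => (z.2, a + b ⬝ᵥ z.2 + z.1)) fun _ => by
      simp only [dotProduct]; fun_prop
    convert h using 2 with t
    funext ω
    exact Prod.ext rfl (residual_eq_iff.mp (he t ω))

section NullEvents

variable {Ω : ℕ → Type*} [∀ n, MeasurableSpace (Ω n)] {P : ∀ n, Measure (Ω n)}
  {S T : ∀ n, Set (Ω n)}

lemma tendsto_measure_zero_union (hS : Tendsto (fun n => P n (S n)) atTop (𝓝 0))
    (hT : Tendsto (fun n => P n (T n)) atTop (𝓝 0)) :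
    Tendsto (fun n => P n (S n ∪ T n)) atTop (𝓝 0) :=
  tendsto_of_tendsto_of_tendsto_of_le_of_le tendsto_const_nhds (by simpa using hS.add hT)
    (fun _ => zero_le) fun _ => measure_union_le _ _

lemma tendsto_measure_zero_mono (hS : Tendsto (fun n => P n (S n)) atTop (𝓝 0))
    (h : ∀ᶠ n in atTop, T n ⊆ S n) : Tendsto (fun n => P n (T n)) atTop (𝓝 0) :=
  tendsto_of_tendsto_of_tendsto_of_le_of_le' tendsto_const_nhds hS
    (Eventually.of_forall fun _ => zero_le) (h.mono fun _ hn => measure_mono hn)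

end NullEvents

lemma eventually_dRate_pos {p : ℕ → ℕ} (q η : ℝ) (hp' : Tendsto p atTop atTop) :
    ∀ᶠ n in atTop, 0 < dRate p q η n := by
  filter_upwards [eventually_cRate_pos hp', eventually_one_le_log] with n ⟨_, hc, _, _⟩ hl
  have : 0 < Real.log n := by linarith
  rw [dRate]
  split_ifs <;> positivity

/-- The sample moments with estimated trimmed importance weights are accurate with probability
tending to one. -/
theorem tendsto_measure_not_sampleAccuracy {p : ℕ → ℕ} {M : ∀ n, ShiftModel (p n)}
    {α : ℕ → ℝ} {β : ∀ n, Fin (p n) → ℝ} (hblp : ∀ n, (M n).IsBestLinearPredictor (α n) (β n))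
    {Ω : ℕ → Type*} [∀ n, MeasurableSpace (Ω n)] {P : ∀ n, Measure (Ω n)}
    [∀ n, IsProbabilityMeasure (P n)] {X : ∀ n, Fin n → Ω n → (Fin (p n) → ℝ)}
    {Y e : ∀ n, Fin n → Ω n → ℝ}
    (hS : ∀ n, IsSample (M n) (P n) (fun t ω => (X n t ω, Y n t ω)))
    (he : ∀ n t ω, e n t ω = residual (α n) (β n) (X n t ω, Y n t ω))
    {γ : ℝ} (hγ : γ < 1)
    (hp : (fun n => Real.log (p n)) =O[atTop] (fun n : ℕ => (n : ℝ) ^ γ))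
    (hp' : Tendsto p atTop atTop)
    {θ₀ η q Mw Mη B : ℝ} (hθ₀ : 0 < θ₀) (hη : 0 < η ∧ η ≤ 2) (hq : 0 < q) (hMw : 0 < Mw)
    (hMη : 1 / η + 1 / 2 ≤ Mη) (hB1 : 1 ≤ B)
    (hw : ∃ K : ℝ, ∀ᶠ n in atTop, ∫⁻ z, ENNReal.ofReal ((M n).w z.1 ^ q) ∂(M n).testLaw
      ≤ ENNReal.ofReal K)
    (hx : ∃ K : ℝ, ∀ᶠ n in atTop, ∀ i j : Fin (p n + 1),
      ∫⁻ z, ENNReal.ofReal (Real.exp (θ₀ * |aug z.1 i * aug z.1 j|)) ∂(M n).testLaw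
        ≤ ENNReal.ofReal K)
    (hB : ∀ᶠ n in atTop, ∀ i j : Fin (p n + 1), |∫ u, aug u i * aug u j ∂(M n).testX| ≤ B)
    (hetr : ∃ K : ℝ, ∀ᶠ n in atTop, ∫⁻ z, ENNReal.ofReal
      (Real.exp (θ₀ * |residual (α n) (β n) z| ^ η)) ∂(M n).trainLaw ≤ ENNReal.ofReal K)
    (hete : ∃ K : ℝ, ∀ᶠ n in atTop, ∫⁻ z, ENNReal.ofReal
      (Real.exp (θ₀ * |residual (α n) (β n) z| ^ η)) ∂(M n).testLaw ≤ ENNReal.ofReal K)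
    (hnoise : ∃ c : ℝ, 0 < c ∧ ∀ᶠ n in atTop, ENNReal.ofReal c ≤
      ∫⁻ z, ENNReal.ofReal ((residual (α n) (β n) z) ^ 2) ∂(M n).testLaw)
    {v vhat : ∀ n, Fin n → Ω n → ℝ}
    (hv : ∀ n t ω, v n t ω = min ((M n).w (X n t ω)) (bTrim p q Mw Mη n))
    (happ_xx : ∃ C : ℝ, 0 < C ∧ Tendsto (fun n => P n {ω | ∃ i j : Fin (p n + 1), i ≤ j ∧
      C * dRate p q η n ≤ |(n : ℝ)⁻¹ * ∑ t, (v n t ω - vhat n t ω) *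
        aug (X n t ω) i * aug (X n t ω) j|}) atTop (𝓝 0))
    (happ_xe : ∃ C : ℝ, 0 < C ∧ Tendsto (fun n => P n {ω | ∃ i : Fin (p n + 1),
      C * dRate p q η n ≤ |(n : ℝ)⁻¹ * ∑ t, (v n t ω - vhat n t ω) *
        aug (X n t ω) i * e n t ω|}) atTop (𝓝 0))
    (happ_ee : IsLittleOpOne P (fun n ω =>
      (n : ℝ)⁻¹ * ∑ t, (v n t ω - vhat n t ω) * (e n t ω) ^ 2)) :
    ∃ A c E₁ : ℝ, 0 < A ∧ 0 < c ∧ 0 ≤ E₁ ∧ Tendsto (fun n => P n {ω |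
      ¬ SampleAccuracy (M n) (normWeight fun t => vhat n t ω) (fun t => X n t ω)
        (fun t => e n t ω) (A * dRate p q η n) c E₁}) atTop (𝓝 0) := by
  obtain ⟨A₁, hA₁, h1⟩ := tendsto_measure_covariate_deviation hS hγ hp hp' hq hη hMw hMη hθ₀ hw hx
  obtain ⟨A₂, hA₂, h2⟩ := tendsto_measure_cross_deviation hS hblp hγ hp hp' hq hη.1 hMw hMη hθ₀
    hw hx hetr hete
  obtain ⟨c, E, hc, h3⟩ := tendsto_measure_noise_sq hS hγ hp hp' hq hη.1 hMw hMη hθ₀ hw hete hnoise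
  obtain ⟨C₁, hC₁, h4⟩ := happ_xx
  obtain ⟨C₂, hC₂, h5⟩ := happ_xe
  -- Half of the lower bound on the noise is conceded to the error of the estimated weights.
  have h6 := happ_ee (c / 2) (half_pos hc)
  set A₀ := A₁ + A₂ + C₁ + C₂ with hA₀
  have hA₀0 : 0 < A₀ := by positivity
  have hsmall : ∀ᶠ n in atTop, 2 * (1 + B) * (A₀ * dRate p q η n) ≤ min 1 (c / 2 / 6) := by
    have h := ((tendsto_dRate (η := η) hγ hp hq).const_mul A₀).const_mul (2 * (1 + B))
    rw [mul_zero, mul_zero] at h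
    exact h.eventually_le_const (by positivity)
  refine ⟨4 * (1 + B) ^ 2 * A₀, c / 2 / 2, 2 * (|E| + c / 2), by positivity, by positivity,
    by positivity, ?_⟩
  refine tendsto_measure_zero_mono (tendsto_measure_zero_union (tendsto_measure_zero_union
    (tendsto_measure_zero_union h1 h2) (tendsto_measure_zero_union h3 h4))
    (tendsto_measure_zero_union h5 h6)) ?_
  filter_upwards [hsmall, hB, eventually_dRate_pos q η hp'] with n hn hBn hd ω hω
  by_contra hgood
  refine hω ?_
  simp only [Set.mem_union, Set.mem_ofPred_eq, not_or, not_exists, not_and, not_le]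
    at hgood
  obtain ⟨⟨⟨g1, g2⟩, g3, g4⟩, g5, g6⟩ := hgood
  simp only [← hv, ← he] at g1 g2 g3
  -- Estimated weights are seen only through their difference from the true trimmed weights, in the
  -- same three families of moments.
  have split : ∀ f : Fin n → ℝ, (n : ℝ)⁻¹ * ∑ t, vhat n t ω * f t
      = (n : ℝ)⁻¹ * ∑ t, v n t ω * f t - (n : ℝ)⁻¹ * ∑ t, (v n t ω - vhat n t ω) * f t := by
    intro f
    rw [← mul_sub, ← Finset.sum_sub_distrib]
    congr 1
    exact Finset.sum_congr rfl fun t _ => by ring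
  rw [mul_assoc (4 * (1 + B) ^ 2)]
  refine sampleAccuracy_of_moments (hblp n) hB1 (by positivity) (by positivity) hBn ?_ ?_ ?_
    (hn.trans (min_le_left _ _)) (hn.trans (min_le_right _ _))
  · intro i j
    have k1 := g1 i j
    rw [← (M n).integral_testX (f := fun u => aug u i * aug u j)
      ((measurable_aug i).mul (measurable_aug j))] at k1
    have k2 : |(n : ℝ)⁻¹ * ∑ t, (v n t ω - vhat n t ω) * (aug (X n t ω) i * aug (X n t ω) j)|
        < C₁ * dRate p q η n := by
      -- The approximation condition covers i ≤ j only; the product is symmetric.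
      rcases le_total i j with hij | hij
      · simpa only [mul_assoc] using g4 i j hij
      · have := g4 j i hij
        simp only [mul_assoc] at this
        simpa only [mul_comm (aug (X n _ ω) i)] using this
    rw [split, sub_right_comm]
    refine (abs_sub _ _).trans ?_
    rw [hA₀]
    nlinarith [mul_pos hA₂ hd, mul_pos hC₂ hd]
  · intro i
    have k1 := g2 i
    have k2 := g5 i
    simp only [mul_assoc (_ - _)] at k2
    rw [split]
    refine (abs_sub _ _).trans ?_
    rw [hA₀]
    nlinarith [mul_pos hA₁ hd, mul_pos hC₁ hd]
  · obtain ⟨k1, k2⟩ := Classical.not_imp.mp g3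
    rw [not_lt] at k2
    rw [split]
    simp only [← pow_two]
    rw [abs_lt] at g6
    have := le_abs_self E
    constructor <;> linarith [g6.1, g6.2]

lemma abs_integral_aug_mul_aug_le {p : ℕ} {M : ShiftModel p} {θ₀ K : ℝ} (hθ₀ : 0 < θ₀)
    (hK : 0 ≤ K) (h : ∀ i j : Fin (p + 1), ∫⁻ u, ENNReal.ofReal
      (Real.exp (θ₀ * |aug u i * aug u j|)) ∂M.testX ≤ ENNReal.ofReal K) (i j : Fin (p + 1)) :
    |∫ u, aug u i * aug u j ∂M.testX| ≤ K / θ₀ := by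
  have hm : Measurable fun u : Fin p → ℝ => aug u i * aug u j :=
    (measurable_aug i).mul (measurable_aug j)
  refine abs_integral_le_integral_abs.trans ?_
  refine integral_le_of_lintegral_ofReal_le (by positivity) hm.abs (fun _ => abs_nonneg _) ?_
  rw [div_eq_inv_mul]
  refine lintegral_ofReal_le_of_le_mul (by positivity)
    ((hm.abs.const_mul θ₀).exp) (fun u => ?_) (h i j)
  rw [← div_eq_inv_mul, le_div_iff₀' hθ₀]
  linarith [Real.add_one_le_exp (θ₀ * |aug u i * aug u j|)]

lemma mcpe_nonneg {n p : ℕ} {M : ShiftModel p} {a : ℝ} {b : Fin p → ℝ} {w : Fin n → ℝ}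
    {x : Fin n → Fin p → ℝ} {y : Fin n → ℝ} {J : Finset (Fin p)} : 0 ≤ mcpe M a b w x y J :=
  integral_nonneg fun _ => sq_nonneg _

end IWOGA

/-! ### Order of the constants and conclusion -/

theorem theorem3
    -- population: dimensions, laws, coefficients of the best linear predictor
    (p : ℕ → ℕ) (M : ∀ n, IWOGA.ShiftModel (p n))
    (α : ℕ → ℝ) (β : ∀ n, Fin (p n) → ℝ)
    (hblp : ∀ n, (M n).IsBestLinearPredictor (α n) (β n))
    -- training sample of size `n`, its residuals
    {Ω : ℕ → Type*} [∀ n, MeasurableSpace (Ω n)]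
    (P : ∀ n, Measure (Ω n)) [∀ n, IsProbabilityMeasure (P n)]
    (X : ∀ n, Fin n → Ω n → (Fin (p n) → ℝ)) (Y : ∀ n, Fin n → Ω n → ℝ)
    (hX : ∀ n t, Measurable (X n t)) (hY : ∀ n t, Measurable (Y n t))
    (hlaw : ∀ n t, (P n).map (fun ω => (X n t ω, Y n t ω)) = (M n).trainLaw)
    (e : ∀ n, Fin n → Ω n → ℝ)
    (he : ∀ n t ω, e n t ω = IWOGA.residual (α n) (β n) (X n t ω, Y n t ω))
    -- growth of the dimension
    (γ : ℝ) (hγ : 0 < γ ∧ γ < 1)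
    (hp : (fun n => Real.log (p n)) =O[atTop] (fun n : ℕ => (n : ℝ) ^ γ))
    (hp' : Tendsto p atTop atTop)
    -- exponential moments
    (θ₀ η : ℝ) (hθ₀ : 0 < θ₀) (hη : 0 < η ∧ η ≤ 2)
    (hexp_tr : limsup (fun n => ∫⁻ z, ENNReal.ofReal
      (Real.exp (θ₀ * |IWOGA.residual (α n) (β n) z| ^ η)) ∂(M n).trainLaw) atTop < ⊤)
    (hexp_te : limsup (fun n => ∫⁻ z, ENNReal.ofReal
      (Real.exp (θ₀ * |IWOGA.residual (α n) (β n) z| ^ η)) ∂(M n).testLaw) atTop < ⊤)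
    (hexp_x : limsup (fun n => ⨆ (i : Fin (p n + 1)) (j : Fin (p n + 1)),
      ∫⁻ u, ENNReal.ofReal (Real.exp (θ₀ * |IWOGA.aug u i * IWOGA.aug u j|)) ∂(M n).testX)
      atTop < ⊤)
    -- the noise does not vanish asymptotically
    (hnoise : 0 < liminf (fun n => ∫⁻ z, ENNReal.ofReal
      ((IWOGA.residual (α n) (β n) z) ^ 2) ∂(M n).testLaw) atTop)
    -- moments of the importance
    (q : ℝ) (hq : 0 < q)
    (hw : limsup (fun n => ∫⁻ u, ENNReal.ofReal ((M n).w u ^ q) ∂(M n).testX) atTop < ⊤)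
    -- independent and identically distributed sample
    (hiid : ∀ n, iIndepFun (fun t ω => (e n t ω, X n t ω)) (P n))
    -- bounded coefficients, smallest eigenvalue of the test covariance matrix
    (hbdd : ∃ B : ℝ, ∀ n, 1 ≤ n → |α n| + IWOGA.l2On (β n) Finset.univ ≤ B)
    (heig : ∃ c : ℝ, 0 < c ∧ ∀ n, 1 ≤ n → ∀ l : ℝ,
      Module.End.HasEigenvalue (Matrix.toLin' (M n).SigmaTe) l → c ≤ l)
    -- trimmed importance
    (Mw Mη : ℝ) (hMw : 0 < Mw) (hMη : 1 / η + 1 / 2 ≤ Mη)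
    (v : ∀ n, Fin n → Ω n → ℝ)
    (hv : ∀ n t ω, v n t ω = min ((M n).w (X n t ω)) (IWOGA.bTrim p q Mw Mη n))
    -- estimated importance function (depending on the data and possibly on further information),
    -- its trimmed version, and the estimated weights
    (what : ∀ n, Ω n → (Fin (p n) → ℝ) → ℝ) (hwhat : ∀ n ω u, 0 ≤ what n ω u)
    (vhat : ∀ n, Fin n → Ω n → ℝ)
    (hvhat : ∀ n t ω, vhat n t ω = min (what n ω (X n t ω)) (IWOGA.bTrim p q Mw Mη n))
    (W : ∀ n, Ω n → Fin n → ℝ)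
    (hW : ∀ n ω, W n ω = IWOGA.normWeight (fun t => vhat n t ω))
    -- approximation conditions
    (happ_xx : ∃ C : ℝ, 0 < C ∧ Tendsto (fun n => P n {ω | ∃ i j : Fin (p n + 1), i ≤ j ∧
      C * IWOGA.dRate p q η n ≤ |(n : ℝ)⁻¹ * ∑ t, (v n t ω - vhat n t ω) *
        IWOGA.aug (X n t ω) i * IWOGA.aug (X n t ω) j|}) atTop (𝓝 0))
    (happ_xe : ∃ C : ℝ, 0 < C ∧ Tendsto (fun n => P n {ω | ∃ i : Fin (p n + 1),
      C * IWOGA.dRate p q η n ≤ |(n : ℝ)⁻¹ * ∑ t, (v n t ω - vhat n t ω) *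
        IWOGA.aug (X n t ω) i * e n t ω|}) atTop (𝓝 0))
    (happ_ee : IWOGA.IsLittleOpOne P (fun n ω =>
      (n : ℝ)⁻¹ * ∑ t, (v n t ω - vhat n t ω) * (e n t ω) ^ 2)) :
    -- for all small `Mk`, with `K_n = ⌊Mk / d_n⌋`
    ∃ Mbar : ℝ, 0 < Mbar ∧ ∀ Mk : ℝ, 0 < Mk → Mk ≤ Mbar →
      (∃ C : ℝ, 0 < C ∧ ∀ n, 1 ≤ n → ∀ J : Finset (Fin (p n)),
        1 ≤ J.card → J.card ≤ IWOGA.maxIter p q η Mk n → ∀ j ∉ J,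
          IWOGA.partialL1 (M n).SigmaTe J j ≤ C) →
      -- for all large `sa`, not depending on the sparsity level `ξ`
      ∃ sbar : ℝ, 0 < sbar ∧ ∀ sa : ℝ, sbar ≤ sa →
        ∀ ξ : ℝ, 0 ≤ ξ →
        (∃ C : ℝ, 0 < C ∧ ∀ n, 1 ≤ n → ∀ J : Finset (Fin (p n)),
          IWOGA.l1On (β n) J ≤ C * IWOGA.l2On (β n) J ^ (2 * ξ / (2 * ξ + 1))) →
        -- selected models and selected number of iterations
        ∀ (J : ∀ n, Ω n → ℕ → Finset (Fin (p n))) (k : ∀ n, Ω n → ℕ),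
        (∀ᶠ n in atTop, ∀ ω,
          IWOGA.IsGreedyPath (W n ω) (fun t => X n t ω) (fun t => Y n t ω)
            (min (IWOGA.maxIter p q η Mk n) (p n)) (J n ω)) →
        (∀ᶠ n in atTop, ∀ ω,
          IWOGA.IsCriterionMin sa (IWOGA.dRate p q η n) (W n ω)
            (fun t => X n t ω) (fun t => Y n t ω)
            (min (IWOGA.maxIter p q η Mk n) (p n)) (J n ω) (k n ω)) →
        IWOGA.IsBigOpOne P (fun n ω =>
          IWOGA.mcpe (M n) (α n) (β n) (W n ω) (fun t => X n t ω) (fun t => Y n t ω)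
              (J n ω (k n ω)) /
            IWOGA.dRate p q η n ^ ((1 + 2 * ξ) / (1 + ξ))) := by
  have hS : ∀ n, IWOGA.IsSample (M n) (P n) (fun t ω => (X n t ω, Y n t ω)) := fun n =>
    IWOGA.isSample_of_residual (hX n) (hY n) (hlaw n) (he n) (hiid n)
  have hw' : ∃ K : ℝ, ∀ᶠ n in atTop, ∫⁻ z, ENNReal.ofReal ((M n).w z.1 ^ q) ∂(M n).testLaw
      ≤ ENNReal.ofReal K := by
    obtain ⟨K, -, hK⟩ := IWOGA.exists_eventually_le_of_limsup_lt_top hw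
    refine ⟨K, hK.mono fun n hn => ?_⟩
    rwa [(M n).lintegral_testX (f := fun u => ENNReal.ofReal ((M n).w u ^ q))
      (((M n).measurable_w.pow_const q).ennreal_ofReal)] at hn
  obtain ⟨K, hK0, hK⟩ := IWOGA.exists_eventually_le_of_limsup_lt_top hexp_x
  have hx : ∀ᶠ n in atTop, ∀ i j : Fin (p n + 1), ∫⁻ u, ENNReal.ofReal
      (Real.exp (θ₀ * |IWOGA.aug u i * IWOGA.aug u j|)) ∂(M n).testX ≤ ENNReal.ofReal K :=
    hK.mono fun n hn i j => (le_iSup₂ (f := fun i j => ∫⁻ u, ENNReal.ofReal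
      (Real.exp (θ₀ * |IWOGA.aug u i * IWOGA.aug u j|)) ∂(M n).testX) i j).trans hn
  have hx' : ∃ K : ℝ, ∀ᶠ n in atTop, ∀ i j : Fin (p n + 1), ∫⁻ z, ENNReal.ofReal
      (Real.exp (θ₀ * |IWOGA.aug z.1 i * IWOGA.aug z.1 j|)) ∂(M n).testLaw
        ≤ ENNReal.ofReal K := by
    refine ⟨K, hx.mono fun n hn i j => ?_⟩
    have h := hn i j
    rwa [(M n).lintegral_testX (f := fun u => ENNReal.ofReal
      (Real.exp (θ₀ * |IWOGA.aug u i * IWOGA.aug u j|))) (by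
        have hi := IWOGA.measurable_aug (p := p n) i
        have hj := IWOGA.measurable_aug (p := p n) j
        exact ((hi.mul hj).abs.const_mul θ₀).exp.ennreal_ofReal)] at h
  have hBm := hx.mono fun n hn => IWOGA.abs_integral_aug_mul_aug_le hθ₀ hK0.le hn
  obtain ⟨Ktr, -, hKtr⟩ := IWOGA.exists_eventually_le_of_limsup_lt_top hexp_tr
  obtain ⟨Kte, -, hKte⟩ := IWOGA.exists_eventually_le_of_limsup_lt_top hexp_te
  have hnoise' : ∃ c : ℝ, 0 < c ∧ ∀ᶠ n in atTop, ENNReal.ofReal c ≤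
      ∫⁻ z, ENNReal.ofReal ((IWOGA.residual (α n) (β n) z) ^ 2) ∂(M n).testLaw := by
    obtain ⟨c, hc0, hc⟩ := ENNReal.lt_iff_exists_real_btwn.mp hnoise
    refine ⟨c, ENNReal.ofReal_pos.mp hc.1, ?_⟩
    exact (eventually_lt_of_lt_liminf hc.2).mono fun n hn => hn.le
  set B₁ := max 1 (K / θ₀)
  obtain ⟨A, c, E₁, hA, hc, hE₁, hbad⟩ := IWOGA.tendsto_measure_not_sampleAccuracy hblp hS he
    hγ.2 hp hp' hθ₀ hη hq hMw hMη (le_max_left 1 (K / θ₀)) hw' hx'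
    (hBm.mono fun n hn i j => (hn i j).trans (le_max_right _ _)) ⟨Ktr, hKtr⟩ ⟨Kte, hKte⟩
    hnoise' hv happ_xx happ_xe happ_ee
  obtain ⟨c₀, hc₀, heig⟩ := heig
  obtain ⟨B, hbdd⟩ := hbdd
  -- The bound 1 gives kd ≤ 1 along the path, and c₀/(2A) keeps the sample covariance coercive on
  -- every model visited. The constant A was obtained before Mk, so there is no circularity.
  refine ⟨min 1 (c₀ / (2 * A)), by positivity, fun Mk hMk0 hMk => ?_⟩
  rintro ⟨L, hL, hpart⟩
  have hMkA : A * Mk ≤ c₀ / 2 := by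
    have h := hMk.trans (min_le_right _ _)
    rw [le_div_iff₀ (by positivity)] at h
    linarith
  have hR := IWOGA.riskConst_nonneg hA.le hc₀ hL.le
  -- `riskConst` involves the moment accuracy, the eigenvalue bound and L, but neither ξ nor its
  -- constant, which are introduced only afterwards.
  refine ⟨2 * IWOGA.riskConst A c₀ L / c + 1, by positivity, fun sa hsa ξ hξ => ?_⟩
  have hsa' : 2 * IWOGA.riskConst A c₀ L / c ≤ sa := by linarith
  have hsa0 : 0 ≤ sa := le_trans (by positivity) hsa'
  rw [div_le_iff₀ hc] at hsa'
  rintro ⟨Cξ, hCξ, hsparse⟩ J k hpath hmin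
  obtain ⟨C, d₀, hC, hd₀, hmain⟩ := IWOGA.exists_mcpe_le (B := max B 0) (Cd := B₁) hA hc₀ hL.le
    (le_max_right _ _) hCξ hξ (zero_le_one.trans (le_max_left _ _)) hMk0
    (hMk.trans (min_le_left _ _)) hMkA hc hE₁ hsa0 hsa'
  intro ε hε
  -- One constant serves every ε: the bound is deterministic on an event whose probability tends to
  -- one.
  refine ⟨C, ?_⟩
  filter_upwards [hpath, hmin, hbad.eventually_le_const (ENNReal.ofReal_pos.mpr hε), hBm,
    IWOGA.eventually_dRate_pos q η hp', (IWOGA.tendsto_dRate (η := η) hγ.2 hp hq).eventually_le_const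
      hd₀, hp'.eventually_ge_atTop 1, eventually_ge_atTop 1]
    with n hpathn hminn hbadn hBn hd hdd hpn hn
  refine (measure_mono fun ω hω => ?_).trans hbadn
  intro hacc
  rw [Set.mem_ofPred_eq, ← not_le] at hω
  refine hω ?_
  have hρ : 0 < IWOGA.dRate p q η n ^ ((1 + 2 * ξ) / (1 + ξ)) := Real.rpow_pos_of_pos hd _
  rw [abs_of_nonneg (div_nonneg IWOGA.mcpe_nonneg hρ.le), div_le_iff₀ hρ]
  rw [← hW] at hacc
  refine hmain hpn hd hdd (hblp n) hacc (fun t => IWOGA.residual_eq_iff.mp (he n t ω)) (heig n hn)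
    (fun j => ?_) ?_ (hsparse n hn) (hpart n hn) (hpathn ω) (hminn ω)
  · have h := hBn j.succ j.succ
    rw [IWOGA.SigmaTe_eq (hblp n)]
    have h1 : ∫ u : Fin (p n) → ℝ, u j * u j ∂(M n).testX ≤ K / θ₀ := by
      simpa [IWOGA.aug] using (le_abs_self _).trans h
    nlinarith [mul_self_nonneg (∫ u : Fin (p n) → ℝ, u j ∂(M n).testX),
      le_max_right 1 (K / θ₀)]
  · exact le_max_of_le_left (by linarith [hbdd n hn, abs_nonneg (α n)])
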